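/- All graphs are finite and simple. A clique cutset of a graph $G$ is a (possibly empty) set $K$ of pairwise adjacent vertices such that $G\setminus K$ is disconnected (has two vertices not joined by a path). For a fixed integer $k\ge 1$, an instance of $k$-Induced Disjoint Paths consists of a graph $G$ and $k$ pairs $(s_1,t_1),\dots,(s_k,t_k)$ of vertices of $G$ such that all $2k$ vertices are distinct and the only edges between them are of the form $s_it_i$; the question is whether $G$ contains paths $P_i$ from $s_i$ to $t_i$ ($1\le i\le k$) such that for all $i\ne j$ the paths $P_i$ and $P_j$ are vertex-disjoint and no vertex of $P_i$ is adjacent to a vertex of $P_j$. **Theorem.** Let $\mathcal G$ be a class of graphs that is closed under taking induced subgraphs, and let $\mathcal G_{\mathrm{basic}}\subseteq\mathcal G$ be such that every graph in $\mathcal G$ belongs to $\mathcal G_{\mathrm{basic}}$ or has a clique cutset. Let $c\ge 1$ be a real constant (not depending on $k$), and assume that for every integer $k\ge 1$ there is an algorithm that solves $k$-Induced Disjoint Paths in time $O(n^c)$ on all instances whose graph belongs to $\mathcal G_{\mathrm{basic}}$. Then for every integer $k\ge 1$ there is an algorithm that solves $k$-Induced Disjoint Paths in time $O(n^{2k+c})$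 on all instances whose graph belongs to $\mathcal G$. Here $n$ is the number of vertices of $G$, the constants in the $O$-notation may depend on $k$ (and on the classes and $c$), and an algorithm is a program for a unit-cost random access machine on natural numbers (with addition and truncated subtraction) that is given $n$, the terminals, and the adjacency matrix of $G$, any entry of which can be read in one step. -/

import Mathlib

/-! ## Graph classes, clique cutsets -/

/-- A class of finite simple graphs, given by its members on the vertex sets `{0, …, n-1}`.
No closure under isomorphism is built in. -/
abbrev GraphClass : Type := ∀ n : ℕ, Set (SimpleGraph (Fin n))

/-- The class is closed under taking induced subgraphs (up to isomorphism): `H ↪g G` is the type of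
embeddings of `H` onto an induced subgraph of `G`. In particular it is closed under isomorphism. -/
def GraphClass.Hereditary (𝒢 : GraphClass) : Prop :=
  ∀ (m n : ℕ) (H : SimpleGraph (Fin m)) (G : SimpleGraph (Fin n)),
    Nonempty (H ↪g G) → G ∈ 𝒢 n → H ∈ 𝒢 m

/-- `G` has a (possibly empty) clique whose removal leaves a disconnected graph, that is, one with
two vertices that are not joined by a path (so the graph without vertices is not disconnected). -/
def HasCliqueCutset {V : Type*} (G : SimpleGraph V) : Prop :=
  ∃ K : Set V, G.IsClique K ∧ ¬ (G.induce Kᶜ).Preconnected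

/-- `𝒢` is `ℬ`-decomposable using clique cutsets. -/
structure GraphClass.DecomposableUsingCliqueCutsets (𝒢 ℬ : GraphClass) : Prop where
  hereditary : 𝒢.Hereditary
  basic_subset : ∀ n, ℬ n ⊆ 𝒢 n
  basic_or_cutset : ∀ (n : ℕ) (G : SimpleGraph (Fin n)), G ∈ 𝒢 n → G ∈ ℬ n ∨ HasCliqueCutset G

/-! ## The problem `k`-Induced Disjoint Paths -/

/-- The pairs `(s 0, t 0), …, (s (k-1), t (k-1))` of an instance on the graph `G`: the `2k`
terminals are distinct and the only edges between them are of the form `s i`–`t i`. -/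
structure IDPInstance {V : Type*} (G : SimpleGraph V) (k : ℕ) where
  s : Fin k → V
  t : Fin k → V
  distinct : Function.Injective (Sum.elim s t)
  nonadj : ∀ i j, i ≠ j → ¬ G.Adj (s i) (s j) ∧ ¬ G.Adj (s i) (t j) ∧ ¬ G.Adj (t i) (t j)

/-- There are paths `P i` from `s i` to `t i` that are pairwise vertex-disjoint and pairwise
without edges between them. -/
def IDPInstance.HasSolution {V : Type*} {G : SimpleGraph V} {k : ℕ} (W : IDPInstance G k) : Prop :=
  ∃ P : ∀ i : Fin k, G.Path (W.s i) (W.t i),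
    ∀ i j, i ≠ j → ∀ u ∈ (P i).1.support, ∀ v ∈ (P j).1.support, u ≠ v ∧ ¬ G.Adj u v

/-! ## The machine model

A unit-cost random access machine on natural numbers with addition and truncated subtraction (but
no multiplication), programmed in a structured language. The input graph is given by its adjacency
matrix, of which one entry can be read in one step. -/

namespace RAM

/-- Finitely many of the registers `reg 0, reg 1, …` occur in a given program;
`mem` is the indirectly addressed memory. -/
structure State where
  reg : ℕ → ℕ
  mem : ℕ → ℕ

/-- The elementary operations; the arguments `r a b` are register numbers. -/
inductive Op where
  /-- do nothing -/
  | skip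
  /-- `reg r := c` -/
  | const (r c : ℕ)
  /-- `reg r := reg a + reg b` -/
  | add (r a b : ℕ)
  /-- `reg r := reg a - reg b`, which is `0` if `reg a < reg b` -/
  | sub (r a b : ℕ)
  /-- `reg r := mem (reg a)` -/
  | load (r a : ℕ)
  /-- `mem (reg a) := reg b` -/
  | store (a b : ℕ)
  /-- `reg r :=` the entry of the adjacency matrix in row `reg a` and column `reg b` -/
  | edge (r a b : ℕ)

/-- Programs: an elementary operation; first `p`, then `q`; if `reg r ≠ 0` then `p` else `q`;
while `reg r ≠ 0` do `p`. -/
inductive Prog where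
  | op (o : Op)
  | seq (p q : Prog)
  | ite (r : ℕ) (p q : Prog)
  | loop (r : ℕ) (p : Prog)

open Classical in
/-- The adjacency matrix, extended by `0` outside of the range of the vertices. -/
noncomputable def adjEntry {n : ℕ} (G : SimpleGraph (Fin n)) (x y : ℕ) : ℕ :=
  if ∃ (hx : x < n) (hy : y < n), G.Adj ⟨x, hx⟩ ⟨y, hy⟩ then 1 else 0

/-- The state after an elementary operation, on the input graph `G`. -/
noncomputable def Op.exec {n : ℕ} (G : SimpleGraph (Fin n)) (σ : State) : Op → State
  | .skip => σ
  | .const r c => { σ with reg := Function.update σ.reg r c }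
  | .add r a b => { σ with reg := Function.update σ.reg r (σ.reg a + σ.reg b) }
  | .sub r a b => { σ with reg := Function.update σ.reg r (σ.reg a - σ.reg b) }
  | .load r a => { σ with reg := Function.update σ.reg r (σ.mem (σ.reg a)) }
  | .store a b => { σ with mem := Function.update σ.mem (σ.reg a) (σ.reg b) }
  | .edge r a b =>
      { σ with reg := Function.update σ.reg r (adjEntry G (σ.reg a) (σ.reg b)) }

/-- `Run G p σ τ σ'`: on the input graph `G`, the program `p` started in state `σ` halts in state
`σ'` after exactly `τ` steps. Every elementary operation and every test counts as one step. -/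
inductive Run {n : ℕ} (G : SimpleGraph (Fin n)) : Prog → State → ℕ → State → Prop where
  | op (o : Op) (σ : State) : Run G (.op o) σ 1 (o.exec G σ)
  | seq {p q : Prog} {σ₁ σ₂ σ₃ : State} {τ₁ τ₂ : ℕ} :
      Run G p σ₁ τ₁ σ₂ → Run G q σ₂ τ₂ σ₃ → Run G (.seq p q) σ₁ (τ₁ + τ₂) σ₃
  | ite_true {r : ℕ} {p q : Prog} {σ σ' : State} {τ : ℕ} :
      σ.reg r ≠ 0 → Run G p σ τ σ' → Run G (.ite r p q) σ (τ + 1) σ'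
  | ite_false {r : ℕ} {p q : Prog} {σ σ' : State} {τ : ℕ} :
      σ.reg r = 0 → Run G q σ τ σ' → Run G (.ite r p q) σ (τ + 1) σ'
  | loop_done {r : ℕ} {p : Prog} {σ : State} :
      σ.reg r = 0 → Run G (.loop r p) σ 1 σ
  | loop_step {r : ℕ} {p : Prog} {σ₁ σ₂ σ₃ : State} {τ₁ τ₂ : ℕ} :
      σ₁.reg r ≠ 0 → Run G p σ₁ τ₁ σ₂ → Run G (.loop r p) σ₂ τ₂ σ₃ →
      Run G (.loop r p) σ₁ (τ₁ + τ₂ + 1) σ₃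

/-- The initial state on an instance: register `0` holds the number `n` of vertices, register
`2 * i + 1` holds `s i`, register `2 * i + 2` holds `t i`; all else is `0`. -/
def initialState {n k : ℕ} {G : SimpleGraph (Fin n)} (W : IDPInstance G k) : State where
  reg x :=
    if x = 0 then n
    else if h : (x - 1) / 2 < k then
      if x % 2 = 1 then (W.s ⟨(x - 1) / 2, h⟩ : ℕ) else (W.t ⟨(x - 1) / 2, h⟩ : ℕ)
    else 0
  mem _ := 0

end RAM

/-- Some program decides `k`-Induced Disjoint Paths in `O(f n)` steps for all instances whose graph
belongs to `𝒢`, where `n` is the number of vertices. The answer, `1` for YES, is left in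
register `0`; nothing is required of the program on other inputs. -/
def IDPSolvableInTime (𝒢 : GraphClass) (k : ℕ) (f : ℕ → ℝ) : Prop :=
  ∃ (p : RAM.Prog) (C : ℝ), ∀ (n : ℕ) (G : SimpleGraph (Fin n)), G ∈ 𝒢 n →
    ∀ W : IDPInstance G k, ∃ (τ : ℕ) (σ : RAM.State),
      RAM.Run G p (RAM.initialState W) τ σ ∧ (τ : ℝ) ≤ C * f n ∧ (σ.reg 0 = 1 ↔ W.HasSolution)

/-! The proof is by induction on the number `k` of pairs. A single pair is a question of
connectivity. For `k ≥ 2` a vertex set `W`, initially all of `V`, is shrunk along clique separators.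
The invariant `Reduced` says that every component of `G \ W` contains at most one terminal and that
its neighbours in `W` form a clique. Under this invariant a clique `K` that separates `G[W]` also
separates `G` (`Cut.comp_inter`, `Cut.separation`). If one side of `K` in `G` contains at most one
terminal, the part of `W` on that side can be deleted without violating the invariant
(`Cut.reduced_diff`, `Cut.reduced_union`). Each deletion removes a vertex, so `n` rounds suffice.

If both sides of `K` contain two terminals, the instance is split. Since `K` is a clique, at most
one pair of a solution uses `K`, and its connection can be rerouted so that it uses at most two
vertices `x`, `y` of `K`. Once `x` and `y` are guessed, the two sides are independent instances
(`Separation.split`, `Separation.of_uncrossed`, `Separation.of_crossed`), and the two terminals on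
each side guarantee that both have fewer than `k` pairs (`Separation.touching_ne_univ` and its
companions). This costs `n ^ 2 * n ^ (2 * (k - 1) + c) = n ^ (2 * k + c)`.

If no clique separates `G[W]`, then `G[W]` has no clique cutset and is basic. A connection that
starts at a terminal outside of `W` enters `W` through a neighbour of the component of that
terminal, a port; excursions out of `W` can be replaced by single edges, because they leave and
return through a clique (`Reduced.project`). Hence it suffices to guess `2 * k` ports and to solve
the resulting instance on `G[W]`, at cost `n ^ (2 * k) * n ^ c`. The two ports of a pair might
coincide, which is not a legal instance; then this common port `x` already connects the pair, and
the other `k - 1` pairs must be solved outside of the closed neighbourhood of `x` (`solvable_ports`,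
`solvable_of_ports`, `solvable_of_common_port`).

A separator is found in time `n ^ 4` as follows. Two nonadjacent neighbours of `u` that are linked
outside of the closed neighbourhood of `u` are not separated by any clique. From such a pair a set
with the same property is grown greedily; when it cannot grow any more, every component of the rest
of `W` has a clique as its neighbourhood (`Cut.of_closed`). If no such pair exists, a closed
neighbourhood serves instead (`Cut.of_nbhd`), or `W` is complete. The `n` rounds take `n ^ 5` steps,
which is affordable because `k ≥ 2` and `c ≥ 1`.

For the running times, all auxiliary computations are first-order formulas and commands over unary
and ternary relations on the vertices; the exponent of the cost is read off from quantifiers and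
loops (`Fml.evalF`, `Com.cmd`). The given programs are interpreted on induced subgraphs with
constant overhead (`Run.simulate`). Their memory carries version stamps, so that it need not be
cleared between the many calls (`EvalF.solve`). -/

namespace RAM

/-! ## Halting within a time bound -/

/-- Started in `σ`, the program `p` halts within `T` steps in a state satisfying `Q`. -/
def Halts {n : ℕ} (G : SimpleGraph (Fin n)) (p : Prog) (σ : State) (T : ℝ) (Q : State → Prop) :
    Prop :=
  ∃ (τ : ℕ) (σ' : State), Run G p σ τ σ' ∧ (τ : ℝ) ≤ T ∧ Q σ'

section
variable {n : ℕ} {G : SimpleGraph (Fin n)}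

theorem Halts.mono {p : Prog} {σ : State} {T T' : ℝ} {Q Q' : State → Prop}
    (h : Halts G p σ T Q) (hT : T ≤ T') (hQ : ∀ σ', Q σ' → Q' σ') : Halts G p σ T' Q' := by
  obtain ⟨τ, σ', hr, hτ, hq⟩ := h
  exact ⟨τ, σ', hr, hτ.trans hT, hQ _ hq⟩

theorem Halts.op {o : Op} {σ : State} {T : ℝ} {Q : State → Prop} (hT : 1 ≤ T)
    (h : Q (o.exec G σ)) : Halts G (.op o) σ T Q :=
  ⟨1, _, .op o σ, by simpa using hT, h⟩

theorem Halts.seq {p q : Prog} {σ : State} {T₁ T₂ T : ℝ} {Q : State → Prop}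
    (h : Halts G p σ T₁ (fun σ₁ => Halts G q σ₁ T₂ Q)) (hT : T₁ + T₂ ≤ T) :
    Halts G (.seq p q) σ T Q := by
  obtain ⟨τ₁, σ₁, hr₁, hτ₁, τ₂, σ₂, hr₂, hτ₂, hq⟩ := h
  refine ⟨τ₁ + τ₂, σ₂, .seq hr₁ hr₂, ?_, hq⟩
  push_cast; linarith

theorem Halts.ite {r : ℕ} {p q : Prog} {σ : State} {T T' : ℝ} {Q : State → Prop}
    (h₁ : σ.reg r ≠ 0 → Halts G p σ T Q) (h₂ : σ.reg r = 0 → Halts G q σ T Q)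
    (hT : T + 1 ≤ T') : Halts G (.ite r p q) σ T' Q := by
  by_cases h : σ.reg r = 0
  · obtain ⟨τ, σ', hr, hτ, hq⟩ := h₂ h
    exact ⟨τ + 1, σ', .ite_false h hr, by push_cast; linarith, hq⟩
  · obtain ⟨τ, σ', hr, hτ, hq⟩ := h₁ h
    exact ⟨τ + 1, σ', .ite_true h hr, by push_cast; linarith, hq⟩

/-- Apart from the interpreted programs, every loop decreases a counter register to zero; so
termination and the time bound come from the index of the invariant. Each pass pays one extra step
for the test, and the last test fails. -/
theorem Halts.countdown {r : ℕ} {p : Prog} {T : ℝ} (Inv : ℕ → State → Prop)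
    (hr : ∀ j σ, Inv j σ → σ.reg r = j)
    (hp : ∀ j σ, Inv (j + 1) σ → Halts G p σ T (Inv j)) :
    ∀ j σ, Inv j σ → Halts G (.loop r p) σ (j * (T + 1) + 1) (Inv 0) := by
  intro j
  induction j with
  | zero => intro σ h; exact ⟨1, σ, .loop_done (hr _ _ h), by simp, h⟩
  | succ j ih =>
    intro σ h
    obtain ⟨τ₁, σ₁, hr₁, hτ₁, h₁⟩ := hp j σ h
    obtain ⟨τ₂, σ₂, hr₂, hτ₂, h₂⟩ := ih σ₁ h₁
    refine ⟨τ₁ + τ₂ + 1, σ₂, .loop_step (by rw [hr _ _ h]; omega) hr₁ hr₂, ?_, h₂⟩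
    push_cast; linarith

/-- A straight-line program. -/
def block : List Op → Prog
  | [] => .op .skip
  | o :: os => .seq (.op o) (block os)

theorem Halts.block (os : List Op) : ∀ {σ : State} {T : ℝ} {Q : State → Prop},
    (os.length + 1 : ℝ) ≤ T → Q (os.foldl (fun σ o => o.exec G σ) σ) →
    Halts G (block os) σ T Q := by
  induction os with
  | nil => intro σ T Q hT h; exact Halts.op (by simpa using hT) h
  | cons o os ih =>
    intro σ T Q hT h
    refine Halts.seq (T₁ := 1) (T₂ := os.length + 1) (Halts.op le_rfl (ih le_rfl h)) ?_
    simp only [List.length_cons] at hT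
    push_cast at hT; linarith

end

/-! ## Register layout

Registers `0, …, 2 * k` hold the input and are never changed. -/

/-- Registers for auxiliary values. -/
def rSys (k i : ℕ) : ℕ := 2 * k + 1 + i
/-- constant `1` -/
abbrev rOne (k : ℕ) : ℕ := rSys k 0
/-- `n ^ 2` -/
abbrev rSq (k : ℕ) : ℕ := rSys k 1
/-- `n ^ 3` -/
abbrev rCu (k : ℕ) : ℕ := rSys k 2
/-- the current version of the simulated memory -/
abbrev rVer (k : ℕ) : ℕ := rSys k 3
/-- the result of the evaluation of a formula -/
abbrev rRes (k : ℕ) : ℕ := rSys k 4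
abbrev rA (k : ℕ) : ℕ := rSys k 5
abbrev rB (k : ℕ) : ℕ := rSys k 6
abbrev rC (k : ℕ) : ℕ := rSys k 7
/-- the number of vertices of the simulated input -/
abbrev rM (k : ℕ) : ℕ := rSys k 8
/-- registers of the loop variable `i`: for `j = 0, 1, 2` its value times `n ^ j`,
for `j = 3` a counter, for `j = 4` an accumulator -/
def rVar (k i j : ℕ) : ℕ := 2 * k + 12 + 6 * i + j
/-- register `i` of the simulated machine -/
def rSim (k i : ℕ) : ℕ := 2 * k + 12 + 6 * i + 5

section
variable {k i j i' j' : ℕ}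

@[simp] theorem rSys_inj : rSys k i = rSys k j ↔ i = j := by unfold rSys; omega
@[simp] theorem rSim_inj : rSim k i = rSim k j ↔ i = j := by unfold rSim; omega
@[simp] theorem rVar_inj (hj : j < 5) (hj' : j' < 5) :
    rVar k i j = rVar k i' j' ↔ i = i' ∧ j = j' := by unfold rVar; omega
@[simp] theorem rSys_ne_rVar (h : i < 11) : rSys k i ≠ rVar k i' j := by
  unfold rSys rVar; omega
@[simp] theorem rVar_ne_rSys (h : i < 11) : rVar k i' j ≠ rSys k i := by
  unfold rSys rVar; omega
@[simp] theorem rSys_ne_rSim (h : i < 11) : rSys k i ≠ rSim k j := by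
  unfold rSys rSim; omega
@[simp] theorem rSim_ne_rSys (h : i < 11) : rSim k j ≠ rSys k i := by
  unfold rSys rSim; omega
@[simp] theorem rSim_ne_rVar (hj : j < 5) : rSim k i ≠ rVar k i' j := by
  unfold rSim rVar; omega
@[simp] theorem rVar_ne_rSim (hj : j < 5) : rVar k i' j ≠ rSim k i := by
  unfold rSim rVar; omega
@[simp] theorem zero_ne_rSys : 0 ≠ rSys k i := by unfold rSys; omega
@[simp] theorem zero_ne_rVar : 0 ≠ rVar k i j := by unfold rVar; omega

end

/-- Registers that are preserved at level `ℓ`. -/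
def Prot (k ℓ r : ℕ) : Prop :=
  -- First the input and the constants `1`, `n ^ 2`, `n ^ 3`; then the registers of the variables
  -- below `ℓ`. Residue `5` is excluded because the simulated registers are interleaved with those
  -- of the variables, which leaves room for arbitrarily many of both.
  r < 2 * k + 4 ∨ (2 * k + 12 ≤ r ∧ r < 2 * k + 12 + 6 * ℓ ∧ (r - (2 * k + 12)) % 6 ≠ 5)

theorem Prot.var {k ℓ i j : ℕ} (hi : i < ℓ) (hj : j < 5) : Prot k ℓ (rVar k i j) := by
  unfold Prot rVar; omega

theorem Prot.low {k ℓ r : ℕ} (h : r ≤ 2 * k) : Prot k ℓ r := by unfold Prot; omega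

theorem Prot.sys {k ℓ i : ℕ} (h : i < 3) : Prot k ℓ (rSys k i) := by unfold Prot rSys; omega

theorem Prot.mono {k ℓ ℓ' r : ℕ} (h : Prot k ℓ r) (hl : ℓ ≤ ℓ') : Prot k ℓ' r := by
  unfold Prot at *; omega

/-- Change one register. -/
def State.setReg (σ : State) (r x : ℕ) : State := { σ with reg := Function.update σ.reg r x }

@[simp] theorem State.setReg_mem (σ : State) (r x : ℕ) : (σ.setReg r x).mem = σ.mem := rfl

@[simp] theorem State.setReg_self (σ : State) (r x : ℕ) : (σ.setReg r x).reg r = x := by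
  simp [State.setReg]

theorem State.setReg_ne (σ : State) {r q : ℕ} (x : ℕ) (h : q ≠ r) :
    (σ.setReg r x).reg q = σ.reg q := by
  simp [State.setReg, h]

theorem State.setReg_reg (σ : State) (r q x : ℕ) :
    (σ.setReg r x).reg q = if q = r then x else σ.reg q := by
  simp [State.setReg, Function.update_apply]

/-- Change one memory cell. -/
def State.setMem (σ : State) (a x : ℕ) : State := { σ with mem := Function.update σ.mem a x }

@[simp] theorem State.setMem_reg (σ : State) (r x : ℕ) : (σ.setMem r x).reg = σ.reg := rfl

theorem State.setMem_mem (σ : State) (a b x : ℕ) :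
    (σ.setMem a x).mem b = if b = a then x else σ.mem b := by
  simp [State.setMem, Function.update_apply]

section
variable {n : ℕ} (G : SimpleGraph (Fin n)) (σ : State)
@[simp] theorem exec_skip : Op.exec G σ .skip = σ := rfl
@[simp] theorem exec_const (r c : ℕ) : Op.exec G σ (.const r c) = σ.setReg r c := rfl
@[simp] theorem exec_add (r a b : ℕ) :
    Op.exec G σ (.add r a b) = σ.setReg r (σ.reg a + σ.reg b) := rfl
@[simp] theorem exec_sub (r a b : ℕ) :
    Op.exec G σ (.sub r a b) = σ.setReg r (σ.reg a - σ.reg b) := rfl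
@[simp] theorem exec_load (r a : ℕ) :
    Op.exec G σ (.load r a) = σ.setReg r (σ.mem (σ.reg a)) := rfl
@[simp] theorem exec_store (a b : ℕ) :
    Op.exec G σ (.store a b) = σ.setMem (σ.reg a) (σ.reg b) := rfl
@[simp] theorem exec_edge (r a b : ℕ) :
    Op.exec G σ (.edge r a b) = σ.setReg r (adjEntry G (σ.reg a) (σ.reg b)) := rfl
end

theorem adjEntry_ne_zero {n : ℕ} (G : SimpleGraph (Fin n)) (u v : Fin n) :
    adjEntry G u v ≠ 0 ↔ G.Adj u v := by
  simp [adjEntry]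

/-! ## Frames -/

/-- What the evaluation of a formula at level `ℓ` leaves unchanged; `pure` evaluations do not
touch the memory and the simulated machine. -/
structure Fr (pure : Bool) (k n ℓ : ℕ) (σ σ' : State) : Prop where
  reg : ∀ r, Prot k ℓ r → σ'.reg r = σ.reg r
  sim : pure = true →
    (∀ i, σ'.reg (rSim k i) = σ.reg (rSim k i)) ∧ σ'.reg (rVer k) = σ.reg (rVer k) ∧
      σ'.mem = σ.mem
  -- Among the cells `3 * a + 2`, the first `n ^ 3` (region `0`) are scratch space for the vertex
  -- table of a simulated subgraph; the regions from `1` on are kept.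
  mem : ∀ a, n * n * n ≤ a → σ'.mem (3 * a + 2) = σ.mem (3 * a + 2)
  -- No stamp is newer than the version counter, so that incrementing the counter invalidates the
  -- whole simulated memory at once.
  stamp : (∀ a, σ.mem (3 * a + 1) ≤ σ.reg (rVer k)) →
    ∀ a, σ'.mem (3 * a + 1) ≤ σ'.reg (rVer k)

theorem Fr.refl (pure : Bool) (k n ℓ : ℕ) (σ : State) : Fr pure k n ℓ σ σ :=
  ⟨fun _ _ => rfl, fun _ => ⟨fun _ => rfl, rfl, rfl⟩, fun _ _ => rfl, fun h => h⟩

theorem Fr.trans {pure : Bool} {k n ℓ : ℕ} {σ₁ σ₂ σ₃ : State} (h : Fr pure k n ℓ σ₁ σ₂)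
    (h' : Fr pure k n ℓ σ₂ σ₃) : Fr pure k n ℓ σ₁ σ₃ where
  reg r hr := (h'.reg r hr).trans (h.reg r hr)
  sim hp := ⟨fun i => ((h'.sim hp).1 i).trans ((h.sim hp).1 i),
    (h'.sim hp).2.1.trans (h.sim hp).2.1, (h'.sim hp).2.2.trans (h.sim hp).2.2⟩
  mem a ha := (h'.mem a ha).trans (h.mem a ha)
  stamp hs := h'.stamp (h.stamp hs)

theorem Fr.level {pure : Bool} {k n ℓ ℓ' : ℕ} {σ₁ σ₂ : State} (h : Fr pure k n ℓ' σ₁ σ₂)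
    (hl : ℓ ≤ ℓ') : Fr pure k n ℓ σ₁ σ₂ :=
  ⟨fun r hr => h.reg r (hr.mono hl), h.sim, h.mem, h.stamp⟩

theorem Fr.impure {pure : Bool} {k n ℓ : ℕ} {σ₁ σ₂ : State} (h : Fr pure k n ℓ σ₁ σ₂) :
    Fr false k n ℓ σ₁ σ₂ :=
  ⟨h.reg, fun h => by simp at h, h.mem, h.stamp⟩

/-- Registers that can be changed freely at level `ℓ`. -/
def Free (k ℓ r : ℕ) : Prop :=
  ¬ Prot k ℓ r ∧ r ≠ rVer k ∧ ¬ (2 * k + 12 ≤ r ∧ (r - (2 * k + 12)) % 6 = 5)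

theorem Fr.setReg {pure : Bool} {k n ℓ r : ℕ} {σ₁ σ₂ : State} (h : Fr pure k n ℓ σ₁ σ₂)
    (hr : Free k ℓ r) (x : ℕ) : Fr pure k n ℓ σ₁ (σ₂.setReg r x) := by
  refine h.trans ⟨fun q hq => ?_, fun _ => ⟨fun i => ?_, ?_, rfl⟩, fun _ _ => rfl, fun hs a => ?_⟩
  · exact State.setReg_ne _ _ (by rintro rfl; exact hr.1 hq)
  · refine State.setReg_ne _ _ ?_
    rintro rfl
    exact hr.2.2 (by unfold rSim; omega)
  · exact State.setReg_ne _ _ hr.2.1.symm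
  · rw [State.setReg_ne _ _ hr.2.1.symm]; exact hs a

theorem free_sys {k ℓ i : ℕ} (h₁ : 4 ≤ i) (h₂ : i < 11) : Free k ℓ (rSys k i) := by
  unfold Free Prot rVer rSys; omega

theorem free_var {k ℓ i j : ℕ} (hi : ℓ ≤ i) (hj : j < 5) : Free k ℓ (rVar k i j) := by
  unfold Free Prot rVer rSys rVar; omega

/-! ## Loops over the vertices -/

/-- Run `p` for all values `0, …, n - 1` of the variable `ℓ`. -/
def forP (k ℓ : ℕ) (p : Prog) : Prog :=
  .seq (block [.const (rVar k ℓ 0) 0, .const (rVar k ℓ 1) 0, .const (rVar k ℓ 2) 0,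
      .add (rVar k ℓ 3) 0 (rVar k ℓ 0)])
    (.loop (rVar k ℓ 3) (.seq p (block [.add (rVar k ℓ 0) (rVar k ℓ 0) (rOne k),
      .add (rVar k ℓ 1) (rVar k ℓ 1) 0, .add (rVar k ℓ 2) (rVar k ℓ 2) (rSq k),
      .sub (rVar k ℓ 3) (rVar k ℓ 3) (rOne k)])))

/-- The machine cannot multiply, so the multiples `v * n` and `v * n ^ 2` that are needed for
addresses are carried along by addition. The body must leave registers `0` to `3` of the variable
alone, while register `4` belongs to the body and may occur in the invariant. -/
theorem Halts.forP {n : ℕ} {G : SimpleGraph (Fin n)} {k ℓ : ℕ} {p : Prog} {T : ℝ} {σ : State}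
    (Inv : ℕ → State → Prop)
    (hconst : ∀ v σ, Inv v σ → σ.reg 0 = n ∧ σ.reg (rOne k) = 1 ∧ σ.reg (rSq k) = n * n)
    (hinv : ∀ v σ j x, j < 4 → Inv v σ → Inv v (σ.setReg (rVar k ℓ j) x))
    (hbody : ∀ v σ, v < n → Inv v σ → σ.reg (rVar k ℓ 0) = v → σ.reg (rVar k ℓ 1) = v * n →
      σ.reg (rVar k ℓ 2) = v * (n * n) → Halts G p σ T (fun σ' => Inv (v + 1) σ' ∧
        ∀ j < 4, σ'.reg (rVar k ℓ j) = σ.reg (rVar k ℓ j)))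
    (h0 : Inv 0 σ) : Halts G (forP k ℓ p) σ (n * (T + 6) + 6) (Inv n) := by
  refine Halts.seq (T₁ := 5) (T₂ := n * ((T + 5) + 1) + 1) ?_ (by linarith)
  refine Halts.block _ (by norm_num) ?_
  let J : ℕ → State → Prop := fun j σ => ∃ v, v + j = n ∧ Inv v σ ∧ σ.reg (rVar k ℓ 3) = j ∧
    σ.reg (rVar k ℓ 0) = v ∧ σ.reg (rVar k ℓ 1) = v * n ∧ σ.reg (rVar k ℓ 2) = v * (n * n)
  refine (Halts.countdown (T := T + 5) J ?_ ?_ n _ ?_).mono le_rfl ?_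
  · rintro j σ ⟨v, -, -, h, -⟩; exact h
  · rintro j σ ⟨v, hv, hI, h3, hv0, hv1, hv2⟩
    refine Halts.seq (T₁ := T) (T₂ := 5) ?_ le_rfl
    refine (hbody v σ (by omega) hI hv0 hv1 hv2).mono le_rfl ?_
    rintro σ' ⟨hI', hsame⟩
    refine Halts.block _ (by norm_num) ?_
    obtain ⟨c0, c1, c2⟩ := hconst _ _ hI'
    have e0 := hsame 0 (by omega)
    have e1 := hsame 1 (by omega)
    have e2 := hsame 2 (by omega)
    have e3 := hsame 3 (by omega)
    refine ⟨v + 1, by omega, ?_, ?_, ?_, ?_, ?_⟩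
    · simp only [List.foldl, exec_add, exec_sub]
      exact hinv _ _ _ _ (by omega) (hinv _ _ _ _ (by omega) (hinv _ _ _ _ (by omega)
        (hinv _ _ _ _ (by omega) hI')))
    · simp [State.setReg_reg, e3, h3, c1]
    · simp [State.setReg_reg, e0, hv0, c1]
    · simp [State.setReg_reg, e1, hv1, c0]; ring
    · simp [State.setReg_reg, e2, hv2, c2]; ring
  · obtain ⟨c0, c1, c2⟩ := hconst _ _ h0
    refine ⟨0, by omega, ?_, ?_, ?_, ?_, ?_⟩
    · simp only [List.foldl, exec_const, exec_add]
      exact hinv _ _ _ _ (by omega) (hinv _ _ _ _ (by omega) (hinv _ _ _ _ (by omega)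
        (hinv _ _ _ _ (by omega) h0)))
    all_goals simp [State.setReg_reg, c0]
  · rintro σ' ⟨v, hv, hI, -⟩
    obtain rfl : v = n := by omega
    exact hI

end RAM

namespace RAM

theorem State.ext {σ σ' : State} (h : σ.reg = σ'.reg) (h' : σ.mem = σ'.mem) : σ = σ' := by
  cases σ; cases σ'; simp_all

theorem rVar_ne_acc {k i j : ℕ} (hj : j < 4) : rVar k i j ≠ rVar k i 4 := by
  unfold rVar; omega

/-! ## Instances, stores and their representation -/

/-- An instance whose graph belongs to the class. -/
structure Input (𝒢 : GraphClass) (k : ℕ) where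
  n : ℕ
  G : SimpleGraph (Fin n)
  mem : G ∈ 𝒢 n
  W : IDPInstance G k

/-- Unary and ternary relations on the vertices. -/
structure Store (n : ℕ) where
  u : ℕ → Fin n → Prop
  t : ℕ → Fin n → Fin n → Fin n → Prop

/-- Properties of an instance, a store and the values of the variables. -/
abbrev Pred (𝒢 : GraphClass) (k : ℕ) : Type :=
  ∀ I : Input 𝒢 k, Store I.n → (ℕ → Fin I.n) → Prop

/-- The memory cell number `x` of region `q`. -/
def cell (n q x : ℕ) : ℕ := 3 * (q * (n * n * n) + x) + 2

variable {𝒢 : GraphClass} {k : ℕ}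

/-- The state represents the instance, the store and the values of the variables below `ℓ`. -/
structure Rep (ℓ : ℕ) (I : Input 𝒢 k) (S : Store I.n) (ρ : ℕ → Fin I.n) (σ : State) : Prop where
  n : σ.reg 0 = I.n
  s : ∀ i : Fin k, σ.reg (2 * i + 1) = I.W.s i
  t : ∀ i : Fin k, σ.reg (2 * i + 2) = I.W.t i
  one : σ.reg (rOne k) = 1
  sq : σ.reg (rSq k) = I.n * I.n
  cu : σ.reg (rCu k) = I.n * I.n * I.n
  var : ∀ i < ℓ, σ.reg (rVar k i 0) = ρ i ∧ σ.reg (rVar k i 1) = ρ i * I.n ∧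
    σ.reg (rVar k i 2) = ρ i * (I.n * I.n)
  un : ∀ R (i : Fin I.n), σ.mem (cell I.n (2 * R + 2) i) ≠ 0 ↔ S.u R i
  ter : ∀ R (i j l : Fin I.n),
    σ.mem (cell I.n (2 * R + 3) (i * (I.n * I.n) + j * I.n + l)) ≠ 0 ↔ S.t R i j l
  stamp : ∀ a, σ.mem (3 * a + 1) ≤ σ.reg (rVer k)

theorem cell_eq (n q x : ℕ) : cell n q x = 3 * (q * (n * n * n) + x) + 2 := rfl

theorem Fr.cell_eq {pu : Bool} {n ℓ : ℕ} {σ σ' : State} (h : Fr pu k n ℓ σ σ') {q : ℕ}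
    (hq : 1 ≤ q) (x : ℕ) : σ'.mem (cell n q x) = σ.mem (cell n q x) := by
  refine h.mem _ ?_
  have : 1 * (n * n * n) ≤ q * (n * n * n) := Nat.mul_le_mul_right _ hq
  omega

theorem Rep.of_fr {ℓ : ℕ} {I : Input 𝒢 k} {S : Store I.n} {ρ : ℕ → Fin I.n} {σ σ' : State}
    {pu : Bool} (h : Rep ℓ I S ρ σ) (hf : Fr pu k I.n ℓ σ σ') : Rep ℓ I S ρ σ' where
  n := (hf.reg _ (.low (by omega))).trans h.n
  s i := (hf.reg _ (.low (by omega))).trans (h.s i)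
  t i := (hf.reg _ (.low (by omega))).trans (h.t i)
  one := (hf.reg _ (.sys (by omega))).trans h.one
  sq := (hf.reg _ (.sys (by omega))).trans h.sq
  cu := (hf.reg _ (.sys (by omega))).trans h.cu
  var i hi := by
    rw [hf.reg _ (.var hi (by omega)), hf.reg _ (.var hi (by omega)),
      hf.reg _ (.var hi (by omega))]
    exact h.var i hi
  un R i := by rw [hf.cell_eq (by omega)]; exact h.un R i
  ter R i j l := by rw [hf.cell_eq (by omega)]; exact h.ter R i j l
  stamp := hf.stamp h.stamp

theorem Rep.snoc {ℓ : ℕ} {I : Input 𝒢 k} {S : Store I.n} {ρ : ℕ → Fin I.n} {σ : State}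
    (h : Rep ℓ I S ρ σ) {v : Fin I.n} (h0 : σ.reg (rVar k ℓ 0) = v)
    (h1 : σ.reg (rVar k ℓ 1) = v * I.n) (h2 : σ.reg (rVar k ℓ 2) = v * (I.n * I.n)) :
    Rep (ℓ + 1) I S (Function.update ρ ℓ v) σ :=
  { h with
    var := fun i hi => by
      rcases Nat.lt_succ_iff_lt_or_eq.1 hi with h' | rfl
      · rw [Function.update_of_ne h'.ne]; exact h.var i h'
      · rw [Function.update_self]; exact ⟨h0, h1, h2⟩ }

theorem Rep.drop {ℓ : ℕ} {I : Input 𝒢 k} {S : Store I.n} {ρ : ℕ → Fin I.n} {σ : State}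
    {v : Fin I.n} (h : Rep (ℓ + 1) I S (Function.update ρ ℓ v) σ) : Rep ℓ I S ρ σ :=
  { h with
    var := fun i hi => by
      have := h.var i (by omega)
      rwa [Function.update_of_ne hi.ne] at this }

/-! ## Vertex terms -/

/-- A variable or a terminal. -/
inductive Term (k : ℕ) where
  | var (i : ℕ)
  | src (j : Fin k)
  | tgt (j : Fin k)

/-- The value of a vertex term. -/
def Term.val : Term k → (I : Input 𝒢 k) → (ℕ → Fin I.n) → Fin I.n
  | .var i, _, ρ => ρ i
  | .src j, I, _ => I.W.s j
  | .tgt j, I, _ => I.W.t j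

/-- The register holding the value of a vertex term. -/
def Term.reg : Term k → ℕ
  | .var i => rVar k i 0
  | .src j => 2 * j + 1
  | .tgt j => 2 * j + 2

/-- The term is meaningful at level `ℓ`. -/
def Term.Below (ℓ : ℕ) : Term k → Prop
  | .var i => i < ℓ
  | _ => True

theorem Term.Below.mono {ℓ ℓ' : ℕ} {a : Term k} (h : a.Below ℓ) (hl : ℓ ≤ ℓ') : a.Below ℓ' := by
  cases a <;> simp only [Term.Below] at *; omega

theorem Term.val_update {ℓ : ℕ} {a : Term k} (h : a.Below ℓ) (I : Input 𝒢 k)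
    (ρ : ℕ → Fin I.n) (v : Fin I.n) : a.val I (Function.update ρ ℓ v) = a.val I ρ := by
  cases a <;> simp only [Term.val]
  exact Function.update_of_ne (by simp only [Term.Below] at h; omega) _ _

theorem Rep.term {ℓ : ℕ} {I : Input 𝒢 k} {S : Store I.n} {ρ : ℕ → Fin I.n} {σ : State}
    (h : Rep ℓ I S ρ σ) {a : Term k} (ha : a.Below ℓ) : σ.reg a.reg = a.val I ρ := by
  cases a with
  | var i => exact (h.var i ha).1
  | src j => exact h.s j
  | tgt j => exact h.t j

theorem Term.prot {ℓ : ℕ} {a : Term k} (ha : a.Below ℓ) : Prot k ℓ a.reg := by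
  cases a with
  | var i => exact .var ha (by omega)
  | src j => exact .low (by simp only [Term.reg]; omega)
  | tgt j => exact .low (by simp only [Term.reg]; omega)

theorem Term.reg_ne {a : Term k} {i : ℕ} (hi : i < 11) : a.reg ≠ rSys k i := by
  cases a with
  | var i => exact rVar_ne_rSys hi
  | src j => simp only [Term.reg, rSys]; omega
  | tgt j => simp only [Term.reg, rSys]; omega

/-! ## Addresses -/

/-- Add the contents of the registers `rs` to register `rA`. -/
def sumOps (k : ℕ) (rs : List ℕ) : List Op := rs.map fun r => .add (rA k) (rA k) r

theorem foldl_sumOps {n : ℕ} (G : SimpleGraph (Fin n)) (rs : List ℕ) (hrs : ∀ r ∈ rs, r ≠ rA k) :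
    ∀ σ : State, (sumOps k rs).foldl (fun σ o => o.exec G σ) σ =
      σ.setReg (rA k) (σ.reg (rA k) + (rs.map σ.reg).sum) := by
  induction rs with
  | nil => intro σ; simp [sumOps, State.setReg]
  | cons r rs ih =>
    intro σ
    have := ih (fun q hq => hrs q (by simp [hq])) (σ.setReg (rA k) (σ.reg (rA k) + σ.reg r))
    simp only [sumOps, List.map_cons, List.foldl_cons, exec_add] at this ⊢
    rw [this]
    have h2 : List.map (σ.setReg (rA k) (σ.reg (rA k) + σ.reg r)).reg rs = List.map σ.reg rs :=
      List.map_congr_left fun q hq => State.setReg_ne _ _ (hrs q (by simp [hq]))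
    rw [h2]
    simp [add_assoc, State.setReg]

/-- Compute in register `rA` the address of the cell of region `q` whose number is the sum of the
registers `rs`. -/
def addrOps (k q : ℕ) (rs : List ℕ) : List Op :=
  .const (rA k) 0 :: (sumOps k (List.replicate q (rCu k) ++ rs) ++
    [.add (rB k) (rA k) (rA k), .add (rA k) (rA k) (rB k), .const (rB k) 2,
      .add (rA k) (rA k) (rB k)])

/-- The region number `q` is a constant of the program, so `q * n ^ 3` is a sum of `q` copies of
`rCu`; the factor `3` is realised by adding the sum to its double. -/
theorem foldl_addrOps {n : ℕ} (G : SimpleGraph (Fin n)) (q : ℕ) (rs : List ℕ)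
    (hrs : ∀ r ∈ rs, r ≠ rA k) (σ : State) (hσ : σ.reg (rCu k) = n * n * n) :
    (addrOps k q rs).foldl (fun σ o => o.exec G σ) σ =
      (σ.setReg (rB k) 2).setReg (rA k) (cell n q (rs.map σ.reg).sum) := by
  have h2 : List.map (σ.setReg (rA k) 0).reg rs = List.map σ.reg rs :=
    List.map_congr_left fun q hq => State.setReg_ne _ _ (hrs q hq)
  simp only [addrOps, List.foldl_cons, List.foldl_append, exec_const]
  rw [foldl_sumOps]
  · refine State.ext (funext fun r => ?_) rfl
    by_cases hA : r = rA k
    · subst hA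
      simp [State.setReg_reg, h2, hσ, cell_eq]
      ring
    · by_cases hB : r = rB k
      · subst hB; simp [State.setReg_reg]
      · simp [State.setReg_reg, hA, hB]
  · intro r hr
    rcases List.mem_append.1 hr with h | h
    · rw [(List.mem_replicate.1 h).2]; simp
    · exact hrs r h

theorem length_addrOps (q : ℕ) (rs : List ℕ) : (addrOps k q rs).length = q + rs.length + 5 := by
  simp [addrOps, sumOps]; omega

/-! ## Evaluation of formulas -/

/-- A valuation exhibits a vertex. Thus `n ≥ 1` wherever formulas are evaluated, and constants are
absorbed into `n ^ d` for every `d ≥ 0`. -/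
theorem Input.one_le (I : Input 𝒢 k) (ρ : ℕ → Fin I.n) : 1 ≤ I.n :=
  (Nat.zero_le _).trans_lt (ρ 0).2

theorem one_le_rpow_natCast {n : ℕ} (hn : 1 ≤ n) {d : ℝ} (hd : 0 ≤ d) : 1 ≤ (n : ℝ) ^ d :=
  Real.one_le_rpow (by exact_mod_cast hn) hd

/-- Some program evaluates the predicate `φ` under the precondition `P` into register `rRes`, in
`O(n ^ d)` steps. -/
def EvalF (pu : Bool) (ℓ : ℕ) (P φ : Pred 𝒢 k) (d : ℝ) : Prop :=
  0 ≤ d ∧ ∃ (p : Prog) (C : ℝ), 0 ≤ C ∧ ∀ (I : Input 𝒢 k) (S : Store I.n) (ρ : ℕ → Fin I.n)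
    (σ : State), Rep ℓ I S ρ σ → P I S ρ → Halts I.G p σ (C * (I.n : ℝ) ^ d) fun σ' =>
      Fr pu k I.n ℓ σ σ' ∧ (σ'.reg (rRes k) ≠ 0 ↔ φ I S ρ)

section
variable {pu : Bool} {ℓ : ℕ} {P φ ψ : Pred 𝒢 k} {d : ℝ}

theorem EvalF.weaken {φ' P' : Pred 𝒢 k} {d' : ℝ} (h : EvalF pu ℓ P φ d) (hd : d ≤ d')
    (hP : ∀ I S ρ, P' I S ρ → P I S ρ) (hφ : ∀ I S ρ, P' I S ρ → (φ I S ρ ↔ φ' I S ρ)) :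
    EvalF pu ℓ P' φ' d' := by
  obtain ⟨h0, p, C, hC, h⟩ := h
  refine ⟨h0.trans hd, p, C, hC, fun I S ρ σ hr hp => (h I S ρ σ hr (hP _ _ _ hp)).mono ?_ ?_⟩
  · have := I.one_le ρ
    gcongr
    exact_mod_cast this
  · rintro σ' ⟨h1, h2⟩
    exact ⟨h1, h2.trans (hφ _ _ _ hp)⟩

theorem EvalF.mono {d' : ℝ} (h : EvalF pu ℓ P φ d) (hd : d ≤ d') : EvalF pu ℓ P φ d' :=
  h.weaken hd (fun _ _ _ h => h) fun _ _ _ _ => Iff.rfl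

theorem EvalF.congr {φ' : Pred 𝒢 k} (h : EvalF pu ℓ P φ d)
    (hφ : ∀ I S ρ, P I S ρ → (φ I S ρ ↔ φ' I S ρ)) : EvalF pu ℓ P φ' d :=
  h.weaken le_rfl (fun _ _ _ h => h) hφ

theorem EvalF.pre {P' : Pred 𝒢 k} (h : EvalF pu ℓ P φ d)
    (hP : ∀ I S ρ, P' I S ρ → P I S ρ) : EvalF pu ℓ P' φ d :=
  h.weaken le_rfl hP fun _ _ _ _ => Iff.rfl

theorem EvalF.of_block (hd : 0 ≤ d) (os : List Op)
    (h : ∀ (I : Input 𝒢 k) (S : Store I.n) (ρ : ℕ → Fin I.n) (σ : State), Rep ℓ I S ρ σ →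
      P I S ρ → Fr pu k I.n ℓ σ (os.foldl (fun σ o => o.exec I.G σ) σ) ∧
      ((os.foldl (fun σ o => o.exec I.G σ) σ).reg (rRes k) ≠ 0 ↔ φ I S ρ)) :
    EvalF pu ℓ P φ d := by
  refine ⟨hd, block os, os.length + 1, by positivity, fun I S ρ σ hr hp => ?_⟩
  refine Halts.block os ?_ (h I S ρ σ hr hp)
  nlinarith [one_le_rpow_natCast (I.one_le ρ) hd]

theorem EvalF.true (hd : 0 ≤ d) : EvalF pu ℓ P (fun _ _ _ => True) d := by
  refine EvalF.of_block hd [.const (rRes k) 1] fun I S ρ σ hr hp => ⟨?_, ?_⟩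
  · exact (Fr.refl _ _ _ _ _).setReg (free_sys (by omega) (by omega)) _
  · simp

theorem EvalF.false (hd : 0 ≤ d) : EvalF pu ℓ P (fun _ _ _ => False) d := by
  refine EvalF.of_block hd [.const (rRes k) 0] fun I S ρ σ hr hp => ⟨?_, ?_⟩
  · exact (Fr.refl _ _ _ _ _).setReg (free_sys (by omega) (by omega)) _
  · simp

theorem EvalF.adj (hd : 0 ≤ d) {a b : Term k} (ha : a.Below ℓ) (hb : b.Below ℓ) :
    EvalF pu ℓ P (fun I _ ρ => I.G.Adj (a.val I ρ) (b.val I ρ)) d := by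
  refine EvalF.of_block hd [.edge (rRes k) a.reg b.reg] fun I S ρ σ hr hp => ⟨?_, ?_⟩
  · exact (Fr.refl _ _ _ _ _).setReg (free_sys (by omega) (by omega)) _
  · simp only [List.foldl, exec_edge, State.setReg_self, hr.term ha, hr.term hb]
    exact adjEntry_ne_zero _ _ _

theorem EvalF.lt (hd : 0 ≤ d) {a b : Term k} (ha : a.Below ℓ) (hb : b.Below ℓ) :
    EvalF pu ℓ P (fun I _ ρ => a.val I ρ < b.val I ρ) d := by
  refine EvalF.of_block hd [.sub (rRes k) b.reg a.reg] fun I S ρ σ hr hp => ⟨?_, ?_⟩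
  · exact (Fr.refl _ _ _ _ _).setReg (free_sys (by omega) (by omega)) _
  · simp only [List.foldl, exec_sub, State.setReg_self, hr.term ha, hr.term hb]
    rw [Fin.lt_def]; omega

theorem EvalF.eq (hd : 0 ≤ d) {a b : Term k} (ha : a.Below ℓ) (hb : b.Below ℓ) :
    EvalF pu ℓ P (fun I _ ρ => a.val I ρ = b.val I ρ) d := by
  -- With truncated subtraction `(b - a) + (a - b)` is the distance, and `1` minus the distance is
  -- nonzero exactly in case of equality.
  refine EvalF.of_block hd [.sub (rA k) b.reg a.reg, .sub (rB k) a.reg b.reg,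
    .add (rA k) (rA k) (rB k), .sub (rRes k) (rOne k) (rA k)]
    fun I S ρ σ hr hp => ⟨?_, ?_⟩
  · exact ((((Fr.refl _ _ _ _ _).setReg (free_sys (by omega) (by omega)) _).setReg
      (free_sys (by omega) (by omega)) _).setReg (free_sys (by omega) (by omega)) _).setReg
      (free_sys (by omega) (by omega)) _
  · simp [State.setReg_reg, hr.term ha, hr.term hb, hr.one, Term.reg_ne]
    rw [Fin.ext_iff]; omega

theorem EvalF.un (hd : 0 ≤ d) (R : ℕ) {a : Term k} (ha : a.Below ℓ) :
    EvalF pu ℓ P (fun I S ρ => S.u R (a.val I ρ)) d := by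
  refine EvalF.of_block hd (addrOps k (2 * R + 2) [a.reg] ++ [.load (rRes k) (rA k)])
    fun I S ρ σ hr hp => ?_
  rw [List.foldl_append, foldl_addrOps _ _ _ (by simp [Term.reg_ne]) _ hr.cu]
  refine ⟨?_, ?_⟩
  · exact (((Fr.refl _ _ _ _ _).setReg (free_sys (by omega) (by omega)) _).setReg
      (free_sys (by omega) (by omega)) _).setReg (free_sys (by omega) (by omega)) _
  · simp only [List.foldl, exec_load, State.setReg_self, State.setReg_mem, List.map_cons,
      List.map_nil, List.sum_cons, List.sum_nil, hr.term ha, add_zero]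
    exact hr.un R _

theorem EvalF.ter (hd : 0 ≤ d) (R : ℕ) {i j l : ℕ} (hi : i < ℓ) (hj : j < ℓ) (hl : l < ℓ) :
    EvalF pu ℓ P (fun _ S ρ => S.t R (ρ i) (ρ j) (ρ l)) d := by
  refine EvalF.of_block hd (addrOps k (2 * R + 3) [rVar k i 2, rVar k j 1, rVar k l 0] ++
    [.load (rRes k) (rA k)]) fun I S ρ σ hr hp => ?_
  rw [List.foldl_append, foldl_addrOps _ _ _ (by simp) _ hr.cu]
  refine ⟨?_, ?_⟩
  · exact (((Fr.refl _ _ _ _ _).setReg (free_sys (by omega) (by omega)) _).setReg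
      (free_sys (by omega) (by omega)) _).setReg (free_sys (by omega) (by omega)) _
  · simp only [List.foldl, exec_load, State.setReg_self, State.setReg_mem, List.map_cons,
      List.map_nil, List.sum_cons, List.sum_nil, (hr.var i hi).2.2, (hr.var j hj).2.1,
      (hr.var l hl).1, add_zero, ← add_assoc]
    exact hr.ter R _ _ _

theorem EvalF.not (h : EvalF pu ℓ P φ d) : EvalF pu ℓ P (fun I S ρ => ¬ φ I S ρ) d := by
  obtain ⟨h0, p, C, hC, h⟩ := h
  refine ⟨h0, .seq p (.op (.sub (rRes k) (rOne k) (rRes k))), C + 1, by positivity,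
    fun I S ρ σ hr hp => ?_⟩
  refine Halts.seq (T₁ := C * (I.n : ℝ) ^ d) (T₂ := 1) ((h I S ρ σ hr hp).mono le_rfl ?_) ?_
  · rintro σ' ⟨h1, h2⟩
    refine Halts.op le_rfl ⟨?_, ?_⟩
    · exact h1.setReg (free_sys (by omega) (by omega)) _
    · change _ ↔ ¬ φ I S ρ
      rw [← h2]
      simp only [exec_sub, State.setReg_self, (hr.of_fr h1).one]; omega
  · nlinarith [one_le_rpow_natCast (I.one_le ρ) h0]

/-- The second conjunct is evaluated only if the first one holds, and may therefore assume it. This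
is how a given program is protected from inputs on which nothing is known about it. -/
theorem EvalF.and (h : EvalF pu ℓ P φ d) (h' : EvalF pu ℓ (fun I S ρ => P I S ρ ∧ φ I S ρ) ψ d) :
    EvalF pu ℓ P (fun I S ρ => φ I S ρ ∧ ψ I S ρ) d := by
  obtain ⟨h0, p, C, hC, h⟩ := h
  obtain ⟨-, p', C', hC', h'⟩ := h'
  refine ⟨h0, .seq p (.ite (rRes k) p' (.op .skip)), C + (C' + 2), by positivity,
    fun I S ρ σ hr hp => ?_⟩
  have h1 := one_le_rpow_natCast (I.one_le ρ) h0
  refine Halts.seq (T₁ := C * (I.n : ℝ) ^ d) (T₂ := (C' + 2) * (I.n : ℝ) ^ d)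
    ((h I S ρ σ hr hp).mono le_rfl ?_) (by linarith)
  rintro σ' ⟨h2, h3⟩
  refine Halts.ite (T := (C' + 1) * (I.n : ℝ) ^ d) (fun hne => ?_) (fun he => ?_) (by linarith)
  · refine (h' I S ρ σ' (hr.of_fr h2) ⟨hp, h3.1 hne⟩).mono (by linarith) ?_
    rintro σ'' ⟨h4, h5⟩
    refine ⟨h2.trans h4, h5.trans ?_⟩
    simp [h3.1 hne]
  · refine Halts.op (by nlinarith) ⟨h2, ?_⟩
    simp [he, show ¬ φ I S ρ from fun h => h3.2 h he]

theorem EvalF.or (h : EvalF pu ℓ P φ d) (h' : EvalF pu ℓ P ψ d) :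
    EvalF pu ℓ P (fun I S ρ => φ I S ρ ∨ ψ I S ρ) d := by
  refine (EvalF.not (EvalF.and h.not (h'.pre (fun _ _ _ h => h.1)).not)).congr fun I S ρ _ => ?_
  tauto

/-- All `n` values are tried, and a success is remembered in the accumulator register of the bound
variable. One quantifier thus raises the exponent by one. -/
theorem EvalF.ex {P' : Pred 𝒢 k} (h : EvalF pu (ℓ + 1) P' φ (d - 1))
    (hP : ∀ I S ρ v, P I S ρ → P' I S (Function.update ρ ℓ v)) :
    EvalF pu ℓ P (fun I S ρ => ∃ v, φ I S (Function.update ρ ℓ v)) d := by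
  obtain ⟨h0, p, C, hC, h⟩ := h
  refine ⟨by linarith, .seq (.op (.const (rVar k ℓ 4) 0)) (.seq (forP k ℓ
    (.seq p (.ite (rRes k) (.op (.const (rVar k ℓ 4) 1)) (.op .skip))))
    (block [.const (rA k) 0, .add (rRes k) (rVar k ℓ 4) (rA k)])), C + 18, by positivity,
    fun I S ρ σ hr hp => ?_⟩
  have hn := I.one_le ρ
  have h1 := one_le_rpow_natCast hn h0
  have hn0 : (0 : ℝ) < I.n := by exact_mod_cast hn
  have hpow : (I.n : ℝ) ^ d = I.n * (I.n : ℝ) ^ (d - 1) := by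
    rw [Real.rpow_sub_one hn0.ne']; field_simp
  have h2 : (1 : ℝ) ≤ I.n := by exact_mod_cast hn
  set X := (I.n : ℝ) ^ (d - 1)
  refine Halts.seq (T₁ := 1) (T₂ := (C + 17) * (I.n : ℝ) ^ d) ?_ (by rw [hpow]; nlinarith)
  refine Halts.op le_rfl ?_
  refine Halts.seq (T₁ := I.n * ((C * X + 2) + 6) + 6) (T₂ := 3) ?_
    (by rw [hpow]; nlinarith [mul_le_mul h2 h1 (by norm_num) (by linarith)])
  let Inv : ℕ → State → Prop := fun v σ' => Fr pu k I.n ℓ σ σ' ∧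
    (σ'.reg (rVar k ℓ 4) ≠ 0 ↔ ∃ w : Fin I.n, (w : ℕ) < v ∧ φ I S (Function.update ρ ℓ w))
  refine (Halts.forP Inv ?_ ?_ ?_ ?_).mono le_rfl ?_
  · rintro v σ' ⟨hf, -⟩
    have := hr.of_fr hf
    exact ⟨this.n, this.one, this.sq⟩
  · rintro v σ' j x hj ⟨hf, ha⟩
    refine ⟨hf.setReg (free_var le_rfl (by omega)) _, ?_⟩
    rw [State.setReg_ne _ _ (rVar_ne_acc hj).symm]
    exact ha
  · rintro v σ' hv ⟨hf, ha⟩ h0 h1 h2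
    have hr' : Rep (ℓ + 1) I S (Function.update ρ ℓ ⟨v, hv⟩) σ' := (hr.of_fr hf).snoc h0 h1 h2
    refine Halts.seq (T₁ := C * X) (T₂ := 2)
      ((h I S _ σ' hr' (hP _ _ _ _ hp)).mono le_rfl ?_) le_rfl
    rintro σ₁ ⟨hf₁, hφ⟩
    have hsame : ∀ j < 5, σ₁.reg (rVar k ℓ j) = σ'.reg (rVar k ℓ j) := fun j hj =>
      hf₁.reg _ (.var (by omega) hj)
    refine Halts.ite (T := 1) (fun hne => ?_) (fun he => ?_) (by norm_num)
    · refine Halts.op le_rfl ⟨⟨(hf.trans (hf₁.level (by omega))).setReg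
        (free_var le_rfl (by omega)) _, ?_⟩, ?_⟩
      · simp only [exec_const, State.setReg_self]
        simpa using ⟨⟨v, hv⟩, by simp, hφ.1 hne⟩
      · intro j hj
        rw [exec_const, State.setReg_ne _ _ (rVar_ne_acc hj)]
        exact hsame j (by omega)
    · refine Halts.op le_rfl ⟨⟨hf.trans (hf₁.level (by omega)), ?_⟩, fun j hj => hsame j (by omega)⟩
      rw [exec_skip, hsame 4 (by omega), ha]
      constructor
      · rintro ⟨w, hw, hw'⟩; exact ⟨w, by omega, hw'⟩
      · rintro ⟨w, hw, hw'⟩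
        refine ⟨w, lt_of_le_of_ne (by omega) ?_, hw'⟩
        rintro rfl
        exact hφ.2 hw' he
  · refine ⟨(Fr.refl _ _ _ _ _).setReg (free_var le_rfl (by omega)) _, ?_⟩
    simp
  · rintro σ' ⟨hf, ha⟩
    refine Halts.block _ (by norm_num) ⟨?_, ?_⟩
    · exact (hf.setReg (free_sys (by omega) (by omega)) _).setReg
        (free_sys (by omega) (by omega)) _
    · simp [State.setReg_reg]
      refine (show _ ↔ _ from ha).trans ?_
      simp

end

end RAM

namespace RAM

variable {𝒢 : GraphClass} {k : ℕ}

/-! ## Filling a region of the memory -/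

theorem cell_inj {n q q' x x' : ℕ} (hx : x < n * n * n) (hx' : x' < n * n * n)
    (h : cell n q x = cell n q' x') : q = q' ∧ x = x' := by
  have h1 : q * (n * n * n) + x = q' * (n * n * n) + x' := by simp only [cell] at h; omega
  have hq : q = q' := by
    rcases lt_trichotomy q q' with hlt | rfl | hlt
    · have := Nat.mul_le_mul_right (n * n * n) (Nat.succ_le_of_lt hlt)
      rw [Nat.succ_mul] at this; omega
    · rfl
    · have := Nat.mul_le_mul_right (n * n * n) (Nat.succ_le_of_lt hlt)
      rw [Nat.succ_mul] at this; omega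
  subst hq
  exact ⟨rfl, by omega⟩

/-- The registers that hold constants have the right contents. -/
structure Ctrl (k n : ℕ) (σ : State) : Prop where
  num : σ.reg 0 = n
  one : σ.reg (rOne k) = 1
  sq : σ.reg (rSq k) = n * n
  cu : σ.reg (rCu k) = n * n * n

theorem Rep.ctrl {ℓ : ℕ} {I : Input 𝒢 k} {S : Store I.n} {ρ : ℕ → Fin I.n} {σ : State}
    (h : Rep ℓ I S ρ σ) : Ctrl k I.n σ := ⟨h.n, h.one, h.sq, h.cu⟩

/-- The two states agree but for the region `q` and unprotected parts. -/
structure Agree (k n ℓ q : ℕ) (σ σ' : State) : Prop where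
  reg : ∀ r, Prot k ℓ r → σ'.reg r = σ.reg r
  mem : ∀ q' x, 1 ≤ q' → q' ≠ q → x < n * n * n → σ'.mem (cell n q' x) = σ.mem (cell n q' x)
  stamp : (∀ a, σ.mem (3 * a + 1) ≤ σ.reg (rVer k)) →
    ∀ a, σ'.mem (3 * a + 1) ≤ σ'.reg (rVer k)

theorem Agree.trans {n ℓ q : ℕ} {σ₁ σ₂ σ₃ : State} (h : Agree k n ℓ q σ₁ σ₂)
    (h' : Agree k n ℓ q σ₂ σ₃) : Agree k n ℓ q σ₁ σ₃ :=
  ⟨fun r hr => (h'.reg r hr).trans (h.reg r hr),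
    fun q' x h1 h2 h3 => (h'.mem q' x h1 h2 h3).trans (h.mem q' x h1 h2 h3),
    fun hs => h'.stamp (h.stamp hs)⟩

theorem Agree.level {n ℓ ℓ' q : ℕ} {σ₁ σ₂ : State} (h : Agree k n ℓ' q σ₁ σ₂) (hl : ℓ ≤ ℓ') :
    Agree k n ℓ q σ₁ σ₂ :=
  ⟨fun r hr => h.reg r (hr.mono hl), h.mem, h.stamp⟩

theorem Fr.agree {pu : Bool} {n ℓ : ℕ} {σ σ' : State} (h : Fr pu k n ℓ σ σ') (q : ℕ) :
    Agree k n ℓ q σ σ' :=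
  ⟨h.reg, fun _ _ h1 _ _ => h.cell_eq h1 _, h.stamp⟩

theorem Ctrl.of_agree {n ℓ q : ℕ} {σ σ' : State} (h : Ctrl k n σ) (ha : Agree k n ℓ q σ σ') :
    Ctrl k n σ' :=
  ⟨(ha.reg _ (.low (by omega))).trans h.num, (ha.reg _ (.sys (by omega))).trans h.one,
    (ha.reg _ (.sys (by omega))).trans h.sq, (ha.reg _ (.sys (by omega))).trans h.cu⟩

/-- The program makes exactly those cells of `D` in region `q` nonzero that satisfy `val`. -/
def Fills {n : ℕ} (G : SimpleGraph (Fin n)) (k ℓ q : ℕ) (p : Prog) (T : ℝ)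
    (Pre : State → Prop) (val D : ℕ → Prop) : Prop :=
  ∀ σ, Pre σ → Halts G p σ T fun σ' => Agree k n ℓ q σ σ' ∧
    (∀ x < n * n * n, D x → (σ'.mem (cell n q x) ≠ 0 ↔ val x)) ∧
    (∀ x < n * n * n, ¬ D x → σ'.mem (cell n q x) = σ.mem (cell n q x))

/-- The registers of the variable `ℓ` hold the vertex `v`. -/
def VarIs (k n ℓ v : ℕ) (σ : State) : Prop :=
  σ.reg (rVar k ℓ 0) = v ∧ σ.reg (rVar k ℓ 1) = v * n ∧ σ.reg (rVar k ℓ 2) = v * (n * n)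

theorem VarIs.of_agree {n i v ℓ q : ℕ} {σ σ' : State} (h : VarIs k n i v σ) (hi : i < ℓ)
    (ha : Agree k n ℓ q σ σ') : VarIs k n i v σ' := by
  unfold VarIs
  rw [ha.reg _ (.var hi (by omega)), ha.reg _ (.var hi (by omega)),
    ha.reg _ (.var hi (by omega))]
  exact h

section
variable {n : ℕ} {G : SimpleGraph (Fin n)} {ℓ q : ℕ} {p : Prog} {T : ℝ} {Pre : State → Prop}
  {val : ℕ → Prop}

/-- The sets `D v` may overlap: the intended contents of a cell do not depend on `v`, so overwriting
a cell that is already correct does no harm. -/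
theorem Fills.loop {D : ℕ → ℕ → Prop} (hc : ∀ σ, Pre σ → Ctrl k n σ)
    (hs : ∀ σ σ', Pre σ → Agree k n ℓ q σ σ' → Pre σ')
    (hp : ∀ v < n, Fills G k (ℓ + 1) q p T (fun σ => Pre σ ∧ VarIs k n ℓ v σ) val (D v)) :
    Fills G k ℓ q (forP k ℓ p) (n * (T + 6) + 6) Pre val (fun x => ∃ v < n, D v x) := by
  intro σ hσ
  let Inv : ℕ → State → Prop := fun v σ' => Agree k n ℓ q σ σ' ∧
    (∀ x < n * n * n, (∃ w < v, D w x) → (σ'.mem (cell n q x) ≠ 0 ↔ val x)) ∧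
    (∀ x < n * n * n, (¬ ∃ w < v, D w x) → σ'.mem (cell n q x) = σ.mem (cell n q x))
  refine Halts.forP Inv ?_ ?_ ?_ ?_
  · rintro v σ' ⟨ha, -⟩
    have := hc _ (hs _ _ hσ ha)
    exact ⟨this.num, this.one, this.sq⟩
  · rintro v σ' j x hj ⟨ha, h1, h2⟩
    exact ⟨ha.trans (((Fr.refl Bool.true k n ℓ _).setReg (free_var le_rfl (by omega)) _).agree _),
      h1, h2⟩
  · rintro v σ' hv ⟨ha, h1, h2⟩ r0 r1 r2
    refine (hp v hv σ' ⟨hs _ _ hσ ha, r0, r1, r2⟩).mono le_rfl ?_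
    rintro σ₁ ⟨ha₁, h3, h4⟩
    refine ⟨⟨ha.trans (ha₁.level (by omega)), ?_, ?_⟩,
      fun j hj => ha₁.reg _ (.var (by omega) (by omega))⟩
    · rintro x hx ⟨w, hw, hD⟩
      by_cases hDv : D v x
      · exact h3 x hx hDv
      · rw [h4 x hx hDv]
        refine h1 x hx ⟨w, lt_of_le_of_ne (by omega) ?_, hD⟩
        rintro rfl; exact hDv hD
    · intro x hx hD
      rw [h4 x hx fun h => hD ⟨v, by omega, h⟩]
      exact h2 x hx fun ⟨w, hw, h⟩ => hD ⟨w, by omega, h⟩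
  · exact ⟨(Fr.refl Bool.true k n ℓ _).agree _, by rintro x - ⟨w, hw, -⟩; omega, fun _ _ _ => rfl⟩

theorem Fills.one {rs : List ℕ} {x : ℕ} (hx : x < n * n * n) (hq : 1 ≤ q)
    (hrs : ∀ r ∈ rs, Prot k ℓ r) (hrs' : ∀ r ∈ rs, r ≠ rA k)
    (hc : ∀ σ, Pre σ → Ctrl k n σ) (hsum : ∀ σ, Pre σ → (rs.map σ.reg).sum = x)
    (hp : ∀ σ, Pre σ → Halts G p σ T fun σ' => Fr false k n ℓ σ σ' ∧
      (σ'.reg (rRes k) ≠ 0 ↔ val x)) :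
    Fills G k ℓ q (.seq p (block (addrOps k q rs ++ [.store (rA k) (rRes k)])))
      (T + (q + rs.length + 7)) Pre val (fun y => y = x) := by
  intro σ hσ
  refine Halts.seq (T₁ := T) (T₂ := q + rs.length + 7) ((hp σ hσ).mono le_rfl ?_) le_rfl
  rintro σ' ⟨hf, hv⟩
  have hc' : Ctrl k n σ' := (hc _ hσ).of_agree (hf.agree 0)
  refine Halts.block _ (by
    rw [List.length_append, length_addrOps]; push_cast; simp; linarith) ?_
  rw [List.foldl_append, foldl_addrOps _ _ _ hrs' _ hc'.cu]
  have hsum' : (rs.map σ'.reg).sum = x := by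
    rw [← hsum σ hσ]
    exact congrArg _ (List.map_congr_left fun r hr => hf.reg r (hrs r hr))
  rw [hsum']
  simp only [List.foldl, exec_store, State.setReg_self]
  set σ₁ := (σ'.setReg (rB k) 2).setReg (rA k) (cell n q x) with hσ₁
  have hf₁ : Fr false k n ℓ σ σ₁ := (hf.setReg (free_sys (by omega) (by omega)) _).setReg
    (free_sys (by omega) (by omega)) _
  have hres : σ₁.reg (rRes k) = σ'.reg (rRes k) := by simp [hσ₁, State.setReg_reg]
  refine ⟨⟨hf₁.reg, ?_, ?_⟩, ?_, ?_⟩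
  · intro q' y h1 h2 h3
    rw [State.setMem_mem, if_neg fun h => h2 (cell_inj h3 hx h).1]
    exact hf₁.cell_eq h1 y
  · intro hs a
    rw [State.setMem_mem, if_neg (by unfold cell; omega)]
    exact hf₁.stamp hs a
  · rintro y hy rfl
    rw [State.setMem_mem, if_pos rfl, hres]
    exact hv
  · rintro y hy hne
    rw [State.setMem_mem, if_neg fun h => hne (cell_inj hy hx h).2]
    exact hf₁.cell_eq hq y

theorem cell_lt {i j l : ℕ} (hi : i < n) (hj : j < n) (hl : l < n) :
    i * (n * n) + j * n + l < n * n * n := by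
  have h1 : (i + 1) * (n * n) ≤ n * (n * n) := Nat.mul_le_mul_right _ hi
  have h2 : (j + 1) * n ≤ n * n := Nat.mul_le_mul_right _ hj
  nlinarith

theorem Fills.un (hq : 1 ≤ q) (hc : ∀ σ, Pre σ → Ctrl k n σ)
    (hs : ∀ σ σ', Pre σ → Agree k n ℓ q σ σ' → Pre σ')
    (hp : ∀ v < n, ∀ σ, Pre σ → VarIs k n ℓ v σ → Halts G p σ T fun σ' =>
      Fr false k n (ℓ + 1) σ σ' ∧ (σ'.reg (rRes k) ≠ 0 ↔ val v)) :
    Fills G k ℓ q (forP k ℓ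
      (.seq p (block (addrOps k q [rVar k ℓ 0] ++ [.store (rA k) (rRes k)]))))
      (n * ((T + (q + 8)) + 6) + 6) Pre val (fun x => x < n) := by
  have h := Fills.loop (D := fun v x => x = v) (val := val) hc hs (T := T + (q + 8))
    (p := .seq p (block (addrOps k q [rVar k ℓ 0] ++ [.store (rA k) (rRes k)]))) (G := G)
    fun v hv => by
      have hv' : v < n * n * n := by
        have := cell_lt (show 0 < n by omega) (show 0 < n by omega) hv
        omega
      have := Fills.one (G := G) (Pre := fun σ => Pre σ ∧ VarIs k n ℓ v σ) (val := val)
        (rs := [rVar k ℓ 0]) (ℓ := ℓ + 1) (q := q) (p := p) (T := T) hv' hq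
        (by simpa using Prot.var (by omega) (by omega)) (by simp) (fun σ h => hc σ h.1)
        (fun σ h => by simpa using h.2.1) (fun σ h => hp v hv σ h.1 h.2)
      refine fun σ hσ => (this σ hσ).mono ?_ fun _ h => h
      simp; linarith
  simpa using h

theorem Fills.ter (hq : 1 ≤ q) (hc : ∀ σ, Pre σ → Ctrl k n σ)
    (hs : ∀ σ σ', Pre σ → Agree k n ℓ q σ σ' → Pre σ')
    (hp : ∀ i < n, ∀ j < n, ∀ l < n, ∀ σ, Pre σ → VarIs k n ℓ i σ → VarIs k n (ℓ + 1) j σ →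
      VarIs k n (ℓ + 2) l σ → Halts G p σ T fun σ' =>
      Fr false k n (ℓ + 3) σ σ' ∧ (σ'.reg (rRes k) ≠ 0 ↔ val (i * (n * n) + j * n + l))) :
    Fills G k ℓ q (forP k ℓ (forP k (ℓ + 1) (forP k (ℓ + 2)
      (.seq p (block (addrOps k q [rVar k ℓ 2, rVar k (ℓ + 1) 1, rVar k (ℓ + 2) 0] ++
        [.store (rA k) (rRes k)]))))))
      (n * ((n * ((n * ((T + (q + 10)) + 6) + 6) + 6) + 6) + 6) + 6) Pre val (fun _ => True) := by
  refine fun σ hσ => ((Fills.loop (q := q) (val := val)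
    (D := fun i x => ∃ j < n, ∃ l < n, x = i * (n * n) + j * n + l) hc hs ?_) σ hσ).mono le_rfl ?_
  · intro i hi
    refine Fills.loop (D := fun j x => ∃ l < n, x = i * (n * n) + j * n + l) (fun σ h => hc σ h.1)
      (fun σ σ' h ha => ⟨hs _ _ h.1 (ha.level (by omega)), h.2.of_agree (by omega) ha⟩) ?_
    intro j hj
    refine Fills.loop (D := fun l x => x = i * (n * n) + j * n + l) (fun σ h => hc σ h.1.1)
      (fun σ σ' h ha => ⟨⟨hs _ _ h.1.1 (ha.level (by omega)), h.1.2.of_agree (by omega) ha⟩,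
        h.2.of_agree (by omega) ha⟩) ?_
    intro l hl
    have := Fills.one (G := G) (Pre := fun σ => ((Pre σ ∧ VarIs k n ℓ i σ) ∧
        VarIs k n (ℓ + 1) j σ) ∧ VarIs k n (ℓ + 2) l σ) (val := val)
      (rs := [rVar k ℓ 2, rVar k (ℓ + 1) 1, rVar k (ℓ + 2) 0]) (ℓ := ℓ + 3) (q := q) (p := p)
      (T := T) (cell_lt hi hj hl) hq (by
        simp only [List.mem_cons, List.not_mem_nil, or_false]
        rintro r (rfl | rfl | rfl)
        all_goals exact Prot.var (by omega) (by omega)) (by simp) (fun σ h => hc σ h.1.1.1)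
      (fun σ h => by
        simp only [List.map_cons, List.map_nil, List.sum_cons, List.sum_nil, h.1.1.2.2.2,
          h.1.2.2.1, h.2.1]
        ring) (fun σ h => hp i hi j hj l hl σ h.1.1.1 h.1.1.2 h.1.2 h.2)
    refine fun σ hσ => (this σ hσ).mono ?_ fun _ h => h
    simp; linarith
  · rintro σ' ⟨h1, h2, -⟩
    refine ⟨h1, fun x hx _ => h2 x hx ?_, fun x hx h => absurd trivial h⟩
    have hn : 0 < n := Nat.pos_of_ne_zero (by rintro rfl; simp at hx)
    have hn2 : 0 < n * n := Nat.mul_pos hn hn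
    refine ⟨x / (n * n), ?_, x % (n * n) / n, ?_, x % (n * n) % n, Nat.mod_lt _ hn, ?_⟩
    · rw [Nat.div_lt_iff_lt_mul hn2]; rwa [mul_assoc] at hx
    · rw [Nat.div_lt_iff_lt_mul hn]; exact Nat.mod_lt _ hn2
    · have h1 := Nat.div_add_mod' x (n * n)
      have h2 := Nat.div_add_mod' (x % (n * n)) n
      omega

end

/-! ## Commands -/

/-- Some program changes the store by `F`, in `O(n ^ d)` steps. -/
def Cmd (ℓ : ℕ) (F : ∀ I : Input 𝒢 k, (ℕ → Fin I.n) → Store I.n → Store I.n) (d : ℝ) : Prop :=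
  0 ≤ d ∧ ∃ (p : Prog) (C : ℝ), 0 ≤ C ∧ ∀ (I : Input 𝒢 k) (S : Store I.n) (ρ : ℕ → Fin I.n)
    (σ : State), Rep ℓ I S ρ σ → Halts I.G p σ (C * (I.n : ℝ) ^ d) fun σ' =>
      (∀ r, Prot k ℓ r → σ'.reg r = σ.reg r) ∧ Rep ℓ I (F I ρ S) ρ σ'

/-- Change a unary relation. -/
def Store.setU {n : ℕ} (S : Store n) (R : ℕ) (X : Fin n → Prop) : Store n :=
  { S with u := Function.update S.u R X }

/-- Change a ternary relation. -/
def Store.setT {n : ℕ} (S : Store n) (R : ℕ) (X : Fin n → Fin n → Fin n → Prop) : Store n :=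
  { S with t := Function.update S.t R X }

section
variable {n : ℕ} (S : Store n) (R R' : ℕ) (X : Fin n → Prop)
  (Y : Fin n → Fin n → Fin n → Prop)
@[simp] theorem Store.setU_t : (S.setU R X).t = S.t := rfl
@[simp] theorem Store.setT_u : (S.setT R Y).u = S.u := rfl
@[simp] theorem Store.setU_self : (S.setU R X).u R = X := by simp [Store.setU]
@[simp] theorem Store.setT_self : (S.setT R Y).t R = Y := by simp [Store.setT]
@[simp] theorem Store.setU_ne (h : R' ≠ R) : (S.setU R X).u R' = S.u R' := by
  simp [Store.setU, h]
@[simp] theorem Store.setT_ne (h : R' ≠ R) : (S.setT R Y).t R' = S.t R' := by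
  simp [Store.setT, h]
end

theorem rpow_eq_mul {n : ℕ} (hn : 1 ≤ n) (d : ℝ) : (n : ℝ) ^ d = n * (n : ℝ) ^ (d - 1) := by
  have hn0 : (n : ℝ) ≠ 0 := by positivity
  rw [Real.rpow_sub_one hn0]; field_simp

section
variable {pu : Bool} {ℓ : ℕ} {P Q R φ : Pred 𝒢 k} {d : ℝ}

theorem Cmd.seq {F F' : ∀ I : Input 𝒢 k, (ℕ → Fin I.n) → Store I.n → Store I.n}
    (h : Cmd ℓ F d) (h' : Cmd ℓ F' d) : Cmd ℓ (fun I ρ S => F' I ρ (F I ρ S)) d := by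
  obtain ⟨h0, p, C, hC, h⟩ := h
  obtain ⟨-, p', C', hC', h'⟩ := h'
  refine ⟨h0, .seq p p', C + C', by positivity, fun I S ρ σ hr => ?_⟩
  refine Halts.seq ((h I S ρ σ hr).mono le_rfl ?_)
    (show C * (I.n : ℝ) ^ d + C' * (I.n : ℝ) ^ d ≤ _ by rw [add_mul])
  rintro σ' ⟨h1, h2⟩
  refine (h' I _ ρ σ' h2).mono le_rfl ?_
  rintro σ'' ⟨h4, h5⟩
  exact ⟨fun r hr => (h4 r hr).trans (h1 r hr), h5⟩

theorem Cmd.for {F : ∀ I : Input 𝒢 k, (ℕ → Fin I.n) → Store I.n → Store I.n}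
    (h : Cmd (ℓ + 1) F (d - 1)) : Cmd ℓ (fun I ρ S =>
      (List.finRange I.n).foldl (fun S v => F I (Function.update ρ ℓ v) S) S) d := by
  obtain ⟨h0, p, C, hC, h⟩ := h
  refine ⟨by linarith, forP k ℓ p, C + 12, by positivity, fun I S ρ σ hr => ?_⟩
  have hn := I.one_le ρ
  have h1 := one_le_rpow_natCast hn h0
  have h2 : (1 : ℝ) ≤ I.n := by exact_mod_cast hn
  rw [rpow_eq_mul hn]
  set X := (I.n : ℝ) ^ (d - 1)
  let f : ℕ → Store I.n := fun v => ((List.finRange I.n).take v).foldl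
    (fun S v => F I (Function.update ρ ℓ v) S) S
  let Inv : ℕ → State → Prop := fun v σ' => (∀ r, Prot k ℓ r → σ'.reg r = σ.reg r) ∧
    Rep ℓ I (f v) ρ σ'
  refine (Halts.forP (T := C * X) (σ := σ) Inv ?_ ?_ ?_ ?_).mono ?_ ?_
  · rintro v σ' ⟨-, hr⟩
    exact ⟨hr.n, hr.one, hr.sq⟩
  · rintro v σ' j x hj ⟨hs, hr⟩
    have := (Fr.refl Bool.true k I.n ℓ σ').setReg (free_var le_rfl (show j < 5 by omega)) x
    exact ⟨fun r hr => (this.reg r hr).trans (hs r hr), hr.of_fr this⟩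
  · rintro v σ' hv ⟨hs, hr⟩ r0 r1 r2
    have hr' : Rep (ℓ + 1) I (f v) (Function.update ρ ℓ ⟨v, hv⟩) σ' := hr.snoc r0 r1 r2
    refine (h I _ _ σ' hr').mono le_rfl ?_
    rintro σ₁ ⟨hs₁, hr₁⟩
    have hf : f (v + 1) = F I (Function.update ρ ℓ ⟨v, hv⟩) (f v) := by
      simp only [f]
      rw [List.take_add_one]
      simp [hv]
    refine ⟨⟨fun r hr => (hs₁ r (hr.mono (by omega))).trans (hs r hr), ?_⟩,
      fun j hj => hs₁ _ (.var (by omega) (by omega))⟩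
    rw [hf]
    exact hr₁.drop
  · exact ⟨fun _ _ => rfl, by simpa [f] using hr⟩
  · nlinarith
  · rintro σ' ⟨h, h'⟩
    refine ⟨h, ?_⟩
    rwa [show f I.n = _ by simp only [f]; rw [List.take_of_length_le (by simp)]] at h'

/-- The relations of the store live in the regions from `2` on, so region `1` is available as a
buffer. -/
theorem Rep.of_agree_tmp {I : Input 𝒢 k} {S : Store I.n} {ρ : ℕ → Fin I.n} {σ σ' : State}
    (h : Rep ℓ I S ρ σ) (ha : Agree k I.n ℓ 1 σ σ') : Rep ℓ I S ρ σ' where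
  n := (ha.reg _ (.low (by omega))).trans h.n
  s i := (ha.reg _ (.low (by omega))).trans (h.s i)
  t i := (ha.reg _ (.low (by omega))).trans (h.t i)
  one := (ha.reg _ (.sys (by omega))).trans h.one
  sq := (ha.reg _ (.sys (by omega))).trans h.sq
  cu := (ha.reg _ (.sys (by omega))).trans h.cu
  var i hi := by
    rw [ha.reg _ (.var hi (by omega)), ha.reg _ (.var hi (by omega)),
      ha.reg _ (.var hi (by omega))]
    exact h.var i hi
  un R i := by
    rw [ha.mem _ _ (by omega) (by omega)]
    · exact h.un R i
    · have := cell_lt (show 0 < I.n from (Nat.zero_le _).trans_lt i.2) (show 0 < I.n from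
        (Nat.zero_le _).trans_lt i.2) i.2
      omega
  ter R i j l := by
    rw [ha.mem _ _ (by omega) (by omega) (cell_lt i.2 j.2 l.2)]
    exact h.ter R i j l
  stamp := ha.stamp h.stamp

/-- The formula may mention the relation that is being assigned. Hence all values are first computed
into the buffer and copied only afterwards, which makes the assignment simultaneous. -/
theorem EvalF.assignU (h : EvalF pu (ℓ + 1) (fun _ _ _ => True) φ (d - 1)) (r : ℕ) :
    Cmd ℓ (fun I ρ S => S.setU r fun v => φ I S (Function.update ρ ℓ v)) d := by
  obtain ⟨h0, p, C, hC, h⟩ := h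
  let fill : Prog → ℕ → Prog := fun p q => forP k ℓ
    (.seq p (block (addrOps k q [rVar k ℓ 0] ++ [.store (rA k) (rRes k)])))
  refine ⟨by linarith, .seq (fill p 1) (fill (block (addrOps k 1 [rVar k ℓ 0] ++
    [.load (rRes k) (rA k)])) (2 * r + 2)), (C + 21) + (2 * r + 2 + 40), by positivity,
    fun I S ρ σ hr => ?_⟩
  have hn := I.one_le ρ
  have hX := one_le_rpow_natCast hn h0
  have hn1 : (1 : ℝ) ≤ I.n := by exact_mod_cast hn
  rw [rpow_eq_mul hn]
  set X := (I.n : ℝ) ^ (d - 1)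
  let val : ℕ → Prop := fun x => ∃ hx : x < I.n, φ I S (Function.update ρ ℓ ⟨x, hx⟩)
  have hlt : ∀ x < I.n, x < I.n * I.n * I.n := fun x hx => by
    have := cell_lt (show 0 < I.n by omega) (show 0 < I.n by omega) hx
    omega
  refine Halts.seq (T₁ := I.n * ((C * X + ((1 : ℕ) + 8)) + 6) + 6)
    (T₂ := I.n * ((9 + ((2 * r + 2 : ℕ) + 8)) + 6) + 6) ?_ ?_
  · refine (Fills.un (G := I.G) (ℓ := ℓ) (q := 1) (p := p) (T := C * X) (val := val)
      (Pre := Rep ℓ I S ρ) le_rfl (fun σ h => h.ctrl) (fun σ σ' h ha => h.of_agree_tmp ha) ?_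
      σ hr).mono le_rfl ?_
    · intro v hv σ hr hvar
      refine (h I S _ σ (hr.snoc (v := ⟨v, hv⟩) hvar.1 hvar.2.1 hvar.2.2)
        trivial).mono le_rfl ?_
      rintro σ' ⟨h1, h2⟩
      refine ⟨h1.impure, h2.trans ?_⟩
      simp [val, hv]
    rintro σ₁ ⟨ha₁, hv₁, -⟩
    have hr₁ := hr.of_agree_tmp ha₁
    refine (Fills.un (G := I.G) (ℓ := ℓ) (q := 2 * r + 2) (T := 9) (val := val)
      (p := block (addrOps k 1 [rVar k ℓ 0] ++ [.load (rRes k) (rA k)]))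
      (Pre := fun σ => Ctrl k I.n σ ∧ ∀ x < I.n, σ.mem (cell I.n 1 x) ≠ 0 ↔ val x)
      (by omega) (fun σ h => h.1) ?_ ?_ σ₁ ?_).mono le_rfl ?_
    · rintro σ σ' ⟨hc, hv⟩ ha
      refine ⟨hc.of_agree ha, fun x hx => ?_⟩
      rw [ha.mem _ _ le_rfl (by omega) (hlt x hx)]
      exact hv x hx
    · rintro v hv σ ⟨hc, hval⟩ hvar
      refine Halts.block _ (by simp [length_addrOps]; norm_num) ?_
      rw [List.foldl_append, foldl_addrOps _ _ _ (by simp) _ hc.cu]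
      refine ⟨(((Fr.refl _ _ _ _ _).setReg (free_sys (by omega) (by omega)) _).setReg
        (free_sys (by omega) (by omega)) _).setReg (free_sys (by omega) (by omega)) _, ?_⟩
      simp only [List.foldl, exec_load, State.setReg_self, State.setReg_mem, List.map_cons,
        List.map_nil, List.sum_cons, List.sum_nil, hvar.1, add_zero]
      exact hval v hv
    · exact ⟨hr₁.ctrl, fun x hx => hv₁ x (hlt x hx) hx⟩
    rintro σ₂ ⟨ha₂, hv₂, hs₂⟩
    refine ⟨fun q hq => (ha₂.reg q hq).trans (ha₁.reg q hq), ?_⟩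
    have e := fun q hq => ha₂.reg q hq
    refine ⟨(e _ (.low (by omega))).trans hr₁.n, fun i => (e _ (.low (by omega))).trans (hr₁.s i),
      fun i => (e _ (.low (by omega))).trans (hr₁.t i), (e _ (.sys (by omega))).trans hr₁.one,
      (e _ (.sys (by omega))).trans hr₁.sq, (e _ (.sys (by omega))).trans hr₁.cu,
      fun i hi => ?_, fun R i => ?_, fun R i j l => ?_, ha₂.stamp hr₁.stamp⟩
    · rw [e _ (.var hi (by omega)), e _ (.var hi (by omega)), e _ (.var hi (by omega))]
      exact hr₁.var i hi
    · by_cases hR : R = r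
      · subst hR
        rw [hv₂ _ (hlt _ i.2) i.2, Store.setU_self]
        simp [val]
      · rw [ha₂.mem _ _ (by omega) (by omega) (hlt _ i.2), Store.setU_ne _ _ _ _ hR]
        exact hr₁.un R i
    · rw [ha₂.mem _ _ (by omega) (by omega) (cell_lt i.2 j.2 l.2)]
      exact hr₁.ter R i j l
  · push_cast
    have : (0 : ℝ) ≤ r := by positivity
    nlinarith [mul_nonneg this (by linarith : (0 : ℝ) ≤ X - 1),
      mul_nonneg (mul_nonneg this (by linarith : (0 : ℝ) ≤ X - 1)) (by linarith : (0 : ℝ) ≤ I.n)]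

/-- Buffered as in `EvalF.assignU`; the three nested loops account for the exponent `3`. -/
theorem EvalF.assignT (h : EvalF pu (ℓ + 3) (fun _ _ _ => True) φ (d - 3)) (r : ℕ) :
    Cmd ℓ (fun I ρ S => S.setT r fun i j l => φ I S
      (Function.update (Function.update (Function.update ρ ℓ i) (ℓ + 1) j) (ℓ + 2) l)) d := by
  obtain ⟨h0, p, C, hC, h⟩ := h
  let fill : Prog → ℕ → Prog := fun p q => forP k ℓ (forP k (ℓ + 1) (forP k (ℓ + 2)
    (.seq p (block (addrOps k q [rVar k ℓ 2, rVar k (ℓ + 1) 1, rVar k (ℓ + 2) 0] ++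
      [.store (rA k) (rRes k)])))))
  refine ⟨by linarith, .seq (fill p 1) (fill (block (addrOps k 1
    [rVar k ℓ 2, rVar k (ℓ + 1) 1, rVar k (ℓ + 2) 0] ++
    [.load (rRes k) (rA k)])) (2 * r + 3)), (C + 50) + (2 * r + 3 + 90), by positivity,
    fun I S ρ σ hr => ?_⟩
  have hn := I.one_le ρ
  have hX := one_le_rpow_natCast hn h0
  have hn1 : (1 : ℝ) ≤ I.n := by exact_mod_cast hn
  rw [rpow_eq_mul hn, rpow_eq_mul hn, rpow_eq_mul hn,
    show d - 1 - 1 - 1 = d - 3 by ring]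
  set X := (I.n : ℝ) ^ (d - 3)
  let val : ℕ → Prop := fun x => ∃ i j l : Fin I.n, x = i * (I.n * I.n) + j * I.n + l ∧ φ I S
      (Function.update (Function.update (Function.update ρ ℓ i) (ℓ + 1) j) (ℓ + 2) l)
  -- A cell determines its triple, by uniqueness of digits in base `n`: division by `n * n` isolates
  -- `i`, division by `n` then isolates `j`.
  have hval : ∀ i j l : Fin I.n, val (i * (I.n * I.n) + j * I.n + l) ↔ φ I S
      (Function.update (Function.update (Function.update ρ ℓ i) (ℓ + 1) j) (ℓ + 2) l) := by
    intro i j l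
    refine ⟨?_, fun h => ⟨i, j, l, rfl, h⟩⟩
    rintro ⟨i', j', l', he, h⟩
    have e1 : (i : ℕ) = i' ∧ (j * I.n + l : ℕ) = j' * I.n + l' := by
      have a1 := cell_lt (n := I.n) (i := 0) (by omega) j.2 l.2
      have a2 := cell_lt (n := I.n) (i := 0) (by omega) j'.2 l'.2
      have b1 : (j * I.n + l : ℕ) < I.n * I.n := by
        have := Nat.mul_le_mul_right I.n (Nat.succ_le_of_lt j.2)
        rw [Nat.succ_mul] at this; omega
      have b2 : (j' * I.n + l' : ℕ) < I.n * I.n := by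
        have := Nat.mul_le_mul_right I.n (Nat.succ_le_of_lt j'.2)
        rw [Nat.succ_mul] at this; omega
      have hd1 := congrArg (· / (I.n * I.n)) he
      have hm1 := congrArg (· % (I.n * I.n)) he
      simp only [add_assoc] at hd1 hm1
      rw [mul_comm (i : ℕ), mul_comm (i' : ℕ), Nat.mul_add_div (by positivity),
        Nat.mul_add_div (by positivity), Nat.div_eq_of_lt b1, Nat.div_eq_of_lt b2] at hd1
      rw [mul_comm (i : ℕ), mul_comm (i' : ℕ), Nat.mul_add_mod, Nat.mul_add_mod,
        Nat.mod_eq_of_lt b1, Nat.mod_eq_of_lt b2] at hm1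
      exact ⟨by simpa using hd1, hm1⟩
    have hd2 := congrArg (· / I.n) e1.2
    have hm2 := congrArg (· % I.n) e1.2
    rw [mul_comm (j : ℕ), mul_comm (j' : ℕ), Nat.mul_add_div (by positivity),
      Nat.mul_add_div (by positivity), Nat.div_eq_of_lt l.2, Nat.div_eq_of_lt l'.2] at hd2
    rw [mul_comm (j : ℕ), mul_comm (j' : ℕ), Nat.mul_add_mod, Nat.mul_add_mod,
      Nat.mod_eq_of_lt l.2, Nat.mod_eq_of_lt l'.2] at hm2
    obtain rfl : i = i' := Fin.ext e1.1
    obtain rfl : j = j' := Fin.ext (by simpa using hd2)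
    obtain rfl : l = l' := Fin.ext hm2
    exact h
  refine Halts.seq (T₁ := I.n * ((I.n * ((I.n * ((C * X + ((1 : ℕ) + 10)) + 6) + 6) + 6) + 6)
    + 6) + 6) (T₂ := I.n * ((I.n * ((I.n * ((11 + ((2 * r + 3 : ℕ) + 10)) + 6) + 6) + 6) + 6)
    + 6) + 6) ?_ ?_
  · refine (Fills.ter (G := I.G) (ℓ := ℓ) (q := 1) (p := p) (T := C * X) (val := val)
      (Pre := Rep ℓ I S ρ) le_rfl (fun σ h => h.ctrl) (fun σ σ' h ha => h.of_agree_tmp ha) ?_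
      σ hr).mono le_rfl ?_
    · intro i hi j hj l hl σ hr v0 v1 v2
      have hr3 := ((hr.snoc (v := ⟨i, hi⟩) v0.1 v0.2.1 v0.2.2).snoc (v := ⟨j, hj⟩)
        v1.1 v1.2.1 v1.2.2).snoc (v := ⟨l, hl⟩) v2.1 v2.2.1 v2.2.2
      refine (h I S _ σ hr3 trivial).mono le_rfl ?_
      rintro σ' ⟨h1, h2⟩
      exact ⟨h1.impure, h2.trans (hval ⟨i, hi⟩ ⟨j, hj⟩ ⟨l, hl⟩).symm⟩
    rintro σ₁ ⟨ha₁, hv₁, -⟩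
    have hr₁ := hr.of_agree_tmp ha₁
    refine (Fills.ter (G := I.G) (ℓ := ℓ) (q := 2 * r + 3) (T := 11) (val := val)
      (p := block (addrOps k 1 [rVar k ℓ 2, rVar k (ℓ + 1) 1, rVar k (ℓ + 2) 0] ++
        [.load (rRes k) (rA k)]))
      (Pre := fun σ => Ctrl k I.n σ ∧ ∀ x < I.n * I.n * I.n, σ.mem (cell I.n 1 x) ≠ 0 ↔ val x)
      (by omega) (fun σ h => h.1) ?_ ?_ σ₁ ?_).mono le_rfl ?_
    · rintro σ σ' ⟨hc, hv⟩ ha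
      refine ⟨hc.of_agree ha, fun x hx => ?_⟩
      rw [ha.mem _ _ le_rfl (by omega) hx]
      exact hv x hx
    · rintro i hi j hj l hl σ ⟨hc, hval⟩ v0 v1 v2
      refine Halts.block _ (by simp [length_addrOps]; norm_num) ?_
      rw [List.foldl_append, foldl_addrOps _ _ _ (by simp) _ hc.cu]
      refine ⟨(((Fr.refl _ _ _ _ _).setReg (free_sys (by omega) (by omega)) _).setReg
        (free_sys (by omega) (by omega)) _).setReg (free_sys (by omega) (by omega)) _, ?_⟩
      simp only [List.foldl, exec_load, State.setReg_self, State.setReg_mem, List.map_cons,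
        List.map_nil, List.sum_cons, List.sum_nil, v0.2.2, v1.2.1, v2.1, add_zero, ← add_assoc]
      exact hval _ (cell_lt hi hj hl)
    · exact ⟨hr₁.ctrl, fun x hx => hv₁ x hx trivial⟩
    rintro σ₂ ⟨ha₂, hv₂, hs₂⟩
    refine ⟨fun q hq => (ha₂.reg q hq).trans (ha₁.reg q hq), ?_⟩
    have e := fun q hq => ha₂.reg q hq
    refine ⟨(e _ (.low (by omega))).trans hr₁.n, fun i => (e _ (.low (by omega))).trans (hr₁.s i),
      fun i => (e _ (.low (by omega))).trans (hr₁.t i), (e _ (.sys (by omega))).trans hr₁.one,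
      (e _ (.sys (by omega))).trans hr₁.sq, (e _ (.sys (by omega))).trans hr₁.cu,
      fun i hi => ?_, fun R i => ?_, fun R i j l => ?_, ha₂.stamp hr₁.stamp⟩
    · rw [e _ (.var hi (by omega)), e _ (.var hi (by omega)), e _ (.var hi (by omega))]
      exact hr₁.var i hi
    · rw [ha₂.mem _ _ (by omega) (by omega)]
      · exact hr₁.un R i
      · have := cell_lt (show 0 < I.n by omega) (show 0 < I.n by omega) i.2
        omega
    · by_cases hR : R = r
      · subst hR
        rw [hv₂ _ (cell_lt i.2 j.2 l.2) trivial, Store.setT_self]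
        exact hval i j l
      · rw [ha₂.mem _ _ (by omega) (by omega) (cell_lt i.2 j.2 l.2), Store.setT_ne _ _ _ _ hR]
        exact hr₁.ter R i j l
  · push_cast
    have hr0 : (0 : ℝ) ≤ r := by positivity
    set N : ℝ := (I.n : ℝ)
    have h2 : 1 ≤ N * N := by nlinarith
    have h3 : N * N ≤ N * (N * N) := by nlinarith
    have h4 : N ≤ N * N := by nlinarith
    have h5 : N * (N * N) ≤ N * (N * (N * X)) := by
      have := mul_le_mul_of_nonneg_left hX (by positivity : 0 ≤ N * (N * N))
      linarith
    have h6 : r * (N * (N * N)) ≤ r * (N * (N * (N * X))) := by gcongr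
    nlinarith

end

end RAM

namespace RAM

variable {𝒢 : GraphClass} {k : ℕ}

/-! ## First-order formulas -/

/-- First-order formulas; a quantifier at level `ℓ` binds the variable `ℓ`. -/
inductive Fml (k : ℕ) where
  | tr
  | adj (a b : Term k)
  | eq (a b : Term k)
  | lt (a b : Term k)
  | u (R : ℕ) (a : Term k)
  | t (R i j l : ℕ)
  | neg (φ : Fml k)
  | and (φ ψ : Fml k)
  | or (φ ψ : Fml k)
  | ex (φ : Fml k)

/-- The truth of a formula at level `ℓ`. -/
def Fml.sat : Fml k → ℕ → (I : Input 𝒢 k) → Store I.n → (ℕ → Fin I.n) → Prop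
  | .tr, _, _, _, _ => True
  | .adj a b, _, I, _, ρ => I.G.Adj (a.val I ρ) (b.val I ρ)
  | .eq a b, _, I, _, ρ => a.val I ρ = b.val I ρ
  | .lt a b, _, I, _, ρ => a.val I ρ < b.val I ρ
  | .u R a, _, I, S, ρ => S.u R (a.val I ρ)
  | .t R i j l, _, _, S, ρ => S.t R (ρ i) (ρ j) (ρ l)
  | .neg φ, ℓ, I, S, ρ => ¬ φ.sat ℓ I S ρ
  | .and φ ψ, ℓ, I, S, ρ => φ.sat ℓ I S ρ ∧ ψ.sat ℓ I S ρ
  | .or φ ψ, ℓ, I, S, ρ => φ.sat ℓ I S ρ ∨ ψ.sat ℓ I S ρ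
  | .ex φ, ℓ, I, S, ρ => ∃ v, φ.sat (ℓ + 1) I S (Function.update ρ ℓ v)

/-- All free variables of the formula are below `ℓ`. -/
def Fml.Below : Fml k → ℕ → Prop
  | .tr, _ => True
  | .adj a b, ℓ => a.Below ℓ ∧ b.Below ℓ
  | .eq a b, ℓ => a.Below ℓ ∧ b.Below ℓ
  | .lt a b, ℓ => a.Below ℓ ∧ b.Below ℓ
  | .u _ a, ℓ => a.Below ℓ
  | .t _ i j l, ℓ => i < ℓ ∧ j < ℓ ∧ l < ℓ
  | .neg φ, ℓ => φ.Below ℓ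
  | .and φ ψ, ℓ => φ.Below ℓ ∧ ψ.Below ℓ
  | .or φ ψ, ℓ => φ.Below ℓ ∧ ψ.Below ℓ
  | .ex φ, ℓ => φ.Below (ℓ + 1)

/-- The quantifier depth. -/
def Fml.depth : Fml k → ℕ
  | .neg φ => φ.depth
  | .and φ ψ => max φ.depth ψ.depth
  | .or φ ψ => max φ.depth ψ.depth
  | .ex φ => φ.depth + 1
  | _ => 0

/-- Connectives cost only a constant factor, so the quantifier depth is the exponent. -/
theorem Fml.evalF {pu : Bool} (φ : Fml k) : ∀ {ℓ : ℕ} {P : Pred 𝒢 k} {d : ℝ}, φ.Below ℓ →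
    (φ.depth : ℝ) ≤ d → EvalF pu ℓ P (φ.sat ℓ) d := by
  induction φ with
  | tr => intro ℓ P d _ hd; exact EvalF.true (by simpa [depth] using hd)
  | adj a b => intro ℓ P d h hd; exact EvalF.adj (by simpa [depth] using hd) h.1 h.2
  | eq a b => intro ℓ P d h hd; exact EvalF.eq (by simpa [depth] using hd) h.1 h.2
  | lt a b => intro ℓ P d h hd; exact EvalF.lt (by simpa [depth] using hd) h.1 h.2
  | u R a => intro ℓ P d h hd; exact EvalF.un (by simpa [depth] using hd) R h
  | t R i j l =>
    intro ℓ P d h hd; exact EvalF.ter (by simpa [depth] using hd) R h.1 h.2.1 h.2.2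
  | neg φ ih => intro ℓ P d h hd; exact (ih h hd).not
  | and φ ψ ih₁ ih₂ =>
    intro ℓ P d h hd
    simp only [depth, Nat.cast_max, max_le_iff] at hd
    exact (ih₁ h.1 hd.1).and (ih₂ h.2 hd.2)
  | or φ ψ ih₁ ih₂ =>
    intro ℓ P d h hd
    simp only [depth, Nat.cast_max, max_le_iff] at hd
    exact (ih₁ h.1 hd.1).or (ih₂ h.2 hd.2)
  | ex φ ih =>
    intro ℓ P d h hd
    simp only [depth, Nat.cast_add, Nat.cast_one] at hd
    exact EvalF.ex (P' := fun _ _ _ => True) (ih h (by linarith)) fun _ _ _ _ _ => trivial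

/-! ## Simulation -/

/-- All registers of the program are below `R`. -/
def Prog.Bdd (R : ℕ) : Prog → Prop
  | .op .skip => True
  | .op (.const r _) => r < R
  | .op (.add r a b) => r < R ∧ a < R ∧ b < R
  | .op (.sub r a b) => r < R ∧ a < R ∧ b < R
  | .op (.load r a) => r < R ∧ a < R
  | .op (.store a b) => a < R ∧ b < R
  | .op (.edge r a b) => r < R ∧ a < R ∧ b < R
  | .seq p q => p.Bdd R ∧ q.Bdd R
  | .ite r p q => r < R ∧ p.Bdd R ∧ q.Bdd R
  | .loop r p => r < R ∧ p.Bdd R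

theorem Prog.Bdd.mono {R R' : ℕ} (hR : R ≤ R') {p : Prog} (h : p.Bdd R) : p.Bdd R' := by
  induction p with
  | op o => cases o <;> simp only [Bdd] at * <;> omega
  | seq p q ihp ihq => exact ⟨ihp h.1, ihq h.2⟩
  | ite r p q ihp ihq => exact ⟨h.1.trans_le hR, ihp h.2.1, ihq h.2.2⟩
  | loop r p ih => exact ⟨h.1.trans_le hR, ih h.2⟩

theorem Prog.exists_bdd (p : Prog) : ∃ R, p.Bdd R := by
  induction p with
  | op o =>
    cases o with
    | skip => exact ⟨0, trivial⟩
    | const r c => exact ⟨r + 1, by simp [Bdd]⟩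
    | add r a b => exact ⟨r + a + b + 1, by simp only [Bdd]; omega⟩
    | sub r a b => exact ⟨r + a + b + 1, by simp only [Bdd]; omega⟩
    | load r a => exact ⟨r + a + 1, by simp only [Bdd]; omega⟩
    | store a b => exact ⟨a + b + 1, by simp only [Bdd]; omega⟩
    | edge r a b => exact ⟨r + a + b + 1, by simp only [Bdd]; omega⟩
  | seq p q ihp ihq =>
    obtain ⟨R, h⟩ := ihp
    obtain ⟨R', h'⟩ := ihq
    exact ⟨max R R', h.mono (le_max_left _ _), h'.mono (le_max_right _ _)⟩
  | ite r p q ihp ihq =>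
    obtain ⟨R, h⟩ := ihp
    obtain ⟨R', h'⟩ := ihq
    exact ⟨max (r + 1) (max R R'), lt_of_lt_of_le (by omega) (le_max_left _ _),
      h.mono ((le_max_left _ _).trans (le_max_right _ _)),
      h'.mono ((le_max_right _ _).trans (le_max_right _ _))⟩
  | loop r p ih =>
    obtain ⟨R, h⟩ := ih
    exact ⟨max (r + 1) R, lt_of_lt_of_le (by omega) (le_max_left _ _), h.mono (le_max_right _ _)⟩

/-- Simulate a program on an induced subgraph: the memory cell `a` is kept in cell `3 * a`, and is
valid if cell `3 * a + 1` holds the current version; cell `3 * i + 2` holds the vertex that has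
number `i` in the induced subgraph. -/
def simP (k : ℕ) : Prog → Prog
  | .op .skip => .op .skip
  | .op (.const r c) => .op (.const (rSim k r) c)
  | .op (.add r a b) => .op (.add (rSim k r) (rSim k a) (rSim k b))
  | .op (.sub r a b) => .op (.sub (rSim k r) (rSim k a) (rSim k b))
  | .op (.load r a) => .seq (block [.add (rA k) (rSim k a) (rSim k a),
      .add (rA k) (rA k) (rSim k a), .add (rB k) (rA k) (rOne k), .load (rB k) (rB k),
      .sub (rC k) (rB k) (rVer k), .sub (rB k) (rVer k) (rB k), .add (rB k) (rB k) (rC k)])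
      (.ite (rB k) (.op (.const (rSim k r) 0)) (.op (.load (rSim k r) (rA k))))
  | .op (.store a b) => block [.add (rA k) (rSim k a) (rSim k a),
      .add (rA k) (rA k) (rSim k a), .store (rA k) (rSim k b), .add (rA k) (rA k) (rOne k),
      .store (rA k) (rVer k)]
  | .op (.edge r a b) => .seq (block [.sub (rA k) (rM k) (rSim k a), .sub (rB k) (rM k) (rSim k b)])
      (.ite (rA k) (.ite (rB k) (block [.add (rA k) (rSim k a) (rSim k a),
        .add (rA k) (rA k) (rSim k a), .const (rB k) 2, .add (rA k) (rA k) (rB k),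
        .load (rC k) (rA k), .add (rA k) (rSim k b) (rSim k b), .add (rA k) (rA k) (rSim k b),
        .add (rA k) (rA k) (rB k), .load (rA k) (rA k), .edge (rSim k r) (rC k) (rA k)])
        (.op (.const (rSim k r) 0))) (.op (.const (rSim k r) 0)))
  | .seq p q => .seq (simP k p) (simP k q)
  | .ite r p q => .ite (rSim k r) (simP k p) (simP k q)
  | .loop r p => .loop (rSim k r) (simP k p)

/-- The state `σ'` represents the state `σ` of the simulated machine. -/
structure SimRel (k R : ℕ) {m n : ℕ} (e : Fin m → Fin n) (σ σ' : State) : Prop where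
  reg : ∀ r < R, σ'.reg (rSim k r) = σ.reg r
  mem : ∀ a, σ.mem a = if σ'.mem (3 * a + 1) = σ'.reg (rVer k) then σ'.mem (3 * a) else 0
  tab : ∀ i : Fin m, σ'.mem (3 * i + 2) = e i
  size : σ'.reg (rM k) = m
  one : σ'.reg (rOne k) = 1

/-- What a simulation leaves unchanged. -/
structure SimFr (k : ℕ) (σ σ' : State) : Prop where
  reg : ∀ r, (∀ i, r ≠ rSim k i) → r ≠ rA k → r ≠ rB k → r ≠ rC k → σ'.reg r = σ.reg r
  mem : ∀ a, σ'.mem (3 * a + 2) = σ.mem (3 * a + 2)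
  stamp : ∀ a, σ'.mem (3 * a + 1) = σ.mem (3 * a + 1) ∨ σ'.mem (3 * a + 1) = σ.reg (rVer k)

theorem SimFr.ver {σ σ' : State} (h : SimFr k σ σ') : σ'.reg (rVer k) = σ.reg (rVer k) :=
  h.reg _ (by simp) (by simp) (by simp) (by simp)

theorem SimFr.trans {σ₁ σ₂ σ₃ : State} (h : SimFr k σ₁ σ₂) (h' : SimFr k σ₂ σ₃) :
    SimFr k σ₁ σ₃ where
  reg r h0 h1 h2 h3 := (h'.reg r h0 h1 h2 h3).trans (h.reg r h0 h1 h2 h3)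
  mem a := (h'.mem a).trans (h.mem a)
  stamp a := by
    rcases h'.stamp a with h1 | h1
    · rw [h1]; exact h.stamp a
    · right; rw [h1, h.ver]

theorem SimFr.refl (σ : State) : SimFr k σ σ :=
  ⟨fun _ _ _ _ _ => rfl, fun _ => rfl, fun _ => Or.inl rfl⟩

theorem SimFr.setReg {σ σ' : State} (h : SimFr k σ σ') {r : ℕ}
    (hr : r = rA k ∨ r = rB k ∨ r = rC k ∨ ∃ i, r = rSim k i) (x : ℕ) :
    SimFr k σ (σ'.setReg r x) := by
  refine h.trans ⟨fun q h0 h1 h2 h3 => State.setReg_ne _ _ ?_, fun _ => rfl, fun _ => Or.inl rfl⟩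
  rintro rfl
  rcases hr with rfl | rfl | rfl | ⟨i, rfl⟩
  · exact h1 rfl
  · exact h2 rfl
  · exact h3 rfl
  · exact h0 i rfl

section
variable {R m n : ℕ} {e : Fin m → Fin n} {σ σ' : State}

theorem SimRel.setAux (h : SimRel k R e σ σ') {r : ℕ} (hr : r = rA k ∨ r = rB k ∨ r = rC k)
    (x : ℕ) : SimRel k R e σ (σ'.setReg r x) := by
  rcases hr with rfl | rfl | rfl <;>
    exact ⟨fun r hr => by simpa [State.setReg_reg] using h.reg r hr,
      fun a => by simpa [State.setReg_reg] using h.mem a, h.tab,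
      by simpa [State.setReg_reg] using h.size, by simpa [State.setReg_reg] using h.one⟩

theorem SimRel.setSim (h : SimRel k R e σ σ') (r x : ℕ) :
    SimRel k R e (σ.setReg r x) (σ'.setReg (rSim k r) x) := by
  refine ⟨fun q hq => ?_, fun a => by simpa [State.setReg_reg] using h.mem a, h.tab,
    by simpa [State.setReg_reg] using h.size, by simpa [State.setReg_reg] using h.one⟩
  simp only [State.setReg_reg, rSim_inj]
  split_ifs
  · rfl
  · exact h.reg q hq

theorem adjEntry_of_le {G : SimpleGraph (Fin n)} {a b : ℕ} (h : n ≤ a ∨ n ≤ b) :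
    adjEntry G a b = 0 := by
  unfold adjEntry
  rw [if_neg]
  rintro ⟨ha, hb, -⟩
  omega

/-- Each operation becomes a fixed piece of straight-line code with a few tests. Reading the
adjacency matrix is the most expensive case and gives the `16 = 3 + 13`. -/
theorem Op.simulate {G : SimpleGraph (Fin n)} {H : SimpleGraph (Fin m)}
    (he : ∀ i j, H.Adj i j ↔ G.Adj (e i) (e j)) (o : Op) (hb : (Prog.op o).Bdd R)
    (h : SimRel k R e σ σ') :
    Halts G (simP k (.op o)) σ' 16
      (fun σ'' => SimRel k R e (o.exec H σ) σ'' ∧ SimFr k σ' σ'') := by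
  cases o with
  | skip => exact Halts.op (by norm_num) ⟨h, SimFr.refl _⟩
  | const r c =>
    exact Halts.op (by norm_num) ⟨h.setSim r c, (SimFr.refl _).setReg (by simp) _⟩
  | add r a b =>
    refine Halts.op (by norm_num) ⟨?_, (SimFr.refl _).setReg (by simp) _⟩
    simp only [exec_add, h.reg a hb.2.1, h.reg b hb.2.2]
    exact h.setSim r _
  | sub r a b =>
    refine Halts.op (by norm_num) ⟨?_, (SimFr.refl _).setReg (by simp) _⟩
    simp only [exec_sub, h.reg a hb.2.1, h.reg b hb.2.2]
    exact h.setSim r _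
  | load r a =>
    refine Halts.seq (T₁ := 8) (T₂ := 2) (Halts.block _ (by norm_num) ?_) (by norm_num)
    have ha := h.reg a hb.2
    simp only [List.foldl, exec_add, exec_sub, exec_load]
    set σ₁ := State.setReg _ (rB k) _ with hσ₁
    have hr : SimRel k R e σ σ₁ := (((((((h.setAux (by simp) _).setAux (by simp) _).setAux
      (by simp) _).setAux (by simp) _).setAux (by simp) _).setAux (by simp) _).setAux (by simp) _)
    have hf : SimFr k σ' σ₁ := ((((((((SimFr.refl _).setReg (by simp) _).setReg (by simp) _).setReg
      (by simp) _).setReg (by simp) _).setReg (by simp) _).setReg (by simp) _).setReg (by simp) _)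
    have hA : σ₁.reg (rA k) = 3 * σ.reg a := by
      simp [hσ₁, State.setReg_reg, ha]; omega
    have hm : σ₁.mem = σ'.mem := rfl
    have hv := hf.ver
    -- `rB` holds the distance between the stamp of the cell and the current version; a cell with an
    -- outdated stamp has to read as `0`.
    have hB : σ₁.reg (rB k) = 0 ↔ σ'.mem (3 * σ.reg a + 1) = σ'.reg (rVer k) := by
      have : σ.reg a + σ.reg a + σ.reg a = 3 * σ.reg a := by ring
      simp [hσ₁, State.setReg_reg, ha, h.one, this]; omega
    refine Halts.ite (T := 1) (fun hne => Halts.op le_rfl ?_) (fun hz => Halts.op le_rfl ?_)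
      (by norm_num)
    · refine ⟨?_, hf.setReg (by simp) _⟩
      have : σ.mem (σ.reg a) = 0 := by rw [h.mem, if_neg fun h => hne (hB.2 h)]
      simp only [exec_const, this]
      exact hr.setSim r 0
    · refine ⟨?_, hf.setReg (by simp) _⟩
      have : σ.mem (σ.reg a) = σ'.mem (3 * σ.reg a) := by rw [h.mem, if_pos (hB.1 hz)]
      simp only [exec_load, this, hA, hm]
      exact hr.setSim r _
  | store a b =>
    refine Halts.block _ (by norm_num) ?_
    have ha := h.reg a hb.1
    have hb' := h.reg b hb.2
    have h3 : σ.reg a + σ.reg a + σ.reg a = 3 * σ.reg a := by ring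
    simp [State.setReg_reg, ha, hb', h.one, h3]
    set σ₁ : State := ((((σ'.setReg (rA k) (σ.reg a + σ.reg a)).setReg (rA k) (3 * σ.reg a)).setMem
      (3 * σ.reg a) (σ.reg b)).setReg (rA k) (3 * σ.reg a + 1)).setMem (3 * σ.reg a + 1)
      (σ'.reg (rVer k)) with hσ₁
    have hreg : ∀ r, r ≠ rA k → σ₁.reg r = σ'.reg r := fun r hr => by
      simp [hσ₁, State.setReg_reg, hr]
    have hmem : ∀ x, σ₁.mem x = if x = 3 * σ.reg a + 1 then σ'.reg (rVer k) else
        if x = 3 * σ.reg a then σ.reg b else σ'.mem x := fun x => by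
      simp [hσ₁, State.setMem_mem]
    refine ⟨⟨fun r hr => ?_, fun x => ?_, fun i => ?_, ?_, ?_⟩, ⟨fun r _ hA _ _ => hreg r hA,
      fun x => ?_, fun x => ?_⟩⟩
    · rw [hreg _ (by simp)]; exact h.reg r hr
    · rw [State.setMem_mem, hreg _ (by simp), hmem, hmem]
      by_cases hx : x = σ.reg a
      · subst hx
        simp
      · rw [if_neg hx, if_neg (show ¬ 3 * x + 1 = 3 * σ.reg a + 1 by omega),
          if_neg (show ¬ 3 * x + 1 = 3 * σ.reg a by omega),
          if_neg (show ¬ 3 * x = 3 * σ.reg a + 1 by omega),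
          if_neg (show ¬ 3 * x = 3 * σ.reg a by omega)]
        exact h.mem x
    · rw [hmem, if_neg (by omega), if_neg (by omega)]; exact h.tab i
    · rw [hreg _ (by simp)]; exact h.size
    · rw [hreg _ (by simp)]; exact h.one
    · rw [hmem, if_neg (by omega), if_neg (by omega)]
    · rw [hmem]
      split_ifs
      · exact Or.inr rfl
      · omega
      · exact Or.inl rfl
  | edge r a b =>
    refine Halts.seq (T₁ := 3) (T₂ := 13) (Halts.block _ (by norm_num) ?_) (by norm_num)
    have ha := h.reg a hb.2.1
    have hb' := h.reg b hb.2.2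
    simp only [List.foldl, exec_sub]
    set σ₁ := State.setReg _ (rB k) _ with hσ₁
    have hr : SimRel k R e σ σ₁ := (h.setAux (by simp) _).setAux (by simp) _
    have hf : SimFr k σ' σ₁ := ((SimFr.refl _).setReg (by simp) _).setReg (by simp) _
    have hA : σ₁.reg (rA k) = m - σ.reg a := by simp [hσ₁, State.setReg_reg, ha, h.size]
    have hB : σ₁.reg (rB k) = m - σ.reg b := by simp [hσ₁, State.setReg_reg, hb', h.size]
    -- The vertex table is meaningful only below `m`, so indices out of range must be caught before
    -- the table is consulted.
    have hzero : (m ≤ σ.reg a ∨ m ≤ σ.reg b) →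
        SimRel k R e ((Op.edge r a b).exec H σ) (σ₁.setReg (rSim k r) 0) ∧
        SimFr k σ' (σ₁.setReg (rSim k r) 0) := fun hle =>
      ⟨by rw [exec_edge, adjEntry_of_le hle]; exact hr.setSim r 0, hf.setReg (by simp) _⟩
    refine Halts.ite (T := 12) (fun hne => ?_) (fun hz => Halts.op (by norm_num) (hzero ?_))
      (by norm_num)
    · refine Halts.ite (T := 11) (fun hne' => ?_) (fun hz => Halts.op (by norm_num) (hzero ?_))
        (by norm_num)
      · have hla : σ.reg a < m := by omega
        have hlb : σ.reg b < m := by omega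
        refine Halts.block _ (by norm_num) ?_
        have ha₁ := hr.reg a hb.2.1
        have hb₁ := hr.reg b hb.2.2
        have ta := hr.tab ⟨_, hla⟩
        have tb := hr.tab ⟨_, hlb⟩
        have h3 : ∀ x : ℕ, x + x + x = 3 * x := fun x => by ring
        simp only [List.foldl, exec_add, exec_load, exec_const, exec_edge]
        set σ₂ := State.setReg _ (rA k) (State.mem _ _) with hσ₂
        have hr₂ : SimRel k R e σ σ₂ := ((((((((hr.setAux (by simp) _).setAux (by simp) _).setAux
          (by simp) _).setAux (by simp) _).setAux (by simp) _).setAux (by simp) _).setAux (by simp)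
          _).setAux (by simp) _).setAux (by simp) _
        have hf₂ : SimFr k σ' σ₂ := ((((((((hf.setReg (by simp) _).setReg (by simp) _).setReg
          (by simp) _).setReg (by simp) _).setReg (by simp) _).setReg (by simp) _).setReg (by simp)
          _).setReg (by simp) _).setReg (by simp) _
        have hA₂ : σ₂.reg (rA k) = e ⟨_, hlb⟩ := by
          simp [hσ₂, State.setReg_reg, hb₁, h3, tb]
        have hC₂ : σ₂.reg (rC k) = e ⟨_, hla⟩ := by
          simp [hσ₂, State.setReg_reg, ha₁, h3, ta]
        refine ⟨?_, hf₂.setReg (by simp) _⟩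
        have : adjEntry G (σ₂.reg (rC k)) (σ₂.reg (rA k)) = adjEntry H (σ.reg a) (σ.reg b) := by
          rw [hA₂, hC₂]
          unfold adjEntry
          congr 1
          simp [hla, hlb, he]
        rw [this]
        exact hr₂.setSim r _
      · right; omega
    · left; omega

/-- The control structure is copied, and each test of the simulated program is itself a counted
step. So the overhead of a single operation bounds the total overhead. -/
theorem Run.simulate {G : SimpleGraph (Fin n)} {H : SimpleGraph (Fin m)}
    (he : ∀ i j, H.Adj i j ↔ G.Adj (e i) (e j)) {p : Prog} {τ : ℕ} {σ₁ σ₂ : State}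
    (hrun : Run H p σ₁ τ σ₂) : ∀ {σ' : State}, p.Bdd R → SimRel k R e σ₁ σ' →
    Halts G (simP k p) σ' (16 * τ) (fun σ'' => SimRel k R e σ₂ σ'' ∧ SimFr k σ' σ'') := by
  induction hrun with
  | op o σ =>
    intro σ' hb h
    exact (Op.simulate he o hb h).mono (by norm_num) fun _ h => h
  | @seq _ _ _ _ _ τ₁ τ₂ h₁ h₂ ih₁ ih₂ =>
    intro σ' hb h
    refine Halts.seq (T₂ := 16 * τ₂) ((ih₁ hb.1 h).mono le_rfl ?_) (by push_cast; linarith)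
    rintro σ'' ⟨hr, hf⟩
    exact (ih₂ hb.2 hr).mono le_rfl fun _ h => ⟨h.1, hf.trans h.2⟩
  | ite_true hne h₁ ih =>
    intro σ' hb h
    refine Halts.ite (fun _ => ih hb.2.1 h) (fun hz => ?_) (by push_cast; linarith)
    rw [h.reg _ hb.1] at hz; exact absurd hz hne
  | ite_false hz h₁ ih =>
    intro σ' hb h
    refine Halts.ite (fun hne => ?_) (fun _ => ih hb.2.2 h) (by push_cast; linarith)
    rw [h.reg _ hb.1] at hne; exact absurd hz hne
  | loop_done hz =>
    intro σ' hb h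
    exact ⟨1, σ', .loop_done (by rw [h.reg _ hb.1]; exact hz), by norm_num, h, SimFr.refl _⟩
  | loop_step hne h₁ h₂ ih₁ ih₂ =>
    intro σ' hb h
    obtain ⟨τ₁, σ₃, hr₁, ht₁, h₃, hf₃⟩ := ih₁ hb.2 h
    obtain ⟨τ₂, σ₄, hr₂, ht₂, h₄, hf₄⟩ := ih₂ hb h₃
    refine ⟨τ₁ + τ₂ + 1, σ₄, .loop_step (by rw [h.reg _ hb.1]; exact hne) hr₁ hr₂, ?_, h₄,
      hf₃.trans hf₄⟩
    push_cast; linarith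

end

end RAM

/-! ## Connected sets and solutions as families of connected sets -/

section
variable {V : Type*} (G : SimpleGraph V)

/-- `v` can be reached from `u` within `U`. -/
def Conn (U : Set V) (u v : V) : Prop :=
  u ∈ U ∧ Relation.ReflTransGen (fun a b => G.Adj a b ∧ b ∈ U) u v

/-- There are pairwise disjoint sets without edges between them that connect, within `U`, the pairs
with index in `J`. -/
def SolvableOn {ι : Type*} (J : Set ι) (U : Set V) (s t : ι → V) : Prop :=
  ∃ S : ι → Set V, (∀ j ∈ J, S j ⊆ U ∧ Conn G (S j) (s j) (t j)) ∧
    ∀ i ∈ J, ∀ j ∈ J, i ≠ j → ∀ u ∈ S i, ∀ v ∈ S j, u ≠ v ∧ ¬ G.Adj u v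

variable {G}

theorem Conn.refl {U : Set V} {u : V} (h : u ∈ U) : Conn G U u u := ⟨h, .refl⟩

theorem Conn.tail {U : Set V} {u v w : V} (h : Conn G U u v) (ha : G.Adj v w) (hw : w ∈ U) :
    Conn G U u w := ⟨h.1, h.2.tail ⟨ha, hw⟩⟩

theorem Conn.mem_right {U : Set V} {u v : V} (h : Conn G U u v) : v ∈ U := by
  obtain ⟨hu, h⟩ := h
  rcases Relation.ReflTransGen.cases_tail h with rfl | ⟨w, -, -, hv⟩
  · exact hu
  · exact hv

theorem Conn.trans {U : Set V} {u v w : V} (h : Conn G U u v) (h' : Conn G U v w) :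
    Conn G U u w := ⟨h.1, h.2.trans h'.2⟩

theorem Conn.mono {U U' : Set V} {u v : V} (h : Conn G U u v) (hU : U ⊆ U') : Conn G U' u v :=
  ⟨hU h.1, Relation.ReflTransGen.mono (fun _ _ h => ⟨h.1, hU h.2⟩) _ _ h.2⟩

/-- Induction along a path. -/
theorem Conn.ind {U : Set V} {u : V} {p : V → Prop} {v : V} (h : Conn G U u v) (h0 : p u)
    (hs : ∀ a b, Conn G U u a → G.Adj a b → b ∈ U → p a → p b) : p v := by
  obtain ⟨hu, h⟩ := h
  induction h with
  | refl => exact h0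
  | tail h1 h2 ih => exact hs _ _ ⟨hu, h1⟩ h2.1 h2.2 ih

theorem Conn.symm {U : Set V} {u v : V} (h : Conn G U u v) : Conn G U v u := by
  refine h.ind (p := fun v => Conn G U v u) (.refl h.1) fun a b hua hab hb ih => ?_
  exact (Conn.refl hb |>.tail hab.symm hua.mem_right).trans ih

theorem Conn.of_adj {U : Set V} {u v : V} (hu : u ∈ U) (h : G.Adj u v) (hv : v ∈ U) :
    Conn G U u v := (Conn.refl hu).tail h hv

/-- Every vertex of a path in `U` from a vertex of `A` that cannot leave `A` is in `A`. -/
theorem Conn.mem_of_closed {U A : Set V} {u v : V} (h : Conn G U u v) (hu : u ∈ A)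
    (hA : ∀ a ∈ A, ∀ b ∈ U, G.Adj a b → b ∈ A) : Conn G (U ∩ A) u v :=
  h.ind (p := fun v => Conn G (U ∩ A) u v) (.refl ⟨h.1, hu⟩) fun _ b _ hab hb ih =>
    ih.tail hab ⟨hb, hA _ ih.mem_right.2 b hb hab⟩

theorem Conn.of_walk {u v : V} (p : G.Walk u v) : Conn G {w | w ∈ p.support} u v := by
  induction p with
  | nil => exact .refl (by simp)
  | cons h p ih =>
    refine (Conn.of_adj (by simp) h (by simp)).trans (ih.mono ?_)
    intro w hw
    simp only [Set.mem_ofPred_eq] at hw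
    simp [hw]

theorem Conn.exists_path {U : Set V} {u v : V} (h : Conn G U u v) :
    ∃ p : G.Path u v, ∀ w ∈ p.1.support, w ∈ U := by
  classical
  have : ∃ p : G.Walk u v, ∀ w ∈ p.support, w ∈ U := by
    refine h.ind (p := fun v => ∃ p : G.Walk u v, ∀ w ∈ p.support, w ∈ U)
      ⟨.nil, by simpa using h.1⟩ ?_
    rintro a b hua hab hb ⟨p, hp⟩
    refine ⟨p.concat hab, fun w hw => ?_⟩
    simp only [SimpleGraph.Walk.support_concat, List.mem_append,
      List.mem_singleton] at hw
    rcases hw with h | rfl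
    · exact hp _ h
    · exact hb
  obtain ⟨p, hp⟩ := this
  exact ⟨p.toPath, fun w hw => hp w (SimpleGraph.Walk.support_toPath_subset_support p hw)⟩

/-- Disjointness and absence of edges pass to subsets, so sets that connect the pairs are as good as
paths: a path can be chosen inside each set. From here on solutions are families of sets, which are
easier to cut and glue. -/
theorem IDPInstance.hasSolution_iff {k : ℕ} (W : IDPInstance G k) :
    W.HasSolution ↔ SolvableOn G Set.univ Set.univ W.s W.t := by
  constructor
  · rintro ⟨P, hP⟩
    exact ⟨fun i => {w | w ∈ (P i).1.support}, fun j _ => ⟨Set.subset_univ _, Conn.of_walk _⟩,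
      fun i _ j _ hij => hP i j hij⟩
  · rintro ⟨S, hS, hd⟩
    choose P hP using fun i => (hS i trivial).2.exists_path
    exact ⟨P, fun i j hij u hu v hv => hd i trivial j trivial hij u (hP i u hu) v (hP j v hv)⟩

theorem SolvableOn.reindex {ι κ : Type*} (f : κ ↪ ι) {U : Set V} {s t : ι → V} :
    SolvableOn G Set.univ U (s ∘ f) (t ∘ f) ↔ SolvableOn G (Set.range f) U s t := by
  constructor
  · rintro ⟨S, h1, h2⟩
    have hS : ∀ i, Function.extend f S (fun _ => ∅) (f i) = S i := fun i => f.injective.extend_apply _ _ i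
    refine ⟨Function.extend f S fun _ => ∅, ?_, ?_⟩
    · rintro _ ⟨i, rfl⟩
      rw [hS]; exact h1 i trivial
    · rintro _ ⟨i, rfl⟩ _ ⟨j, rfl⟩ hij
      rw [hS, hS]
      exact h2 i trivial j trivial fun h => hij (by rw [h])
  · rintro ⟨S, h1, h2⟩
    exact ⟨S ∘ f, fun j _ => h1 _ ⟨j, rfl⟩, fun i _ j _ hij => h2 _ ⟨i, rfl⟩ _ ⟨j, rfl⟩
      fun h => hij (f.injective h)⟩

theorem Conn.map {V' : Type*} {H : SimpleGraph V'} {e : V' → V}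
    (he : ∀ i j, H.Adj i j → G.Adj (e i) (e j)) {U : Set V'} {u v : V'} (h : Conn H U u v) :
    Conn G (e '' U) (e u) (e v) :=
  h.ind (p := fun v => Conn G (e '' U) (e u) (e v)) (.refl ⟨_, h.1, rfl⟩)
    fun _ b _ hab hb ih => ih.tail (he _ _ hab) ⟨b, hb, rfl⟩

theorem Conn.comap {V' : Type*} {H : SimpleGraph V'} {e : V' ↪ V}
    (he : ∀ i j, G.Adj (e i) (e j) → H.Adj i j) {U : Set V} (hU : U ⊆ Set.range e) {u v : V'}
    (h : Conn G U (e u) (e v)) : Conn H (e ⁻¹' U) u v := by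
  have : ∃ w, e w = e v ∧ Conn H (e ⁻¹' U) u w := by
    refine h.ind (p := fun x => ∃ w, e w = x ∧ Conn H (e ⁻¹' U) u w) ⟨u, rfl, .refl h.1⟩ ?_
    rintro a b - hab hb ⟨w, rfl, hw⟩
    obtain ⟨x, rfl⟩ := hU hb
    exact ⟨x, rfl, hw.tail (he _ _ hab) hb⟩
  obtain ⟨w, hw, h⟩ := this
  rwa [e.injective hw] at h

theorem SolvableOn.comap {V' ι : Type*} {H : SimpleGraph V'} (e : V' ↪ V)
    (he : ∀ i j, H.Adj i j ↔ G.Adj (e i) (e j)) {J : Set ι} (s t : ι → V') :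
    SolvableOn H J Set.univ s t ↔ SolvableOn G J (Set.range e) (e ∘ s) (e ∘ t) := by
  constructor
  · rintro ⟨S, h1, h2⟩
    refine ⟨fun j => e '' S j, fun j hj => ⟨Set.image_subset_range _ _,
      (h1 j hj).2.map fun _ _ => (he _ _).1⟩, ?_⟩
    rintro i hi j hj hij _ ⟨u, hu, rfl⟩ _ ⟨v, hv, rfl⟩
    obtain ⟨h3, h4⟩ := h2 i hi j hj hij u hu v hv
    exact ⟨fun h => h3 (e.injective h), fun h => h4 ((he _ _).2 h)⟩
  · rintro ⟨S, h1, h2⟩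
    refine ⟨fun j => e ⁻¹' S j, fun j hj => ⟨Set.subset_univ _,
      (h1 j hj).2.comap (fun _ _ => (he _ _).2) (h1 j hj).1⟩, ?_⟩
    rintro i hi j hj hij u hu v hv
    obtain ⟨h3, h4⟩ := h2 i hi j hj hij _ hu _ hv
    exact ⟨fun h => h3 (by rw [h]), fun h => h4 ((he _ _).1 h)⟩

end

namespace RAM

variable {𝒢 : GraphClass} {k : ℕ}

/-! ## Solving an induced subinstance with a given program -/

/-- For each pair `(r, a)` in the list such that `a` has the value of the variable `ℓ`, copy the
accumulator of `ℓ` to register `r` of the simulated machine. -/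
def rankP (k ℓ : ℕ) : List (ℕ × Term k) → Prog
  | [] => .op .skip
  | x :: L => .seq (.seq (block [.sub (rA k) (rVar k ℓ 0) x.2.reg, .sub (rB k) x.2.reg (rVar k ℓ 0),
      .add (rA k) (rA k) (rB k)]) (.ite (rA k) (.op .skip)
        (block [.const (rB k) 0, .add (rSim k x.1) (rVar k ℓ 4) (rB k)]))) (rankP k ℓ L)

theorem Term.reg_ne_rSim {ℓ : ℕ} {a : Term k} (ha : a.Below ℓ) (i : ℕ) : a.reg ≠ rSim k i := by
  have := Term.prot ha
  intro h
  rw [h] at this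
  unfold Prot rSim at this
  omega

-- The accumulator of `ℓ` holds the number of vertices of the subgraph met so far. Copying it when
-- the loop passes a terminal gives that terminal its number in the subgraph, in the same loop that
-- builds the vertex table.
open Classical in
theorem Halts.rank {n : ℕ} (G : SimpleGraph (Fin n)) {ℓ : ℕ} (L : List (ℕ × Term k))
    (hL : ∀ x ∈ L, x.2.Below ℓ) : ∀ σ : State, Halts G (rankP k ℓ L) σ (8 * L.length + 1) fun σ' =>
      σ'.mem = σ.mem ∧ ∀ q, q ≠ rA k → q ≠ rB k → σ'.reg q =
        if ∃ x ∈ L, q = rSim k x.1 ∧ σ.reg x.2.reg = σ.reg (rVar k ℓ 0) then σ.reg (rVar k ℓ 4)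
        else σ.reg q := by
  induction L with
  | nil => intro σ; exact Halts.op (by simp) ⟨rfl, by simp⟩
  | cons x L ih =>
    intro σ
    have hx := hL x (by simp)
    refine Halts.seq (T₁ := 8) (T₂ := 8 * L.length + 1) ?_ (by
      simp only [List.length_cons]; push_cast; linarith)
    have key : Halts G (.seq (RAM.block [.sub (rA k) (rVar k ℓ 0) x.2.reg,
        .sub (rB k) x.2.reg (rVar k ℓ 0), .add (rA k) (rA k) (rB k)]) (.ite (rA k) (.op .skip)
        (RAM.block [.const (rB k) 0, .add (rSim k x.1) (rVar k ℓ 4) (rB k)]))) σ 8 fun σ' =>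
        σ'.mem = σ.mem ∧ ∀ q, q ≠ rA k → q ≠ rB k → σ'.reg q =
        if q = rSim k x.1 ∧ σ.reg x.2.reg = σ.reg (rVar k ℓ 0) then σ.reg (rVar k ℓ 4)
        else σ.reg q := by
      refine Halts.seq (T₁ := 4) (T₂ := 4) (Halts.block _ (by norm_num) ?_) (by norm_num)
      simp only [List.foldl, exec_sub, exec_add]
      refine Halts.ite (T := 3) (fun hne => Halts.op (by norm_num) ?_)
        (fun hz => Halts.block _ (by norm_num) ?_) (by norm_num)
      · refine ⟨rfl, fun q hA hB => ?_⟩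
        simp [State.setReg_reg, Term.reg_ne] at hne
        rw [if_neg (by omega)]
        simp [State.setReg_reg, hA, hB]
      · refine ⟨rfl, fun q hA hB => ?_⟩
        simp [State.setReg_reg, Term.reg_ne] at hz
        have he : σ.reg x.2.reg = σ.reg (rVar k ℓ 0) := by omega
        simp [State.setReg_reg, hA, hB, he]
    refine key.mono le_rfl ?_
    rintro σ₁ ⟨hm₁, hr₁⟩
    have hsame : ∀ q, q ≠ rA k → q ≠ rB k → (∀ i, q ≠ rSim k i) → σ₁.reg q = σ.reg q :=
      fun q h1 h2 h3 => by rw [hr₁ q h1 h2, if_neg fun h => h3 _ h.1]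
    refine (ih (fun y hy => hL y (by simp [hy])) σ₁).mono le_rfl ?_
    rintro σ₂ ⟨hm₂, hr₂⟩
    refine ⟨hm₂.trans hm₁, fun q hA hB => ?_⟩
    rw [hr₂ q hA hB, hsame (rVar k ℓ 0) (by simp) (by simp) (by simp),
      hsame (rVar k ℓ 4) (by simp) (by simp) (by simp), hr₁ q hA hB]
    have hiff : (∃ y ∈ L, q = rSim k y.1 ∧ σ₁.reg y.2.reg = σ.reg (rVar k ℓ 0)) ↔
        ∃ y ∈ L, q = rSim k y.1 ∧ σ.reg y.2.reg = σ.reg (rVar k ℓ 0) := by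
      refine exists_congr fun y => and_congr_right fun hy => and_congr_right fun _ => ?_
      rw [hsame y.2.reg (Term.reg_ne (by omega)) (Term.reg_ne (by omega))
        (Term.reg_ne_rSim (hL y (by simp [hy])))]
    simp only [hiff, List.mem_cons, exists_eq_or_imp]
    by_cases hE : ∃ y ∈ L, q = rSim k y.1 ∧ σ.reg y.2.reg = σ.reg (rVar k ℓ 0)
    · rw [if_pos hE, if_pos (Or.inr hE)]
    · rw [if_neg hE]
      by_cases hF : q = rSim k x.1 ∧ σ.reg x.2.reg = σ.reg (rVar k ℓ 0)
      · rw [if_pos hF, if_pos (Or.inl hF)]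
      · rw [if_neg hF, if_neg (not_or.2 ⟨hF, hE⟩)]

/-- The pairs (register of the initial state, terminal that it holds). -/
def initList {j : ℕ} (a b : Fin j → Term k) : List (ℕ × Term k) :=
  (List.finRange j).flatMap fun i : Fin j => [(2 * (i : ℕ) + 1, a i), (2 * (i : ℕ) + 2, b i)]

theorem mem_initList {j : ℕ} {a b : Fin j → Term k} {x : ℕ × Term k} :
    x ∈ initList a b ↔ ∃ i : Fin j, x = (2 * (i : ℕ) + 1, a i) ∨ x = (2 * (i : ℕ) + 2, b i) := by
  simp [initList]

theorem initList_unique {j : ℕ} {a b : Fin j → Term k} {x y : ℕ × Term k}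
    (hx : x ∈ initList a b) (hy : y ∈ initList a b) (h : x.1 = y.1) : x = y := by
  rw [mem_initList] at hx hy
  obtain ⟨i, rfl | rfl⟩ := hx <;> obtain ⟨i', rfl | rfl⟩ := hy
  · obtain rfl : i = i' := Fin.ext (by simp only at h; omega)
    rfl
  · simp only at h; omega
  · simp only at h; omega
  · obtain rfl : i = i' := Fin.ext (by simp only at h; omega)
    rfl

theorem foldl_zero {n : ℕ} (G : SimpleGraph (Fin n)) (R : ℕ) : ∀ σ : State,
    let σ' := ((List.range R).map fun r => Op.const (rSim k r) 0).foldl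
      (fun σ o => o.exec G σ) σ
    σ'.mem = σ.mem ∧ (∀ r < R, σ'.reg (rSim k r) = 0) ∧
      ∀ q, (∀ i, q ≠ rSim k i) → σ'.reg q = σ.reg q := by
  induction R with
  | zero => intro σ; simp
  | succ R ih =>
    intro σ
    obtain ⟨h1, h2, h3⟩ := ih σ
    simp only [List.range_succ, List.map_append, List.foldl_append, List.map_cons, List.map_nil,
      List.foldl_cons, List.foldl_nil, exec_const, State.setReg_mem]
    refine ⟨h1, fun r hr => ?_, fun q hq => ?_⟩
    · rw [State.setReg_reg]
      split_ifs with h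
      · rfl
      · exact h2 r (by simp only [rSim_inj] at h; omega)
    · rw [State.setReg_ne _ _ (hq R)]
      exact h3 q hq

/-- Number the vertices `v` for which `pψ` gives a nonzero result. -/
def numberP (k ℓ : ℕ) (pψ : Prog) (L : List (ℕ × Term k)) : Prog :=
  forP k ℓ (.seq pψ (.ite (rRes k) (.seq (block [.add (rA k) (rVar k ℓ 4) (rVar k ℓ 4),
    .add (rA k) (rA k) (rVar k ℓ 4), .const (rB k) 2, .add (rA k) (rA k) (rB k),
    .store (rA k) (rVar k ℓ 0)]) (.seq (rankP k ℓ L)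
      (.op (.add (rVar k ℓ 4) (rVar k ℓ 4) (rOne k))))) (.op .skip)))

section
variable {ℓ : ℕ} {I : Input 𝒢 k} {S : Store I.n} {ρ : ℕ → Fin I.n} {σ : State} {pψ : Prog} {T : ℝ}
  {L : List (ℕ × Term k)} {R : ℕ}

-- Vertices of `U` are numbered in increasing order, so `Nat.count p` sends a vertex to its number
-- and `Nat.nth p` is the table of the inverse. The membership test has to be pure, since the table
-- and the simulated registers are under construction while it runs.
open Classical in
theorem Halts.number (U : Set (Fin I.n)) (hr : Rep ℓ I S ρ σ)
    (hψ : ∀ v σ, Rep (ℓ + 1) I S (Function.update ρ ℓ v) σ → Halts I.G pψ σ T fun σ' =>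
      Fr true k I.n (ℓ + 1) σ σ' ∧ (σ'.reg (rRes k) ≠ 0 ↔ v ∈ U))
    (hL : ∀ x ∈ L, x.2.Below ℓ) (hLu : ∀ x ∈ L, ∀ y ∈ L, x.1 = y.1 → x = y)
    (hLU : ∀ x ∈ L, x.2.val I ρ ∈ U)
    (hacc : σ.reg (rVar k ℓ 4) = 0) (hz : ∀ r < R, σ.reg (rSim k r) = 0)
    (p : ℕ → Prop) (hp : ∀ v : Fin I.n, p v ↔ v ∈ U) :
    Halts I.G (numberP k ℓ pψ L) σ (I.n * ((T + (8 * L.length + 9)) + 6) + 6) fun σ' =>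
      Fr false k I.n ℓ σ σ' ∧ σ'.reg (rVer k) = σ.reg (rVer k) ∧
      σ'.reg (rVar k ℓ 4) = Nat.count p I.n ∧
      (∀ i < Nat.count p I.n, σ'.mem (3 * i + 2) = Nat.nth p i) ∧
      (∀ x ∈ L, σ'.reg (rSim k x.1) = Nat.count p (x.2.val I ρ)) ∧
      ∀ r < R, (∀ x ∈ L, x.1 ≠ r) → σ'.reg (rSim k r) = 0 := by
  let Inv : ℕ → State → Prop := fun v σ' => Fr false k I.n ℓ σ σ' ∧
    σ'.reg (rVer k) = σ.reg (rVer k) ∧ σ'.reg (rVar k ℓ 4) = Nat.count p v ∧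
    (∀ i < Nat.count p v, σ'.mem (3 * i + 2) = Nat.nth p i) ∧
    (∀ x ∈ L, (x.2.val I ρ : ℕ) < v → σ'.reg (rSim k x.1) = Nat.count p (x.2.val I ρ)) ∧
    ∀ r < R, (∀ x ∈ L, x.1 ≠ r) → σ'.reg (rSim k r) = 0
  refine (Halts.forP (T := T + (8 * L.length + 9)) Inv ?_ ?_ ?_ ?_).mono le_rfl ?_
  · rintro v σ' ⟨hf, -⟩
    have := hr.of_fr hf
    exact ⟨this.n, this.one, this.sq⟩
  · rintro v σ' j x hj ⟨h1, h2, h3, h4, h5, h6⟩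
    refine ⟨h1.setReg (free_var le_rfl (by omega)) _, ?_, ?_, h4, ?_, ?_⟩
    · rw [State.setReg_ne _ _ (by simp)]; exact h2
    · rw [State.setReg_ne _ _ (rVar_ne_acc hj).symm]; exact h3
    · intro y hy hlt
      rw [State.setReg_ne _ _ (by rw [ne_comm]; exact rVar_ne_rSim (by omega))]; exact h5 y hy hlt
    · intro r hr' hx
      rw [State.setReg_ne _ _ (by rw [ne_comm]; exact rVar_ne_rSim (by omega))]; exact h6 r hr' hx
  · rintro v σ' hv ⟨h1, h2, h3, h4, h5, h6⟩ r0 r1 r2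
    have hrep := (hr.of_fr h1).snoc (v := ⟨v, hv⟩) r0 r1 r2
    refine Halts.seq (T₁ := T) (T₂ := 8 * L.length + 9) ((hψ _ _ hrep).mono le_rfl ?_) le_rfl
    rintro σ₁ ⟨hf₁, hv₁⟩
    rw [← hp] at hv₁
    simp only at hv₁
    obtain ⟨hs₁, hver₁, hm₁⟩ := hf₁.sim rfl
    have hvar₁ : ∀ j < 5, σ₁.reg (rVar k ℓ j) = σ'.reg (rVar k ℓ j) := fun j hj =>
      hf₁.reg _ (.var (by omega) hj)
    have hf : Fr false k I.n ℓ σ σ₁ := h1.trans (hf₁.level (by omega)).impure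
    refine Halts.ite (T := 8 * L.length + 8) (fun hne => ?_) (fun he => ?_) (by linarith)
    · have hpv := hv₁.1 hne
      have hcnt : Nat.count p (v + 1) = Nat.count p v + 1 := by
        rw [Nat.count_succ, if_pos hpv]
      -- The table cell lies in region `0`, outside of what the frame protects.
      have hlt : Nat.count p v < I.n * I.n * I.n := by
        have h1 : Nat.count p v ≤ v := Nat.count_le p
        have h2 : I.n * 1 ≤ I.n * (I.n * I.n) :=
          Nat.mul_le_mul_left _ (Nat.mul_pos (by omega) (by omega))
        rw [← mul_assoc] at h2; omega
      refine Halts.seq (T₁ := 6) (T₂ := 8 * L.length + 2) (Halts.block _ (by norm_num) ?_)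
        (by linarith)
      simp only [List.foldl, exec_add, exec_const, exec_store]
      set σ₂ := State.setMem _ _ _ with hσ₂
      have hr₂ : ∀ q, q ≠ rA k → q ≠ rB k → σ₂.reg q = σ₁.reg q := fun q hA hB => by
        simp [hσ₂, State.setReg_reg, hA, hB]
      have hm₂ : ∀ x, σ₂.mem x = if x = 3 * Nat.count p v + 2 then v else σ₁.mem x := fun x => by
        have : Nat.count p v + Nat.count p v + Nat.count p v + 2 = 3 * Nat.count p v + 2 := by ring
        simp [hσ₂, State.setReg_reg, State.setMem_mem, hvar₁, h3, r0, this]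
      refine Halts.seq (T₁ := 8 * L.length + 1) (T₂ := 1) ((Halts.rank I.G L hL σ₂).mono le_rfl ?_)
        (by linarith)
      rintro σ₃ ⟨hm₃, hr₃⟩
      have hr₃' : ∀ q, q ≠ rA k → q ≠ rB k → (∀ i, q ≠ rSim k i) → σ₃.reg q = σ₁.reg q := by
        intro q hA hB hq
        rw [hr₃ q hA hB, if_neg fun ⟨x, _, h, _⟩ => hq _ h, hr₂ q hA hB]
      have hterm : ∀ x ∈ L, σ₂.reg x.2.reg = x.2.val I ρ := fun x hx => by
        rw [hr₂ _ (Term.reg_ne (by omega)) (Term.reg_ne (by omega))]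
        exact (hr.of_fr hf).term (hL x hx)
      have hv0 : σ₂.reg (rVar k ℓ 0) = v := by
        rw [hr₂ _ (by simp) (by simp), hvar₁ _ (by omega), r0]
      have hacc₂ : σ₂.reg (rVar k ℓ 4) = Nat.count p v := by
        rw [hr₂ _ (by simp) (by simp), hvar₁ _ (by omega), h3]
      have hsim₃ : ∀ r, σ₃.reg (rSim k r) = if ∃ x ∈ L, r = x.1 ∧ (x.2.val I ρ : ℕ) = v then
          Nat.count p v else σ'.reg (rSim k r) := by
        intro r
        rw [hr₃ _ (by simp) (by simp), hacc₂, hr₂ (rSim k r) (by simp) (by simp), hs₁]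
        refine if_congr (exists_congr fun x => and_congr_right fun hx => ?_) rfl rfl
        rw [hterm x hx, hv0, rSim_inj]
      refine Halts.op le_rfl ⟨⟨⟨?_, ?_, ?_, ?_⟩, ?_, ?_, ?_, ?_, ?_⟩, ?_⟩
      · intro q hq
        rw [exec_add, State.setReg_ne, hr₃']
        · exact hf.reg q hq
        · rintro rfl; exact (free_sys (k := k) (ℓ := ℓ) (i := 5) (by omega) (by omega)).1 hq
        · rintro rfl; exact (free_sys (k := k) (ℓ := ℓ) (i := 6) (by omega) (by omega)).1 hq
        · rintro i rfl; unfold Prot rSim at hq; omega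
        · rintro rfl; exact (free_var (k := k) (ℓ := ℓ) (j := 4) le_rfl (by omega)).1 hq
      · intro h; simp at h
      · intro a ha
        rw [exec_add, State.setReg_mem, hm₃, hm₂, if_neg (by omega)]
        exact hf.mem a ha
      · intro hst a
        rw [exec_add, State.setReg_mem, hm₃, hm₂, if_neg (by omega),
          State.setReg_ne _ _ (by simp), hr₃' _ (by simp) (by simp) (by simp)]
        exact hf.stamp hst a
      · rw [exec_add, State.setReg_ne _ _ (by simp), hr₃' _ (by simp) (by simp) (by simp), hver₁, h2]
      · rw [exec_add, State.setReg_self, hr₃' _ (by simp) (by simp) (by simp),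
          hr₃' _ (by simp) (by simp) (by simp), hvar₁ _ (by omega), h3, (hr.of_fr hf).one, hcnt]
      · intro i hi
        rw [exec_add, State.setReg_mem, hm₃, hm₂]
        by_cases hic : i = Nat.count p v
        · rw [if_pos (by omega), hic, Nat.nth_count hpv]
        · rw [if_neg (by omega), hm₁]
          exact h4 i (by omega)
      · intro x hx hxv
        rw [exec_add, State.setReg_ne _ _ (by simp), hsim₃]
        by_cases hxe : (x.2.val I ρ : ℕ) = v
        · rw [if_pos ⟨x, hx, rfl, hxe⟩, hxe]
        · rw [if_neg]
          · exact h5 x hx (by omega)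
          · rintro ⟨y, hy, hxy, hyv⟩
            rw [hLu x hx y hy hxy] at hxe
            exact hxe hyv
      · intro r hr' hx
        rw [exec_add, State.setReg_ne _ _ (by simp), hsim₃, if_neg]
        · exact h6 r hr' hx
        · rintro ⟨y, hy, rfl, -⟩
          exact hx y hy rfl
      · intro j hj
        rw [exec_add, State.setReg_ne _ _ (rVar_ne_acc hj),
          hr₃' _ (rVar_ne_rSys (by omega)) (rVar_ne_rSys (by omega))
            (fun i => rVar_ne_rSim (by omega)), hvar₁ _ (by omega)]
    · have hpv : ¬ p v := fun h => hv₁.2 h he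
      have hcnt : Nat.count p (v + 1) = Nat.count p v := by
        rw [Nat.count_succ, if_neg hpv]; rfl
      refine Halts.op (by norm_cast; omega) ⟨⟨hf, ?_, ?_, ?_, ?_, ?_⟩,
        fun j hj => hvar₁ j (by omega)⟩
      · exact hver₁.trans h2
      · rw [exec_skip, hvar₁ _ (by omega), h3, hcnt]
      · intro i hi
        rw [exec_skip, hm₁]
        exact h4 i (by omega)
      · intro x hx hxv
        rw [exec_skip, hs₁]
        -- The terminals in the list belong to `U`, so none of them is the vertex that is being
        -- skipped.
        refine h5 x hx (lt_of_le_of_ne (by omega) fun h => hpv ?_)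
        have := (hp (x.2.val I ρ)).2 (hLU x hx)
        rwa [h] at this
      · intro r hr' hx
        rw [exec_skip, hs₁]
        exact h6 r hr' hx
  · exact ⟨Fr.refl _ _ _ _ _, rfl, by simpa using hacc, by simp, by simp,
      fun r hr' _ => hz r hr'⟩
  · rintro σ' ⟨h1, h2, h3, h4, h5, h6⟩
    exact ⟨h1, h2, h3, h4, fun x hx => h5 x hx (x.2.val I ρ).2, h6⟩

end

end RAM

namespace RAM

variable {𝒢 : GraphClass} {k : ℕ}

theorem initialState_reg_zero {n j : ℕ} {G : SimpleGraph (Fin n)} (W : IDPInstance G j) :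
    (initialState W).reg 0 = n := by simp [initialState]

theorem initialState_reg_src {n j : ℕ} {G : SimpleGraph (Fin n)} (W : IDPInstance G j)
    (i : Fin j) : (initialState W).reg (2 * i + 1) = W.s i := by
  have h : (2 * (i : ℕ) + 1 - 1) / 2 = i := by omega
  simp [initialState]

theorem initialState_reg_tgt {n j : ℕ} {G : SimpleGraph (Fin n)} (W : IDPInstance G j)
    (i : Fin j) : (initialState W).reg (2 * i + 2) = W.t i := by
  have h : (2 * (i : ℕ) + 1) / 2 = i := by omega
  simp [initialState, h]

theorem initialState_reg_other {n j : ℕ} {G : SimpleGraph (Fin n)} (W : IDPInstance G j) {r : ℕ}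
    (h0 : r ≠ 0) (h : ∀ i : Fin j, r ≠ 2 * i + 1 ∧ r ≠ 2 * i + 2) :
    (initialState W).reg r = 0 := by
  simp only [initialState]
  rw [if_neg h0, dif_neg]
  intro hlt
  have := h ⟨_, hlt⟩
  simp only at this
  omega

/-- The instance given by the terms on the subgraph induced by `U` is valid and this subgraph
belongs to the class. -/
structure ValidSub {n j : ℕ} (𝒦 : GraphClass) (G : SimpleGraph (Fin n)) (U : Set (Fin n))
    (s t : Fin j → Fin n) : Prop where
  smem : ∀ i, s i ∈ U
  tmem : ∀ i, t i ∈ U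
  distinct : Function.Injective (Sum.elim s t)
  nonadj : ∀ i i', i ≠ i' → ¬ G.Adj (s i) (s i') ∧ ¬ G.Adj (s i) (t i') ∧ ¬ G.Adj (t i) (t i')
  mem : ∀ (m : ℕ) (e : Fin m ↪ Fin n), Set.range e = U → G.comap e ∈ 𝒦 m

-- A call consists of numbering the vertices of the subgraph, initialising the finitely many
-- registers that the program mentions, moving to a new version of the memory, and interpreting.
-- Clearing memory is never necessary, and the call costs only the order of `n ^ d` with `d ≥ c`:
-- `n` membership tests of cost `n ^ (d - 1)` and the interpreted run on at most `n` vertices.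
open Classical in
theorem EvalF.solve {𝒦 : GraphClass} {j ℓ : ℕ} {c d : ℝ}
    (hsolve : IDPSolvableInTime 𝒦 j (fun n => (n : ℝ) ^ c)) (hc : 0 ≤ c) (hcd : c ≤ d)
    {P P' ψ : Pred 𝒢 k} (hψ : EvalF Bool.true (ℓ + 1) P' ψ (d - 1)) {a b : Fin j → Term k}
    (ha : ∀ i, (a i).Below ℓ) (hb : ∀ i, (b i).Below ℓ)
    (hP : ∀ I S ρ v, P I S ρ → P' I S (Function.update ρ ℓ v))
    (hvalid : ∀ I S ρ, P I S ρ → ValidSub 𝒦 I.G {v | ψ I S (Function.update ρ ℓ v)}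
      (fun i => (a i).val I ρ) (fun i => (b i).val I ρ)) :
    EvalF Bool.false ℓ P (fun I S ρ => SolvableOn I.G Set.univ {v | ψ I S (Function.update ρ ℓ v)}
      (fun i => (a i).val I ρ) (fun i => (b i).val I ρ)) d := by
  obtain ⟨h0, pψ, Cψ, hCψ, hψ⟩ := hψ
  obtain ⟨p, C, hp⟩ := hsolve
  obtain ⟨R', hR'⟩ := p.exists_bdd
  -- The answer is read from register `0`, which the program need not mention.
  let R := R' + 1
  have hR : p.Bdd R := hR'.mono (by omega)
  let L := initList a b
  refine ⟨by linarith, .seq (block (.const (rVar k ℓ 4) 0 ::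
    (List.range R).map fun r => Op.const (rSim k r) 0)) (.seq (numberP k ℓ pψ L)
    (.seq (block [.const (rA k) 0, .add (rM k) (rVar k ℓ 4) (rA k),
      .add (rSim k 0) (rVar k ℓ 4) (rA k), .add (rVer k) (rVer k) (rOne k)])
    (.seq (simP k p) (block [.sub (rA k) (rSim k 0) (rOne k), .sub (rB k) (rOne k) (rSim k 0),
      .add (rA k) (rA k) (rB k), .sub (rRes k) (rOne k) (rA k)])))),
    (R + 2) + ((Cψ + 8 * L.length + 21) + (5 + (16 * |C| + 5))), by positivity,
    fun I S ρ σ hr hpre => ?_⟩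
  have hn := I.one_le ρ
  have hn1 : (1 : ℝ) ≤ I.n := by exact_mod_cast hn
  have hX := one_le_rpow_natCast hn h0
  have hXd := one_le_rpow_natCast hn (show 0 ≤ d by linarith)
  have hpow := rpow_eq_mul hn d
  set D := (I.n : ℝ) ^ d
  set X := (I.n : ℝ) ^ (d - 1)
  set U : Set (Fin I.n) := {v | ψ I S (Function.update ρ ℓ v)} with hU
  have hv := hvalid I S ρ hpre
  have hlenL : (0 : ℝ) ≤ L.length := by positivity
  refine Halts.seq (T₁ := R + 2) (T₂ := I.n * ((Cψ * X + (8 * L.length + 9)) + 6) + 6 +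
    (5 + (16 * |C| * D + 5))) (Halts.block _ (by simp; linarith) ?_) ?_
  swap
  · have : (0 : ℝ) ≤ |C| := abs_nonneg C
    have hRR : (0 : ℝ) ≤ R := by positivity
    have e1 : (R + 2 : ℝ) ≤ (R + 2) * D := le_mul_of_one_le_right (by positivity) hXd
    have e2 : (I.n : ℝ) * ((Cψ * X + (8 * L.length + 9)) + 6) + 6 ≤
        (Cψ + 8 * L.length + 21) * D := by
      rw [hpow]
      have h1 : (I.n : ℝ) ≤ I.n * X := le_mul_of_one_le_right (by positivity) hX
      have h2 : (8 * L.length + 15 : ℝ) * I.n ≤ (8 * L.length + 15) * (I.n * X) := by gcongr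
      nlinarith
    nlinarith
  rw [List.foldl_cons, exec_const]
  obtain ⟨hm₁, hz₁, hs₁⟩ := foldl_zero (k := k) I.G R (σ.setReg (rVar k ℓ 4) 0)
  set σ₁ := List.foldl (fun σ o => Op.exec I.G σ o) (σ.setReg (rVar k ℓ 4) 0)
    (List.map (fun r => Op.const (rSim k r) 0) (List.range R))
  have hnsim : ∀ q, Prot k ℓ q → ∀ i, q ≠ rSim k i := fun q hq i h => by
    subst h; unfold Prot rSim at hq; omega
  have hf₁ : Fr Bool.false k I.n ℓ σ σ₁ := by
    refine ⟨fun q hq => ?_, fun h => by simp at h, fun x _ => by rw [hm₁]; rfl, fun hst x => ?_⟩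
    · rw [hs₁ q (hnsim q hq), State.setReg_ne]
      rintro rfl
      exact (free_var (k := k) (ℓ := ℓ) (j := 4) le_rfl (by omega)).1 hq
    · rw [hm₁, hs₁ _ (by simp), State.setReg_ne _ _ (by simp)]; exact hst x
  -- Membership in `U` is extended to all natural numbers, as `Nat.count` and `Nat.nth` require.
  obtain ⟨q, hq⟩ : ∃ q : ℕ → Prop, ∀ v : Fin I.n, q v ↔ v ∈ U :=
    ⟨fun x => ∃ hx : x < I.n, (⟨x, hx⟩ : Fin I.n) ∈ U, fun v => by simp⟩
  have hLU : ∀ x ∈ L, x.2.Below ℓ ∧ x.2.val I ρ ∈ U := by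
    intro x hx
    obtain ⟨i, rfl | rfl⟩ := mem_initList.1 hx
    · exact ⟨ha i, hv.smem i⟩
    · exact ⟨hb i, hv.tmem i⟩
  refine Halts.seq (T₁ := I.n * ((Cψ * X + (8 * L.length + 9)) + 6) + 6)
    (T₂ := 5 + (16 * |C| * D + 5)) ((Halts.number (R := R) U (hr.of_fr hf₁)
      (fun v σ' h => hψ I S _ σ' h (hP I S ρ v hpre)) (fun x hx => (hLU x hx).1)
      (fun x hx y hy => initList_unique hx hy) (fun x hx => (hLU x hx).2) ?_ hz₁ q hq).mono
      le_rfl ?_) le_rfl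
  · rw [hs₁ _ (by simp)]; simp
  rintro σ₂ ⟨hf₂, hver₂, hacc₂, htab₂, hterm₂, hzero₂⟩
  set m := Nat.count q I.n with hm
  have hfin : ∀ i < m, q (Nat.nth q i) ∧ Nat.nth q i < I.n := by
    intro i hi
    have h1 := Nat.nth_lt_of_lt_count hi
    have h2 : q (Nat.nth q i) := by
      refine Nat.nth_mem _ fun hf => ?_
      refine hi.trans_le ?_
      rw [hm, Nat.count_eq_card_filter_range]
      refine Finset.card_le_card fun x hx => ?_
      simpa using (Finset.mem_filter.1 hx).2
    exact ⟨h2, h1⟩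
  have hinj : ∀ i i', i < m → i' < m → Nat.nth q i = Nat.nth q i' → i = i' := by
    intro i i' hi hi' h
    have hc : ∀ i < m, Nat.count q (Nat.nth q i) = i := fun i hi =>
      Nat.count_nth fun hf => hi.trans_le (by
        rw [hm, Nat.count_eq_card_filter_range]
        refine Finset.card_le_card fun x hx => ?_
        simpa using (Finset.mem_filter.1 hx).2)
    rw [← hc i hi, ← hc i' hi', h]
  let e : Fin m ↪ Fin I.n := ⟨fun i => ⟨Nat.nth q i, (hfin i i.2).2⟩, fun i i' h =>
    Fin.ext (hinj i i' i.2 i'.2 (by simpa using congrArg Fin.val h))⟩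
  have hcount : ∀ v ∈ U, ∃ h : Nat.count q v < m, e ⟨_, h⟩ = v := by
    intro v hvU
    have hqv := (hq v).2 hvU
    have hlt : Nat.count q v < m := Nat.count_strict_mono hqv v.2
    exact ⟨hlt, Fin.ext (Nat.nth_count hqv)⟩
  have hrange : Set.range e = U := by
    ext v
    constructor
    · rintro ⟨i, rfl⟩
      exact (hq _).1 (hfin i i.2).1
    · intro hvU
      obtain ⟨h, h'⟩ := hcount v hvU
      exact ⟨_, h'⟩
  choose cs hcs using fun i => hcount _ (hv.smem i)
  choose ct hct using fun i => hcount _ (hv.tmem i)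
  let W : IDPInstance (I.G.comap e) j :=
    { s := fun i => ⟨_, cs i⟩
      t := fun i => ⟨_, ct i⟩
      distinct := by
        intro x y hxy
        apply hv.distinct
        rcases x with i | i <;> rcases y with i' | i' <;>
          simp only [Sum.elim_inl, Sum.elim_inr] at hxy ⊢ <;>
          simpa [hcs, hct] using congrArg e hxy
      nonadj := fun i i' hii => by
        simp only [SimpleGraph.comap_adj, hcs, hct]
        exact hv.nonadj i i' hii }
  obtain ⟨τ, σf, hrun, hτ, hans⟩ := hp m (I.G.comap e) (hv.mem m e hrange) W
  refine Halts.seq (T₁ := 5) (T₂ := 16 * |C| * D + 5) (Halts.block _ (by norm_num) ?_) le_rfl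
  simp only [List.foldl, exec_add, exec_const]
  set σ₃ := State.setReg _ (rVer k) _ with hσ₃
  have hr₂ := (hr.of_fr hf₁).of_fr hf₂
  have hreg₃ : ∀ x, x ≠ rA k → x ≠ rM k → x ≠ rSim k 0 → x ≠ rVer k → σ₃.reg x = σ₂.reg x := by
    intro x h1 h2 h3 h4
    simp [hσ₃, State.setReg_reg, h1, h2, h3, h4]
  have hmem₃ : σ₃.mem = σ₂.mem := rfl
  have hver₃ : σ₃.reg (rVer k) = σ₂.reg (rVer k) + 1 := by
    simp [hσ₃, State.setReg_reg, hr₂.one]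
  have hrel : SimRel k R e (initialState W) σ₃ := by
    refine ⟨fun r hr => ?_, fun x => ?_, fun i => ?_, ?_, ?_⟩
    · by_cases hr0 : r = 0
      · subst hr0
        rw [initialState_reg_zero]
        simp [hσ₃, State.setReg_reg, hacc₂]
      · rw [hreg₃ _ (by simp) (by simp) (by simpa using hr0) (by simp)]
        by_cases hex : ∃ x ∈ L, x.1 = r
        · obtain ⟨x, hx, rfl⟩ := hex
          rw [hterm₂ x hx]
          obtain ⟨i, rfl | rfl⟩ := mem_initList.1 hx
          · exact (initialState_reg_src W i).symm
          · exact (initialState_reg_tgt W i).symm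
        · push Not at hex
          rw [hzero₂ r hr hex, initialState_reg_other W hr0]
          exact fun i => ⟨fun h => hex _ (mem_initList.2 ⟨i, Or.inl rfl⟩) h.symm,
            fun h => hex _ (mem_initList.2 ⟨i, Or.inr rfl⟩) h.symm⟩
    -- All stamps are at most the old version, hence different from the new one: the simulated
    -- memory is all zero, as in an initial state.
    · have := hr₂.stamp x
      rw [hmem₃, hver₃, if_neg (by omega)]
      rfl
    · rw [hmem₃]; exact htab₂ i i.2
    · simp [hσ₃, State.setReg_reg, hacc₂]
    · rw [hreg₃ _ (by simp) (by simp) (by simp) (by simp)]; exact hr₂.one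
  have hsim := hrun.simulate (e := e) (G := I.G) (fun _ _ => Iff.rfl) hR hrel
  refine Halts.seq (T₁ := 16 * |C| * D) (T₂ := 5) (hsim.mono ?_ ?_) le_rfl
  · have hm' : (m : ℝ) ≤ I.n := by
      have : m ≤ I.n := Nat.count_le q
      exact_mod_cast this
    have h1 : (m : ℝ) ^ c ≤ D :=
      (Real.rpow_le_rpow (by positivity) hm' hc).trans
        (Real.rpow_le_rpow_of_exponent_le hn1 hcd)
    -- The constant of the given time bound may be negative, hence the absolute value.
    have h2 : C * (m : ℝ) ^ c ≤ |C| * D :=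
      (mul_le_mul_of_nonneg_right (le_abs_self C) (by positivity)).trans
        (mul_le_mul_of_nonneg_left h1 (abs_nonneg C))
    linarith
  rintro σ₄ ⟨hrel₄, hfr₄⟩
  refine Halts.block _ (by norm_num) ?_
  simp only [List.foldl, exec_add, exec_sub]
  have hf₄ : Fr Bool.false k I.n ℓ σ σ₄ := by
    refine ⟨fun x hx => ?_, fun h => by simp at h, fun x hx => ?_, fun hst x => ?_⟩
    · have hns := hnsim x hx
      have hsys : ∀ i, 3 ≤ i → i < 11 → x ≠ rSys k i := by
        rintro i h1 h2 rfl
        unfold Prot rSys at hx; omega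
      rw [hfr₄.reg x hns (hsys _ (by omega) (by omega)) (hsys _ (by omega) (by omega))
        (hsys _ (by omega) (by omega)), hreg₃ x (hsys _ (by omega) (by omega))
        (hsys _ (by omega) (by omega)) (hns 0) (hsys _ (by omega) (by omega))]
      exact (hf₁.trans hf₂).reg x hx
    · rw [hfr₄.mem, hmem₃]; exact (hf₁.trans hf₂).mem x hx
    · rw [hfr₄.ver]
      rcases hfr₄.stamp x with h | h
      · have := (hf₁.trans hf₂).stamp hst x
        rw [h, hmem₃, hver₃]; omega
      · rw [h]
  refine ⟨(((hf₄.setReg (free_sys (by omega) (by omega)) _).setReg (free_sys (by omega) (by omega))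
    _).setReg (free_sys (by omega) (by omega)) _).setReg (free_sys (by omega) (by omega)) _, ?_⟩
  have hsol : σf.reg 0 = 1 ↔ SolvableOn I.G Set.univ U (fun i => (a i).val I ρ)
      (fun i => (b i).val I ρ) := by
    rw [hans, W.hasSolution_iff, SolvableOn.comap (G := I.G) e (fun _ _ => Iff.rfl), hrange]
    have h1 : e ∘ W.s = fun i => (a i).val I ρ := funext hcs
    have h2 : e ∘ W.t = fun i => (b i).val I ρ := funext hct
    rw [h1, h2]
  rw [← hsol]
  have hreg0 := hrel₄.reg 0 (by omega)
  simp [State.setReg_reg, hreg0, hrel₄.one]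
  omega

end RAM

/-! ## Clique separators -/

section
variable {V : Type*} {G : SimpleGraph V}

/-- No two vertices of `H` are separated by a clique in the subgraph induced by `W`. -/
structure Unseparated (G : SimpleGraph V) (W H : Set V) : Prop where
  subset : H ⊆ W
  conn : ∀ K, G.IsClique K → ∀ x ∈ H, ∀ y ∈ H, x ∉ K → y ∉ K → Conn G (W \ K) x y

/-- The vertices outside of the closed neighbourhood of `u`. -/
def far (G : SimpleGraph V) (u : V) : Set V := {v | v ≠ u ∧ ¬ G.Adj u v}

/-- There is a path from `x` to `y` that has an interior vertex and all interior vertices in `U`. -/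
def Link (G : SimpleGraph V) (U : Set V) (x y : V) : Prop :=
  ∃ a b, G.Adj x a ∧ Conn G U a b ∧ G.Adj b y

theorem Link.conn {U U' : Set V} {x y : V} (h : Link G U x y) (hU : U ⊆ U') (hx : x ∈ U')
    (hy : y ∈ U') : Conn G U' x y := by
  obtain ⟨a, b, hxa, hab, hby⟩ := h
  have hab := hab.mono hU
  exact ((Conn.of_adj hx hxa hab.1).trans hab).tail hby hy

/-- A clique through `u` is contained in the closed neighbourhood of `u`, so it cannot block
anything that happens far from `u`. -/
theorem far_diff_clique {K W : Set V} (hK : G.IsClique K) {u : V} (hu : u ∈ K) :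
    W ∩ far G u ⊆ W \ K := fun _ hv => ⟨hv.1, fun hvK => hv.2.2 (hK hu hvK hv.2.1.symm)⟩

/-- Two nonadjacent neighbours of `u` are adjacent to the same component outside of the closed
neighbourhood of `u`. -/
structure Seed (G : SimpleGraph V) (W : Set V) (u x y : V) : Prop where
  mem : u ∈ W
  left : x ∈ W ∧ G.Adj u x
  right : y ∈ W ∧ G.Adj u y
  ne : x ≠ y
  nonadj : ¬ G.Adj x y
  link : Link G (W ∩ far G u) x y

/-- A clique through `u` misses the link, by `far_diff_clique`; a clique that avoids `u` misses the
path `x`, `u`, `y`. -/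
theorem Seed.unseparated {W : Set V} {u x y : V} (h : Seed G W u x y) :
    Unseparated G W {x, y} := by
  have key : ∀ K, G.IsClique K → x ∉ K → y ∉ K → Conn G (W \ K) x y := by
    intro K hK hx hy
    have hx' : x ∈ W \ K := ⟨h.left.1, hx⟩
    have hy' : y ∈ W \ K := ⟨h.right.1, hy⟩
    by_cases hu : u ∈ K
    · exact h.link.conn (far_diff_clique hK hu) hx' hy'
    · exact (Conn.of_adj hx' h.left.2.symm ⟨h.mem, hu⟩).tail h.right.2 hy'
  refine ⟨by rintro v (rfl | rfl); exacts [h.left.1, h.right.1], ?_⟩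
  rintro K hK p (rfl | rfl) q (rfl | rfl) hp hq
  · exact .refl ⟨h.left.1, hp⟩
  · exact key K hK hp hq
  · exact (key K hK hq hp).symm
  · exact .refl ⟨h.right.1, hp⟩

/-- The vertex `d` cannot be separated from `{x, y}` by a clique. -/
def Attached (G : SimpleGraph V) (W H : Set V) (d : V) : Prop :=
  ∃ x ∈ H, ∃ y ∈ H, x ≠ y ∧ ¬ G.Adj x y ∧ G.Adj d x ∧ (G.Adj d y ∨ Link G (W ∩ far G x) d y)

/-- Let `d` be attached by means of `x` and `y`. A clique avoiding `x` leaves the edge from `d` to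
`x`. A clique through `x` avoids `y` and everything far from `x`, and so leaves the connection from
`d` to `y`. -/
theorem Unseparated.insert_attached {W H D : Set V} (h : Unseparated G W H)
    (hD : ∀ d ∈ D, d ∈ W ∧ Attached G W H d) : Unseparated G W (H ∪ D) := by
  have key : ∀ K, G.IsClique K → ∀ d ∈ H ∪ D, d ∉ K → ∃ e ∈ H, e ∉ K ∧ Conn G (W \ K) d e := by
    rintro K hK d (hd | hd) hdK
    · exact ⟨d, hd, hdK, .refl ⟨h.subset hd, hdK⟩⟩
    obtain ⟨hdW, x, hx, y, hy, hne, hna, hdx, hor⟩ := hD d hd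
    have hd' : d ∈ W \ K := ⟨hdW, hdK⟩
    by_cases hxK : x ∈ K
    · have hyK : y ∉ K := fun hyK => hna (hK hxK hyK hne)
      have hy' : y ∈ W \ K := ⟨h.subset hy, hyK⟩
      refine ⟨y, hy, hyK, ?_⟩
      rcases hor with ha | hl
      · exact .of_adj hd' ha hy'
      · exact hl.conn (far_diff_clique hK hxK) hd' hy'
    · exact ⟨x, hx, hxK, .of_adj hd' hdx ⟨h.subset hx, hxK⟩⟩
  refine ⟨Set.union_subset h.subset fun d hd => (hD d hd).1, fun K hK x hx y hy hxK hyK => ?_⟩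
  obtain ⟨a, ha, haK, hxa⟩ := key K hK x hx hxK
  obtain ⟨b, hb, hbK, hyb⟩ := key K hK y hy hyK
  exact (hxa.trans (h.conn K hK a ha b hb haK hbK)).trans hyb.symm

theorem Unseparated.of_complete {W : Set V} (h : ∀ u ∈ W, ∀ v ∈ W, v ≠ u → G.Adj u v) :
    Unseparated G W W := by
  refine ⟨subset_rfl, fun K _ x hx y hy hxK hyK => ?_⟩
  by_cases hxy : y = x
  · subst hxy; exact .refl ⟨hx, hxK⟩
  · exact .of_adj ⟨hx, hxK⟩ (h x hx y hy hxy) ⟨hy, hyK⟩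

theorem Unseparated.not_hasCliqueCutset {n : ℕ} {V' : Type*} {e : V' ↪ Fin n}
    {G : SimpleGraph (Fin n)} (h : Unseparated G (Set.range e) (Set.range e)) :
    ¬ HasCliqueCutset (G.comap e) := by
  rintro ⟨K, hK, hd⟩
  apply hd
  rintro ⟨x, hx⟩ ⟨y, hy⟩
  have hK' : G.IsClique (e '' K) := by
    rintro _ ⟨a, ha, rfl⟩ _ ⟨b, hb, rfl⟩ hab
    exact hK ha hb fun h => hab (by rw [h])
  have hc := h.conn _ hK' (e x) ⟨x, rfl⟩ (e y) ⟨y, rfl⟩ (by simpa using hx) (by simpa using hy)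
  have hc := hc.comap (H := G.comap e) (fun _ _ h => h) Set.sdiff_subset
  have hsub : e ⁻¹' (Set.range e \ e '' K) ⊆ Kᶜ := fun v hv hvK => hv.2 ⟨v, hvK, rfl⟩
  have : ∃ h : y ∈ Kᶜ, ((G.comap e).induce Kᶜ).Reachable ⟨x, hx⟩ ⟨y, h⟩ := by
    refine (hc.mono hsub).ind (p := fun y => ∃ h : y ∈ Kᶜ,
      ((G.comap e).induce Kᶜ).Reachable ⟨x, hx⟩ ⟨y, h⟩) ⟨hx, .refl _⟩ ?_
    rintro a b - hab hb ⟨ha, hr⟩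
    exact ⟨hb, hr.trans (SimpleGraph.Adj.reachable (by simpa using hab))⟩
  exact this.2

/-- `K` is a clique that separates, in the subgraph induced by `W`, the connected set `A`
containing `v` from a further vertex. -/
structure Cut (G : SimpleGraph V) (W : Set V) (v : V) (A K : Set V) : Prop where
  memA : v ∈ A
  subA : A ⊆ W
  subK : K ⊆ W
  disj : Disjoint A K
  conn : ∀ a ∈ A, Conn G A v a
  clique : G.IsClique K
  nbr : ∀ a ∈ A, ∀ b ∈ W, G.Adj a b → b ∈ A ∨ b ∈ K
  rest : ∃ b ∈ W, b ∉ A ∧ b ∉ K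

/-- The neighbours in `W` of the set `A`. -/
def boundary (G : SimpleGraph V) (W A : Set V) : Set V := {w ∈ W | w ∉ A ∧ ∃ a ∈ A, G.Adj a w}

/-- The component of `v` in the subgraph induced by `U`. -/
def comp (G : SimpleGraph V) (U : Set V) (v : V) : Set V := {w | Conn G U v w}

theorem boundary_subset {W H : Set V} {v : V} : boundary G W (comp G (W \ H) v) ⊆ H := by
  rintro x ⟨hxW, hxA, a, ha, hax⟩
  by_contra hxH
  exact hxA (Conn.tail ha hax ⟨hxW, hxH⟩)

/-- A component of `W \ H` and its boundary satisfy all requirements of a cut by construction,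
except that the boundary must be a clique and that something must remain on the other side. -/
theorem Cut.of_clique {W H : Set V} {v : V} (hH : H ⊆ W) (hv : v ∈ W \ H)
    (hK : G.IsClique (boundary G W (comp G (W \ H) v)))
    (hr : ∃ h ∈ H, h ∉ boundary G W (comp G (W \ H) v)) :
    Cut G W v (comp G (W \ H) v) (boundary G W (comp G (W \ H) v)) where
  memA := .refl hv
  subA _ ha := (Conn.mem_right ha).1
  subK _ hx := hx.1
  disj := Set.disjoint_left.2 fun _ ha hx => hx.2.1 ha
  conn a ha := by
    refine (Conn.mem_of_closed ha (A := comp G (W \ H) v) (.refl hv) ?_).mono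
      Set.inter_subset_right
    exact fun a ha b hb hab => Conn.tail ha hab hb
  clique := hK
  nbr a ha b hb hab := by
    by_cases hbA : b ∈ comp G (W \ H) v
    · exact .inl hbA
    · exact .inr ⟨hb, hbA, a, ha, hab⟩
  rest := by
    obtain ⟨h, hh, hhK⟩ := hr
    exact ⟨h, hH hh, fun hA => (Conn.mem_right hA).2 hh, hhK⟩

/-- Suppose that the boundary of a component of `W \ H` has nonadjacent vertices `x`, `y`, and walk
inside the component from a neighbour of `y` to a neighbour of `x`. The first vertex on the way that
is adjacent to `x` would be attached to `H`, as it reaches `y` directly or through vertices far from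
`x`. Then it would belong to `H`, which is absurd. So the boundary is a clique, and it misses part
of `H` because `H` is not a clique. -/
theorem Cut.of_closed {W H : Set V} {v : V} (hH : H ⊆ W) (hv : v ∈ W \ H)
    (hcl : ∀ d ∈ W, Attached G W H d → d ∈ H)
    (hne : ∃ x ∈ H, ∃ y ∈ H, x ≠ y ∧ ¬ G.Adj x y) :
    Cut G W v (comp G (W \ H) v) (boundary G W (comp G (W \ H) v)) := by
  have hK : G.IsClique (boundary G W (comp G (W \ H) v)) := by
    intro x hx y hy hxy
    by_contra hna
    have hxH := boundary_subset hx
    have hyH := boundary_subset hy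
    obtain ⟨hxW, hxA, a, ha, hax⟩ := hx
    obtain ⟨hyW, hyA, b, hb, hby⟩ := hy
    have hab : Conn G (W \ H) b a := (Conn.symm hb).trans ha
    have hdne : ∀ d ∈ W \ H, d ≠ x := fun d hd h => hd.2 (h ▸ hxH)
    -- This is the claim that is propagated along the walk: no vertex visited is adjacent to `x`, so
    -- the walk back to `b` stays far from `x`. At `a` it contradicts the adjacency of `a` and `x`.
    have : ¬ G.Adj x a ∧ Conn G (W ∩ far G x) a b := by
      have hno : ∀ d ∈ W \ H, G.Adj x d → ¬ G.Adj d y ∧ ¬ Link G (W ∩ far G x) d y :=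
        fun d hd hxd => not_or.1 fun hor =>
          hd.2 (hcl d hd.1 ⟨x, hxH, y, hyH, hxy, hna, hxd.symm, hor⟩)
      refine hab.ind (p := fun v => ¬ G.Adj x v ∧ Conn G (W ∩ far G x) v b) ?_ ?_
      · have h1 : ¬ G.Adj x b := fun h => (hno b hab.1 h).1 hby
        exact ⟨h1, .refl ⟨hab.1.1, hdne b hab.1, h1⟩⟩
      · rintro v w hv hvw hw ⟨-, ih⟩
        have h1 : ¬ G.Adj x w := fun h => (hno w hw h).2 ⟨v, b, hvw.symm, ih, hby⟩
        exact ⟨h1, (Conn.of_adj (U := W ∩ far G x) ⟨hw.1, hdne w hw, h1⟩ hvw.symm ih.1).trans ih⟩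
    exact this.1 hax.symm
  refine Cut.of_clique hH hv hK ?_
  by_contra! hall
  obtain ⟨x, hx, y, hy, hxy, hna⟩ := hne
  exact hna (hK (hall x hx) (hall y hy) hxy)

/-- The role of the hub is played by the closed neighbourhood of `u` in `W`. Two nonadjacent
boundary vertices of a component of `W ∩ far G u` would form a seed with `u`; and `u` itself is not
in the boundary, so it remains on the other side. -/
theorem Cut.of_nbhd {W : Set V} {u v : V} (hu : u ∈ W) (hv : v ∈ W ∩ far G u)
    (hno : ∀ x y, ¬ Seed G W u x y) :
    Cut G W v (comp G (W \ (W \ far G u)) v) (boundary G W (comp G (W \ (W \ far G u)) v)) := by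
  have hW : W \ (W \ far G u) = W ∩ far G u := by
    ext x; simp only [Set.mem_sdiff, Set.mem_inter_iff]; tauto
  have huK : u ∉ boundary G W (comp G (W \ (W \ far G u)) v) := by
    rintro ⟨-, -, a, ha, hau⟩
    rw [hW] at ha
    exact (Conn.mem_right ha).2.2 hau.symm
  refine Cut.of_clique Set.sdiff_subset (by rwa [hW]) ?_ ⟨u, ⟨hu, fun h => h.1 rfl⟩, huK⟩
  intro x hx y hy hxy
  by_contra hna
  have adj : ∀ z ∈ boundary G W (comp G (W \ (W \ far G u)) v), G.Adj u z := by
    intro z hz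
    by_contra h
    exact (boundary_subset hz).2 ⟨fun h => huK (h ▸ hz), h⟩
  have hux := adj x hx
  have huy := adj y hy
  obtain ⟨hxW, hxA, a, ha, hax⟩ := hx
  obtain ⟨hyW, hyA, b, hb, hby⟩ := hy
  rw [hW] at ha hb
  exact hno x y ⟨hu, ⟨hxW, hux⟩, ⟨hyW, huy⟩, hxy, hna, a, b, hax.symm, (Conn.symm ha).trans hb, hby⟩

/-! ## Reducing the vertex set -/

/-- The components outside of `W` contain at most one vertex of `T` each, and the neighbours of each
form a clique. -/
structure Reduced (G : SimpleGraph V) (T W : Set V) : Prop where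
  clique : ∀ u p q z z', p ∈ W → q ∈ W → Conn G Wᶜ u z → Conn G Wᶜ u z' → G.Adj z p → G.Adj z' q →
    p ≠ q → G.Adj p q
  term : ∀ s ∈ T, ∀ t ∈ T, Conn G Wᶜ s t → s = t

theorem Reduced.univ (T : Set V) : Reduced G T Set.univ :=
  ⟨fun _ _ _ _ _ _ _ h => absurd (Set.mem_univ _) h.1,
    fun _ _ _ _ h => absurd (Set.mem_univ _) h.1⟩

/-- An excursion of a path outside of `W` stays in one component of the complement, whose neighbours
in `W` form a clique. It can therefore be replaced by one edge, or by nothing if it returns to the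
same vertex. -/
theorem Reduced.project {T W U : Set V} (h : Reduced G T W) {a x : V} (hc : Conn G U a x)
    (ha : a ∈ W) (hx : x ∈ W) : Conn G (U ∩ W) a x := by
  -- For vertices outside of `W` the induction remembers `p`, the vertex of `W` at which the current
  -- excursion started, and a neighbour `z` of `p` in the component being visited.
  have : (x ∈ W → Conn G (U ∩ W) a x) ∧ (x ∉ W → ∃ p ∈ W, Conn G (U ∩ W) a p ∧
      ∃ z, Conn G Wᶜ x z ∧ G.Adj z p) := by
    refine hc.ind (p := fun x => (x ∈ W → Conn G (U ∩ W) a x) ∧ (x ∉ W → ∃ p ∈ W,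
      Conn G (U ∩ W) a p ∧ ∃ z, Conn G Wᶜ x z ∧ G.Adj z p)) ⟨fun _ => .refl ⟨hc.1, ha⟩,
      fun h => absurd ha h⟩ ?_
    rintro v w - hvw hw ⟨ih₁, ih₂⟩
    by_cases hv : v ∈ W
    · exact ⟨fun hwW => (ih₁ hv).tail hvw ⟨hw, hwW⟩, fun hwW => ⟨v, hv, ih₁ hv, w, .refl hwW,
        hvw.symm⟩⟩
    · obtain ⟨p, hp, hap, z, hvz, hzp⟩ := ih₂ hv
      refine ⟨fun hwW => ?_, fun hwW => ⟨p, hp, hap, z, (Conn.of_adj hwW hvw.symm hv).trans hvz,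
        hzp⟩⟩
      by_cases hpw : p = w
      · exact hpw ▸ hap
      · exact hap.tail (h.clique v p w z v hp hwW hvz (.refl hv) hzp hvw hpw) ⟨hw, hwW⟩
  exact this.1 hx

section
variable {T W A K : Set V} {v : V}

theorem Cut.subset_comp (h : Cut G W v A K) : A ⊆ comp G Kᶜ v := fun a ha =>
  (h.conn a ha).mono fun _ hx hxK => Set.disjoint_left.1 h.disj hx hxK

/-- A path that avoids `K` can be projected into `W` without gaining vertices, so it still avoids
`K` and cannot leave `A`. Hence cutting `G[W]` along `K` cuts `G` in a compatible way. -/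
theorem Cut.comp_inter (h : Cut G W v A K) (hW : Reduced G T W) {x : V} (hx : x ∈ comp G Kᶜ v)
    (hxW : x ∈ W) : x ∈ A := by
  have := hW.project hx (h.subA h.memA) hxW
  refine (this.mem_of_closed h.memA ?_).mem_right.2
  exact fun a ha b hb hab => (h.nbr a ha b hb.2 hab).resolve_right hb.1

theorem comp_nbr {U : Set V} {x y : V} (hx : x ∈ comp G U v) (hxy : G.Adj x y) (hy : y ∈ U) :
    y ∈ comp G U v := Conn.tail hx hxy hy

theorem comp_conn {U R : Set V} {x y : V} (hx : x ∈ comp G U v) (hxy : Conn G R x y) (hR : R ⊆ U) :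
    y ∈ comp G U v := Conn.trans hx (hxy.mono hR)

theorem comp_conn' {U R : Set V} {x y : V} (hx : x ∉ comp G U v) (hxy : Conn G R x y)
    (hR : R ⊆ U) : y ∉ comp G U v := fun hy => hx (Conn.trans hy (hxy.symm.mono hR))

/-- A component of the enlarged complement that lies on the side of `A` sees only vertices of the
clique `K` in what remains of `W`, and `hT` bounds its terminals. Any other one does not meet `A`,
so it was already a component outside of `W`. -/
theorem Cut.reduced_diff (h : Cut G W v A K) (hW : Reduced G T W)
    (hT : ∀ s ∈ T, ∀ t ∈ T, s ∈ comp G Kᶜ v → t ∈ comp G Kᶜ v → s = t) : Reduced G T (W \ A) := by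
  have hR : (W \ A)ᶜ ⊆ Kᶜ := fun x hx hxK => hx ⟨h.subK hxK, fun hA =>
    Set.disjoint_left.1 h.disj hA hxK⟩
  have hout : ∀ u z, u ∉ comp G Kᶜ v → Conn G (W \ A)ᶜ u z → Conn G Wᶜ u z := by
    intro u z hu huz
    have hmem : ∀ x, Conn G (W \ A)ᶜ u x → x ∈ Wᶜ := fun x hx hxW =>
      comp_conn' hu hx hR (h.subset_comp (by
        by_contra hxA
        exact hx.mem_right ⟨hxW, hxA⟩))
    exact huz.ind (.refl (hmem u (.refl huz.1))) fun a b hua hab hb ih =>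
      ih.tail hab (hmem b (hua.tail hab hb))
  refine ⟨fun u p q z z' hp hq huz huz' hzp hzq hpq => ?_, fun s hs t ht hst => ?_⟩
  · by_cases hu : u ∈ comp G Kᶜ v
    · have hK : ∀ z p, p ∈ W \ A → Conn G (W \ A)ᶜ u z → G.Adj z p → p ∈ K := by
        intro z p hp huz hzp
        by_contra hpK
        exact hp.2 (h.comp_inter hW (comp_nbr (comp_conn hu huz hR) hzp hpK) hp.1)
      exact h.clique (hK z p hp huz hzp) (hK z' q hq huz' hzq) hpq
    · exact hW.clique u p q z z' hp.1 hq.1 (hout u z hu huz) (hout u z' hu huz') hzp hzq hpq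
  · by_cases hs' : s ∈ comp G Kᶜ v
    · exact hT s hs t ht hs' (comp_conn hs' hst hR)
    · exact hW.term s hs t ht (hout s t hs' hst)

/-- The mirror image of `Cut.reduced_diff`: here the side of `A` is unaffected, and components on
the other side see only `K`. -/
theorem Cut.reduced_union (h : Cut G W v A K) (hW : Reduced G T W)
    (hT : ∀ s ∈ T, ∀ t ∈ T, s ∉ comp G Kᶜ v → s ∉ K → t ∉ comp G Kᶜ v → t ∉ K → s = t) :
    Reduced G T (A ∪ K) := by
  have hR : (A ∪ K)ᶜ ⊆ Kᶜ := fun x hx hxK => hx (.inr hxK)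
  have hin : ∀ u z, u ∈ comp G Kᶜ v → Conn G (A ∪ K)ᶜ u z → Conn G Wᶜ u z := by
    intro u z hu huz
    have hmem : ∀ x, Conn G (A ∪ K)ᶜ u x → x ∈ Wᶜ := fun x hx hxW =>
      hx.mem_right (.inl (h.comp_inter hW (comp_conn hu hx hR) hxW))
    exact huz.ind (.refl (hmem u (.refl huz.1))) fun a b hua hab hb ih =>
      ih.tail hab (hmem b (hua.tail hab hb))
  have hsub : A ∪ K ⊆ W := Set.union_subset h.subA h.subK
  refine ⟨fun u p q z z' hp hq huz huz' hzp hzq hpq => ?_, fun s hs t ht hst => ?_⟩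
  · by_cases hu : u ∈ comp G Kᶜ v
    · exact hW.clique u p q z z' (hsub hp) (hsub hq) (hin u z hu huz) (hin u z' hu huz')
        hzp hzq hpq
    · have hK : ∀ z p, p ∈ A ∪ K → Conn G (A ∪ K)ᶜ u z → G.Adj z p → p ∈ K := by
        intro z p hp huz hzp
        refine hp.resolve_left fun hpA => comp_conn' hu huz hR ?_
        exact comp_nbr (h.subset_comp hpA) hzp.symm (hR huz.mem_right)
      exact h.clique (hK z p hp huz hzp) (hK z' q hq huz' hzq) hpq
  · by_cases hs' : s ∈ comp G Kᶜ v
    · exact hW.term s hs t ht (hin s t hs' hst)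
    · exact hT s hs t ht hs' (hR hst.1) (comp_conn' hs' hst hR) (hR hst.mem_right)

end

end

/-! ## Splitting solutions along a clique separator -/

section
variable {V : Type*} {G : SimpleGraph V}

/-- The clique `K` separates `A` from `B`. -/
structure Separation (G : SimpleGraph V) (A K B : Set V) : Prop where
  cover : ∀ v, v ∈ A ∨ v ∈ K ∨ v ∈ B
  disjAK : Disjoint A K
  disjAB : Disjoint A B
  disjBK : Disjoint B K
  clique : G.IsClique K
  nonadj : ∀ a ∈ A, ∀ b ∈ B, ¬ G.Adj a b

theorem Separation.symm {A K B : Set V} (h : Separation G A K B) : Separation G B K A where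
  cover v := by rcases h.cover v with h | h | h <;> simp [h]
  disjAK := h.disjBK
  disjAB := h.disjAB.symm
  disjBK := h.disjAK
  clique := h.clique
  nonadj a ha b hb hab := h.nonadj b hb a ha hab.symm

/-- Two sets of vertices are disjoint and there is no edge between them. -/
def Anti (G : SimpleGraph V) (X Y : Set V) : Prop := ∀ u ∈ X, ∀ v ∈ Y, u ≠ v ∧ ¬ G.Adj u v

theorem Anti.symm {X Y : Set V} (h : Anti G X Y) : Anti G Y X :=
  fun u hu v hv => ⟨(h v hv u hu).1.symm, fun ha => (h v hv u hu).2 ha.symm⟩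

theorem Anti.mono {X Y X' Y' : Set V} (h : Anti G X Y) (hX : X' ⊆ X) (hY : Y' ⊆ Y) :
    Anti G X' Y' := fun u hu v hv => h u (hX hu) v (hY hv)

theorem Anti.union_left {X X' Y : Set V} (h : Anti G X Y) (h' : Anti G X' Y) :
    Anti G (X ∪ X') Y := fun u hu v hv => hu.elim (h u · v hv) (h' u · v hv)

theorem Anti.union_right {X Y Y' : Set V} (h : Anti G X Y) (h' : Anti G X Y') :
    Anti G X (Y ∪ Y') := fun u hu v hv => hv.elim (h u hu v) (h' u hu v)

theorem Separation.anti {A K B : Set V} (h : Separation G A K B) : Anti G A B :=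
  fun _ ha _ hb => ⟨fun e => Set.disjoint_left.1 h.disjAB ha (e ▸ hb), h.nonadj _ ha _ hb⟩

theorem anti_far {x : V} : Anti G {x} (far G x) := by
  rintro _ rfl v hv; exact ⟨hv.1.symm, hv.2⟩

theorem Anti.subset_far {X Y : Set V} (h : Anti G X Y) {x : V} (hx : x ∈ X) : Y ⊆ far G x :=
  fun _ hv => ⟨(h x hx _ hv).1.symm, (h x hx _ hv).2⟩

section
variable {A K B : Set V} {ι : Type*} {s t : ι → V}

/-- The pairs that have a terminal in `B`. -/
def touching (B : Set V) (s t : ι → V) : Set ι := {j | s j ∈ B ∨ t j ∈ B}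

/-- There is a solution of which the part in `K` belongs to a pair without terminals in `B`. -/
def SplitUncrossed (G : SimpleGraph V) (A K B : Set V) (s t : ι → V) : Prop :=
  ∃ x y, SolvableOn G (touching B s t)ᶜ (A ∪ ({x, y} ∩ K)) s t ∧
    SolvableOn G (touching B s t) {v ∈ B | ∀ z ∈ ({x, y} : Set V) ∩ K, v ∈ far G z} s t

open Classical in
/-- There is a solution of which the part in `K` belongs to the pair `o`, which is split. -/
def SplitCrossed (G : SimpleGraph V) (A K B : Set V) (s t : ι → V) (o : ι) : Prop :=
  s o ∈ A ∧ t o ∈ B ∧ ∃ x ∈ K, ∃ y ∈ K,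
    SolvableOn G (insert o (touching B s t)ᶜ) {v | v ∈ A ∧ (x = y ∨ ¬ G.Adj v y) ∨ v = x} s
      (Function.update t o x) ∧
    SolvableOn G (touching B s t) {v | v ∈ B ∧ (x = y ∨ ¬ G.Adj v x) ∨ v = y}
      (Function.update s o y) t

open Classical in
theorem solvableOn_union {J : Set ι} {U U' : Set V}
    (h : SolvableOn G Jᶜ U s t) (h' : SolvableOn G J U' s t) (hU : Anti G U U') :
    SolvableOn G Set.univ Set.univ s t := by
  obtain ⟨S, h1, h2⟩ := h
  obtain ⟨S', h1', h2'⟩ := h'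
  refine ⟨fun j => if j ∈ J then S' j else S j, fun j _ => ⟨Set.subset_univ _, ?_⟩,
    fun i _ j _ hij => ?_⟩
  · by_cases hj : j ∈ J
    · simpa [hj] using (h1' j hj).2
    · simpa [hj] using (h1 j hj).2
  · by_cases hi : i ∈ J <;> by_cases hj : j ∈ J <;> simp only [hi, hj, if_true, if_false]
    · exact h2' i hi j hj hij
    · exact (hU.mono (h1 j hj).1 (h1' i hi).1).symm
    · exact hU.mono (h1 i hi).1 (h1' j hj).1
    · exact h2 i hi j hj hij

theorem Separation.of_uncrossed (h : Separation G A K B) (hs : SplitUncrossed G A K B s t) :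
    SolvableOn G Set.univ Set.univ s t := by
  obtain ⟨x, y, h1, h2⟩ := hs
  refine solvableOn_union h1 h2 ((h.anti.mono subset_rfl (Set.sep_subset _ _)).union_left ?_)
  intro z hz v hv
  exact ⟨(hv.2 z hz).1.symm, (hv.2 z hz).2⟩

/-- The two halves of the pair `o` are joined by the edge from `x` to `y`, or at `x = y`. What has
to be excluded are edges from other pairs on the left to `y`, and from other pairs on the right to
`x`. If `x ≠ y`, the domains forbid them; if `x = y`, they are excluded because this vertex belongs
to the set of `o` on either side. -/
theorem Separation.of_crossed (h : Separation G A K B) {o : ι}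
    (hs : SplitCrossed G A K B s t o) : SolvableOn G Set.univ Set.univ s t := by
  classical
  obtain ⟨hso, hto, x, hx, y, hy, ⟨S, h1, h2⟩, ⟨S', h1', h2'⟩⟩ := hs
  set J := touching B s t
  have hoJ : o ∈ J := Or.inr hto
  have ho := h1 o (Set.mem_insert _ _)
  have ho' := h1' o hoJ
  rw [Function.update_self] at ho ho'
  have hxS : x ∈ S o := ho.2.mem_right
  have hyS : y ∈ S' o := ho'.2.1
  have hnot : ∀ i, i ∉ J → i ≠ o := fun i hi h => hi (h ▸ hoJ)
  have hA : ∀ i, i ∉ J → S i ⊆ {v | v ∈ A ∧ v ∈ far G y} := by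
    intro i hi v hv
    have ha := h2 i (.inr hi) o (.inl rfl) (hnot i hi) v hv x hxS
    obtain ⟨hvA, hor⟩ | rfl := (h1 i (.inr hi)).1 hv
    · refine ⟨hvA, fun e => Set.disjoint_left.1 h.disjAK hvA (e ▸ hy), fun hyv => ?_⟩
      rcases hor with rfl | hn
      · exact ha.2 hyv.symm
      · exact hn hyv.symm
    · exact absurd rfl ha.1
  have hB : ∀ i ∈ J, i ≠ o → S' i ⊆ {v | v ∈ B ∧ v ∈ far G x} := by
    intro i hi hio v hv
    have ha := h2' i hi o hoJ hio v hv y hyS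
    obtain ⟨hvB, hor⟩ | rfl := (h1' i hi).1 hv
    · refine ⟨hvB, fun e => Set.disjoint_left.1 h.disjBK hvB (e ▸ hx), fun hxv => ?_⟩
      rcases hor with rfl | hn
      · exact ha.2 hxv.symm
      · exact hn hxv.symm
    · exact absurd rfl ha.1
  have hSo : S o ⊆ A ∪ {x} := fun v hv => (ho.1 hv).imp (fun h => h.1) fun h => h
  have hSo' : S' o ⊆ B ∪ {y} := fun v hv => (ho'.1 hv).imp (fun h => h.1) fun h => h
  -- the two parts of a solution are anticomplete
  have key₁ : ∀ i, i ∉ J → Anti G (S i) (S' o) := fun i hi => by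
    refine Anti.mono ?_ (hA i hi) hSo'
    refine (h.anti.mono (fun v hv => hv.1) subset_rfl).union_right ?_
    exact (anti_far.symm).mono (fun v hv => hv.2) subset_rfl
  have key₂ : ∀ i ∈ J, i ≠ o → Anti G (S o) (S' i) := fun i hi hio => by
    refine Anti.mono ?_ hSo (hB i hi hio)
    refine (h.anti.mono subset_rfl (fun v hv => hv.1)).union_left ?_
    exact anti_far.mono subset_rfl (fun v hv => hv.2)
  have key₃ : ∀ i, i ∉ J → ∀ j ∈ J, j ≠ o → Anti G (S i) (S' j) := fun i hi j hj hjo =>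
    h.anti.mono (fun v hv => (hA i hi hv).1) (fun v hv => (hB j hj hjo hv).1)
  let Z : ι → Set V := fun i => if i = o then S o ∪ S' o else if i ∈ J then S' i else S i
  have hZ : ∀ i j, i ≠ j → i ≠ o → Anti G (Z i) (Z j) := by
    intro i j hij hio
    by_cases hj : j = o
    · subst hj
      by_cases hi : i ∈ J
      · simp only [Z, hio, hi, if_true, if_false]
        exact (key₂ i hi hio).symm.union_right (h2' i hi j hoJ hio)
      · simp only [Z, hio, hi, if_true, if_false]
        exact Anti.union_right (h2 i (.inr hi) j (.inl rfl) hio) (key₁ i hi)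
    · by_cases hi : i ∈ J <;> by_cases hjJ : j ∈ J <;>
        simp only [Z, hio, hj, hi, hjJ, if_true, if_false]
      · exact h2' i hi j hjJ hij
      · exact (key₃ j hjJ i hi hio).symm
      · exact key₃ i hi j hjJ hj
      · exact h2 i (.inr hi) j (.inr hjJ) hij
  refine ⟨Z, fun j _ => ⟨Set.subset_univ _, ?_⟩, fun i _ j _ hij => ?_⟩
  · by_cases hj : j = o
    · subst hj
      simp only [Z, if_true]
      have e1 := ho.2.mono (Set.subset_union_left (t := S' j))
      have e2 := ho'.2.mono (Set.subset_union_right (s := S j))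
      refine e1.trans (Conn.trans ?_ e2)
      by_cases hxy : x = y
      · subst hxy; exact .refl (.inl hxS)
      · exact .of_adj (.inl hxS) (h.clique hx hy hxy) (.inr hyS)
    · by_cases hjJ : j ∈ J
      · simp only [Z, hj, hjJ, if_true, if_false]
        have := (h1' j hjJ).2
        rwa [Function.update_of_ne hj] at this
      · simp only [Z, hj, hjJ, if_false]
        have := (h1 j (.inr hjJ)).2
        rwa [Function.update_of_ne hj] at this
  · by_cases hi : i = o
    · exact (hZ j i hij.symm fun hj => hij (hi.trans hj.symm)).symm
    · exact hZ i j hij hi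

/-- A path from `A ∪ K` that meets `K` does so without visiting `B` before. -/
theorem Separation.first_hit (h : Separation G A K B) {S : Set V} {u p : V} (hc : Conn G S u p)
    (hu : u ∉ B) (hp : p ∈ K) : ∃ x ∈ S ∩ K, Conn G (S ∩ A ∪ {x}) u x := by
  have : (∃ x ∈ S ∩ K, Conn G (S ∩ A ∪ {x}) u x) ∨ (p ∈ A ∧ Conn G (S ∩ A) u p) := by
    refine hc.ind (p := fun p => (∃ x ∈ S ∩ K, Conn G (S ∩ A ∪ {x}) u x) ∨
      (p ∈ A ∧ Conn G (S ∩ A) u p)) ?_ ?_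
    · rcases h.cover u with hu' | hu' | hu'
      · exact .inr ⟨hu', .refl ⟨hc.1, hu'⟩⟩
      · exact .inl ⟨u, ⟨hc.1, hu'⟩, .refl (.inr rfl)⟩
      · exact absurd hu' hu
    · rintro v w hv hvw hw (h' | ⟨hvA, hcv⟩)
      · exact .inl h'
      · rcases h.cover w with hw' | hw' | hw'
        · exact .inr ⟨hw', hcv.tail hvw ⟨hw, hw'⟩⟩
        · exact .inl ⟨w, ⟨hw, hw'⟩, (hcv.mono Set.subset_union_left).tail hvw (.inr rfl)⟩
        · exact absurd hvw (h.nonadj v hvA w hw')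
  exact this.resolve_right fun h' => Set.disjoint_left.1 h.disjAK h'.1 hp

/-- A path that avoids `K` stays on its side. -/
theorem Separation.stay (h : Separation G A K B) {S : Set V} {u v : V} (hc : Conn G S u v)
    (hu : u ∈ A) (hS : ∀ x ∈ S, x ∉ K) : Conn G (S ∩ A) u v :=
  hc.mem_of_closed hu fun a ha b hb hab => by
    rcases h.cover b with hb' | hb' | hb'
    · exact hb'
    · exact absurd hb' (hS b hb)
    · exact absurd hab (h.nonadj a ha b hb')

variable {S : ι → Set V}

/-- The sets of a solution may be assumed to be connected. -/
theorem SolvableOn.exists_connected {J : Set ι} {U : Set V} (h : SolvableOn G J U s t) :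
    ∃ S : ι → Set V, (∀ j ∈ J, S j ⊆ U ∧ t j ∈ S j ∧ ∀ v ∈ S j, Conn G (S j) (s j) v) ∧
      ∀ i ∈ J, ∀ j ∈ J, i ≠ j → Anti G (S i) (S j) := by
  obtain ⟨S, h1, h2⟩ := h
  have hsub : ∀ j, comp G (S j) (s j) ⊆ S j := fun j v hv => Conn.mem_right hv
  refine ⟨fun j => comp G (S j) (s j), fun j hj => ⟨(hsub j).trans (h1 j hj).1, (h1 j hj).2,
    fun v hv => ?_⟩, fun i hi j hj hij => Anti.mono (h2 i hi j hj hij) (hsub i) (hsub j)⟩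
  refine (Conn.mem_of_closed hv (A := comp G (S j) (s j)) (Conn.refl (Conn.mono hv subset_rfl).1) ?_).mono
    Set.inter_subset_right
  exact fun a ha b hb hab => Conn.tail ha hab hb

section
variable (h : Separation G A K B) (hc : ∀ j, Conn G (S j) (s j) (t j))
  (hS : ∀ i j, i ≠ j → Anti G (S i) (S j))

include h hc in
theorem Separation.stay_right {j : ι} (hj : j ∈ touching B s t) (hK : ∀ z ∈ S j, z ∉ K) :
    Conn G (S j ∩ B) (s j) (t j) := by
  rcases hj with hj' | hj'
  · exact h.symm.stay (hc j) hj' hK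
  · exact (h.symm.stay (hc j).symm hj' hK).symm

include h hc in
theorem Separation.stay_left {j : ι} (hj : j ∉ touching B s t) (hK : ∀ z ∈ S j, z ∉ K) :
    Conn G (S j ∩ A) (s j) (t j) := by
  refine h.stay (hc j) ?_ hK
  rcases h.cover (s j) with h' | h' | h'
  · exact h'
  · exact absurd h' (hK _ (hc j).1)
  · exact absurd (Or.inl h') hj

include h hc hS

theorem Separation.uncrossed_of_sets {x y : V}
    (hJ : ∀ j ∈ touching B s t, (∀ z ∈ S j, z ∉ K) ∧
      ∀ z ∈ ({x, y} : Set V) ∩ K, S j ⊆ far G z)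
    (hJc : ∀ j ∉ touching B s t, Conn G (S j ∩ (A ∪ ({x, y} ∩ K))) (s j) (t j)) :
    SplitUncrossed G A K B s t := by
  refine ⟨x, y, ⟨fun j => S j ∩ (A ∪ ({x, y} ∩ K)), fun j hj => ⟨Set.inter_subset_right, hJc j hj⟩,
    fun i _ j _ hij => (hS i j hij).mono Set.inter_subset_left Set.inter_subset_left⟩,
    ⟨fun j => S j ∩ B, fun j hj => ⟨?_, h.stay_right hc hj (hJ j hj).1⟩,
    fun i _ j _ hij => (hS i j hij).mono Set.inter_subset_left Set.inter_subset_left⟩⟩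
  exact fun v hv => ⟨hv.2, fun z hz => (hJ j hj).2 z hz hv.1⟩

/-- The case in which `K` is not used is encoded by choosing `x = y` outside of `K`, so that `{x, y}
∩ K` is empty. -/
theorem Separation.uncrossed_of_avoid (hK : ∀ j, ∀ z ∈ S j, z ∉ K) (hA : ∃ a, a ∉ K) :
    SplitUncrossed G A K B s t := by
  obtain ⟨a, ha⟩ := hA
  refine h.uncrossed_of_sets hc hS (x := a) (y := a) (fun j hj => ⟨hK j, ?_⟩) fun j hj => ?_
  · rintro z ⟨hz, hzK⟩
    simp only [Set.mem_insert_iff, Set.mem_singleton_iff, or_self] at hz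
    exact absurd (hz ▸ hzK) ha
  · exact (h.stay_left hc hj (hK j)).mono
      (Set.inter_subset_inter_right _ Set.subset_union_left)

/-- Follow the connection from each end of the pair until it meets `K`. Up to these vertices `x` and
`y` it has not entered `B`, and since `K` is a clique the remainder can be replaced by at most one
edge. -/
theorem Separation.uncrossed_of_hit {o : ι} {p : V} (hso : s o ∉ B) (hto : t o ∉ B) (hp : p ∈ K)
    (hsp : Conn G (S o) (s o) p) (hother : ∀ j, j ≠ o → ∀ z ∈ S j, z ∉ K) :
    SplitUncrossed G A K B s t := by
  obtain ⟨x, hx, hsx⟩ := h.first_hit hsp hso hp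
  obtain ⟨y, hy, hty⟩ := h.first_hit ((hc o).symm.trans hsp) hto hp
  refine h.uncrossed_of_sets hc hS (x := x) (y := y) (fun j hj => ?_) fun j hj => ?_
  · have hjo : j ≠ o := fun e => (e ▸ hj).elim hso hto
    refine ⟨hother j hjo, ?_⟩
    rintro z ⟨rfl | rfl, -⟩
    · exact (hS o j hjo.symm).subset_far hx.1
    · exact (hS o j hjo.symm).subset_far hy.1
  · by_cases hjo : j = o
    · subst hjo
      have hx' : x ∈ S j ∩ (A ∪ ({x, y} ∩ K)) := ⟨hx.1, .inr ⟨.inl rfl, hx.2⟩⟩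
      have hy' : y ∈ S j ∩ (A ∪ ({x, y} ∩ K)) := ⟨hy.1, .inr ⟨.inr rfl, hy.2⟩⟩
      have sub : ∀ z ∈ S j ∩ (A ∪ ({x, y} ∩ K)), S j ∩ A ∪ {z} ⊆ S j ∩ (A ∪ ({x, y} ∩ K)) := by
        rintro z hz v (hv | rfl)
        · exact ⟨hv.1, .inl hv.2⟩
        · exact hz
      refine (hsx.mono (sub x hx')).trans (Conn.trans ?_ (hty.mono (sub y hy')).symm)
      by_cases hxy : x = y
      · subst hxy; exact .refl hx'
      · exact .of_adj hx' (h.clique hx.2 hy.2 hxy) hy'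
    · exact (h.stay_left hc hj (hother j hjo)).mono
        (Set.inter_subset_inter_right _ Set.subset_union_left)

end

/-- A path in `A` towards `x` reaches `x` before it comes next to `y`, or reaches `y`. -/
theorem Conn.avoid_or {X : Set V} {u x : V} (y : V) (hc : Conn G (X ∪ {x}) u x) (hu : u ∈ X)
    (hx : x ∉ X) : Conn G (X ∪ {y}) u y ∨ Conn G ({v ∈ X | ¬ G.Adj v y} ∪ {x}) u x := by
  have : (Conn G (X ∪ {y}) u y ∨ Conn G ({v ∈ X | ¬ G.Adj v y} ∪ {x}) u x) ∨
      Conn G {v ∈ X | ¬ G.Adj v y} u x := by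
    have hleft : ∀ v, Conn G X u v → G.Adj v y → Conn G (X ∪ {y}) u y := fun v hv ha =>
      (hv.mono Set.subset_union_left).tail ha (.inr rfl)
    refine hc.ind (p := fun w => (Conn G (X ∪ {y}) u y ∨
      Conn G ({v ∈ X | ¬ G.Adj v y} ∪ {x}) u x) ∨ Conn G {v ∈ X | ¬ G.Adj v y} u w) ?_ ?_
    · by_cases ha : G.Adj u y
      · exact .inl (.inl (hleft u (.refl hu) ha))
      · exact .inr (.refl ⟨hu, ha⟩)
    · rintro v w - hvw hw (ih | ih)
      · exact .inl ih
      · rcases hw with hw | rfl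
        · by_cases ha : G.Adj w y
          · exact .inl (.inl (hleft w ((ih.mono (Set.sep_subset _ _)).tail hvw hw) ha))
          · exact .inr (ih.tail hvw ⟨hw, ha⟩)
        · exact .inl (.inr ((ih.mono Set.subset_union_left).tail hvw (.inr rfl)))
  exact this.resolve_right fun h' => hx h'.mem_right.1

/-- Let `x` and `y` be the first vertices of `K` seen from the two ends. The left domain excludes
neighbours of `y` for all pairs, including `o`, so the left half must avoid them too. If it does
not, it can go directly to `y`, and `y` serves as the only crossing vertex; symmetrically with `x`
for the right half. `Conn.avoid_or` provides this alternative. -/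
theorem Separation.crossed_of_hit (h : Separation G A K B) (hc : ∀ j, Conn G (S j) (s j) (t j))
    (hS : ∀ i j, i ≠ j → Anti G (S i) (S j)) {o : ι} {p : V} (hso : s o ∈ A) (hto : t o ∈ B)
    (hp : p ∈ K) (hsp : Conn G (S o) (s o) p) (hother : ∀ j, j ≠ o → ∀ z ∈ S j, z ∉ K) :
    SplitCrossed G A K B s t o := by
  classical
  have htp := (hc o).symm.trans hsp
  obtain ⟨x, hx, hsx⟩ := h.first_hit hsp (Set.disjoint_left.1 h.disjAB hso) hp
  obtain ⟨y, hy, hty⟩ := h.symm.first_hit htp (Set.disjoint_right.1 h.disjAB hto) hp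
  have hxA : x ∉ S o ∩ A := fun h' => Set.disjoint_left.1 h.disjAK h'.2 hx.2
  have hyB : y ∉ S o ∩ B := fun h' => Set.disjoint_left.1 h.disjBK h'.2 hy.2
  obtain ⟨x, y, hx, hy, hsx, hty⟩ : ∃ x y, x ∈ S o ∩ K ∧ y ∈ S o ∩ K ∧
      Conn G ({v ∈ S o ∩ A | x = y ∨ ¬ G.Adj v y} ∪ {x}) (s o) x ∧
      Conn G ({v ∈ S o ∩ B | x = y ∨ ¬ G.Adj v x} ∪ {y}) (t o) y := by
    have hself : ∀ (X : Set V) (x : V), {v ∈ X | x = x ∨ ¬ G.Adj v x} = X := by simp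
    rcases hsx.avoid_or y ⟨hsp.1, hso⟩ hxA with h1 | h1
    · exact ⟨y, y, hy, hy, by rwa [hself], by rwa [hself]⟩
    rcases hty.avoid_or x ⟨htp.1, hto⟩ hyB with h2 | h2
    · exact ⟨x, x, hx, hx, by rwa [hself], by rwa [hself]⟩
    · refine ⟨x, y, hx, hy, h1.mono ?_, h2.mono ?_⟩ <;>
        exact Set.union_subset_union_left _ fun v hv => ⟨hv.1, .inr hv.2⟩
  have hnbr : ∀ z ∈ S o, ∀ j, j ≠ o → ∀ v ∈ S j, ¬ G.Adj v z := fun z hz j hj v hv =>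
    (hS j o hj v hv z hz).2
  have hanti : ∀ {Z : Set V} {j}, Z ⊆ S o → j ≠ o → ∀ {X : Set V}, Anti G Z (S j ∩ X) :=
    fun hZ hj => (hS o _ hj.symm).mono hZ Set.inter_subset_left
  refine ⟨hso, hto, x, hx.2, y, hy.2,
    ⟨fun j => if j = o then {v ∈ S o ∩ A | x = y ∨ ¬ G.Adj v y} ∪ {x} else S j ∩ A, ?_, ?_⟩,
    ⟨fun j => if j = o then {v ∈ S o ∩ B | x = y ∨ ¬ G.Adj v x} ∪ {y} else S j ∩ B, ?_, ?_⟩⟩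
  · intro j hj
    by_cases hjo : j = o
    · subst hjo
      simp only [if_true, Function.update_self]
      refine ⟨?_, hsx⟩
      rintro v (hv | rfl)
      · exact .inl ⟨hv.1.2, hv.2⟩
      · exact .inr rfl
    · simp only [hjo, if_false, Function.update_of_ne hjo]
      exact ⟨fun v hv => .inl ⟨hv.2, .inr (hnbr y hy.1 j hjo v hv.1)⟩,
        h.stay_left hc (hj.resolve_left hjo) (hother j hjo)⟩
  · have hsub : {v ∈ S o ∩ A | x = y ∨ ¬ G.Adj v y} ∪ {x} ⊆ S o := by
      rintro v (hv | rfl)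
      exacts [hv.1.1, hx.1]
    intro i _ j _ hij
    by_cases hi : i = o <;> by_cases hj : j = o <;> simp only [hi, hj, if_true, if_false]
    · exact absurd (hi.trans hj.symm) hij
    · exact hanti hsub hj
    · exact (hanti hsub hi).symm
    · exact (hS i j hij).mono Set.inter_subset_left Set.inter_subset_left
  · intro j hj
    by_cases hjo : j = o
    · subst hjo
      simp only [if_true, Function.update_self]
      refine ⟨?_, hty.symm⟩
      rintro v (hv | rfl)
      · exact .inl ⟨hv.1.2, hv.2⟩
      · exact .inr rfl
    · simp only [hjo, if_false, Function.update_of_ne hjo]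
      exact ⟨fun v hv => .inl ⟨hv.2, .inr (hnbr x hx.1 j hjo v hv.1)⟩,
        h.stay_right hc hj (hother j hjo)⟩
  · have hsub : {v ∈ S o ∩ B | x = y ∨ ¬ G.Adj v x} ∪ {y} ⊆ S o := by
      rintro v (hv | rfl)
      exacts [hv.1.1, hy.1]
    intro i _ j _ hij
    by_cases hi : i = o <;> by_cases hj : j = o <;> simp only [hi, hj, if_true, if_false]
    · exact absurd (hi.trans hj.symm) hij
    · exact hanti hsub hj
    · exact (hanti hsub hi).symm
    · exact (hS i j hij).mono Set.inter_subset_left Set.inter_subset_left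

/-- A solution is of one of four forms, and not all pairs have a terminal in `B`. -/
theorem Separation.split (h : Separation G A K B) (hsol : SolvableOn G Set.univ Set.univ s t)
    (hA : ∃ a, a ∉ K) :
    SplitUncrossed G A K B s t ∨ SplitUncrossed G B K A s t ∨
      (∃ o, SplitCrossed G A K B s t o) ∨ ∃ o, SplitCrossed G B K A s t o := by
  obtain ⟨S, hc, hS⟩ := hsol.exists_connected
  have hcc : ∀ j, ∀ v ∈ S j, Conn G (S j) (s j) v := fun j => (hc j trivial).2.2
  replace hc : ∀ j, Conn G (S j) (s j) (t j) := fun j => hcc j _ (hc j trivial).2.1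
  replace hS : ∀ i j, i ≠ j → Anti G (S i) (S j) := fun i j => hS i trivial j trivial
  by_cases hK : ∃ o, ∃ p ∈ S o, p ∈ K
  swap
  · push Not at hK
    exact .inl (h.uncrossed_of_avoid hc hS hK hA)
  obtain ⟨o, p, hpS, hpK⟩ := hK
  -- Vertices of different pairs are neither equal nor adjacent, so a clique is met by only one
  -- pair.
  have hother : ∀ j, j ≠ o → ∀ z ∈ S j, z ∉ K := fun j hj z hz hzK =>
    (hS j o hj z hz p hpS).2 (h.clique hzK hpK (hS j o hj z hz p hpS).1)
  have hp := hcc o p hpS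
  by_cases h1 : s o ∉ B ∧ t o ∉ B
  · exact .inl (h.uncrossed_of_hit hc hS h1.1 h1.2 hpK hp hother)
  by_cases h2 : s o ∉ A ∧ t o ∉ A
  · exact .inr (.inl (h.symm.uncrossed_of_hit hc hS h2.1 h2.2 hpK hp hother))
  have hd : ∀ v, v ∈ A → v ∉ B := fun v hv => Set.disjoint_left.1 h.disjAB hv
  have := hd (s o)
  have := hd (t o)
  by_cases h3 : s o ∈ A
  · exact .inr (.inr (.inl ⟨o, h.crossed_of_hit hc hS h3 (by tauto) hpK hp hother⟩))
  · exact .inr (.inr (.inr ⟨o, h.symm.crossed_of_hit hc hS (by tauto) (by tauto) hpK hp hother⟩))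

/-- A pair with terminals on both sides uses the separator. -/
theorem Separation.exists_mem_of_crossing (h : Separation G A K B) {X : Set V} {u v : V}
    (hc : Conn G X u v) (hu : u ∈ A) (hv : v ∈ B) : ∃ z ∈ X, z ∈ K := by
  by_contra! hK
  exact Set.disjoint_left.1 h.disjAB (h.stay hc hu hK).mem_right.2 hv

/-- If one side contains two terminals, then not all pairs of a solvable instance have a terminal on
the other side. -/
theorem Separation.touching_ne_univ (h : Separation G A K B)
    (hsol : SolvableOn G Set.univ Set.univ s t)
    (hA : ∃ a b : ι ⊕ ι, a ≠ b ∧ Sum.elim s t a ∈ A ∧ Sum.elim s t b ∈ A) :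
    touching B s t ≠ Set.univ := by
  intro huniv
  obtain ⟨S, hc, hS⟩ := hsol
  have hno : ∀ v, v ∈ A → v ∉ B := fun v hv => Set.disjoint_left.1 h.disjAB hv
  have htouch : ∀ j, s j ∈ B ∨ t j ∈ B := fun j =>
    huniv.symm.subset (Set.mem_univ j)
  have key : ∀ j, s j ∈ A ∨ t j ∈ A → ∃ z ∈ S j, z ∈ K := by
    rintro j (hj | hj)
    · exact h.exists_mem_of_crossing (hc j trivial).2 hj ((htouch j).resolve_left (hno _ hj))
    · exact h.exists_mem_of_crossing (hc j trivial).2.symm hj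
        ((htouch j).resolve_right (hno _ hj))
  obtain ⟨a, b, hab, ha, hb⟩ := hA
  have hidx : ∀ a : ι ⊕ ι, Sum.elim s t a ∈ A → ∃ j, (a = .inl j ∨ a = .inr j) ∧
      (s j ∈ A ∨ t j ∈ A) := by
    rintro (j | j) hj
    · exact ⟨j, .inl rfl, .inl hj⟩
    · exact ⟨j, .inr rfl, .inr hj⟩
  obtain ⟨i, hi, hiA⟩ := hidx a ha
  obtain ⟨j, hj, hjA⟩ := hidx b hb
  have hij : i ≠ j := by
    rintro rfl
    have hboth : ¬ (s i ∈ A ∧ t i ∈ A) := fun h' =>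
      (htouch i).elim (hno _ h'.1) (hno _ h'.2)
    rcases hi with rfl | rfl <;> rcases hj with rfl | rfl
    · exact hab rfl
    · exact hboth ⟨ha, hb⟩
    · exact hboth ⟨hb, ha⟩
    · exact hab rfl
  -- Two distinct pairs would both cross and hence both use the clique.
  obtain ⟨z, hz, hzK⟩ := key i hiA
  obtain ⟨w, hw, hwK⟩ := key j hjA
  have := hS i trivial j trivial hij z hz w hw
  exact this.2 (h.clique hzK hwK this.1)

theorem compl_touching_ne_univ (hB : ∃ a : ι ⊕ ι, Sum.elim s t a ∈ B) :
    (touching B s t)ᶜ ≠ Set.univ := by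
  intro huniv
  obtain ⟨j | j, hj⟩ := hB
  · exact (huniv.symm ▸ Set.mem_univ j : j ∈ (touching B s t)ᶜ) (.inl hj)
  · exact (huniv.symm ▸ Set.mem_univ j : j ∈ (touching B s t)ᶜ) (.inr hj)

/-- Otherwise `o` would be the only pair with a terminal in `B`, and since `s o` is in `A`, only `t
o` would be there. -/
theorem Separation.insert_compl_touching_ne_univ (h : Separation G A K B) {o : ι} (hso : s o ∈ A)
    (hB : ∃ a b : ι ⊕ ι, a ≠ b ∧ Sum.elim s t a ∈ B ∧ Sum.elim s t b ∈ B) :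
    insert o (touching B s t)ᶜ ≠ Set.univ := by
  intro huniv
  have key : ∀ a : ι ⊕ ι, Sum.elim s t a ∈ B → a = .inr o := by
    intro a ha
    have hmem : ∀ j, j ∈ touching B s t → j = o := fun j hj =>
      (huniv.symm ▸ Set.mem_univ j : j ∈ insert o (touching B s t)ᶜ).resolve_right
        fun h' => h' hj
    rcases a with j | j
    · obtain rfl := hmem j (.inl ha)
      exact absurd ha (Set.disjoint_left.1 h.disjAB hso)
    · obtain rfl := hmem j (.inr ha)
      rfl
  obtain ⟨a, b, hab, ha, hb⟩ := hB
  exact hab ((key a ha).trans (key b hb).symm)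

end

end

/-! ## Moving the terminals into a reduced vertex set -/

section
variable {V : Type*} {G : SimpleGraph V} {ι : Type*} {s t : ι → V} {W : Set V}

/-- The vertices of `W` to which the terminal `w` can be moved. -/
def ports (G : SimpleGraph V) (W : Set V) (w : V) : Set V :=
  {a ∈ W | a = w ∨ ∃ z, Conn G Wᶜ w z ∧ G.Adj z a}

/-- The vertices outside of `W` that can be reached from `w` outside of `W`. -/
def pocket (G : SimpleGraph V) (W : Set V) (w : V) : Set V := comp G Wᶜ w

theorem conn_of_port {w a : V} (ha : a ∈ ports G W w) : Conn G (insert a (pocket G W w)) w a := by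
  obtain ⟨-, rfl | ⟨z, hz, hza⟩⟩ := ha
  · exact .refl (Set.mem_insert _ _)
  · have : Conn G (pocket G W w) w z := by
      refine (hz.mem_of_closed (A := pocket G W w) (.refl hz.1) ?_).mono Set.inter_subset_right
      exact fun a ha b hb hab => Conn.tail ha hab hb
    exact (this.mono (Set.subset_insert _ _)).tail hza (Set.mem_insert _ _)

variable (hW : Reduced G (Set.range s ∪ Set.range t) W)
  (hst : Function.Injective (Sum.elim s t))

/-- A component of the complement of `W` contains at most one terminal. So a connection from `w` to
another terminal has to leave the component of `w`, and the first vertex of `W` that it reaches is a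
port. -/
theorem exists_port {T S : Set V} {w v : V} (hW : Reduced G T W) (hw : w ∈ T) (hv : v ∈ T)
    (hwv : w ≠ v) (hc : Conn G S w v) : ∃ a ∈ ports G W w, Conn G S w a := by
  by_cases hwW : w ∈ W
  · exact ⟨w, ⟨hwW, .inl rfl⟩, .refl hc.1⟩
  have : (∃ a ∈ ports G W w, Conn G S w a) ∨ Conn G Wᶜ w v ∧ Conn G S w v := by
    refine hc.ind (p := fun v => (∃ a ∈ ports G W w, Conn G S w a) ∨
      Conn G Wᶜ w v ∧ Conn G S w v) (.inr ⟨.refl hwW, .refl hc.1⟩) ?_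
    rintro a b - hab hb (ih | ⟨ih, ih'⟩)
    · exact .inl ih
    · by_cases hbW : b ∈ W
      · exact .inl ⟨b, ⟨hbW, .inr ⟨a, ih, hab⟩⟩, ih'.tail hab hb⟩
      · exact .inr ⟨ih.tail hab hbW, ih'.tail hab hb⟩
  exact this.resolve_right fun h' => hwv (hW.term w hw v hv h'.1)

include hW hst in
-- Choose ports on the connections of a solution. If the two ports of every pair differ, projecting
-- the sets to `W` solves the moved instance. If those of a pair `i` coincide in `x`, the other
-- pairs avoid the closed neighbourhood of `x`, and nothing else has to be known about pair `i`.
theorem solvable_ports (h : SolvableOn G Set.univ Set.univ s t) :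
    (∃ a b : ι → V, (∀ i, a i ∈ ports G W (s i)) ∧ (∀ i, b i ∈ ports G W (t i)) ∧
      (∀ i, a i ≠ b i) ∧ SolvableOn G Set.univ W a b) ∨
    ∃ i x, x ∈ ports G W (s i) ∧ x ∈ ports G W (t i) ∧ SolvableOn G {i}ᶜ (far G x) s t := by
  obtain ⟨S, hc, hS⟩ := h
  have hne : ∀ i, s i ≠ t i := fun i hi => by
    have := @hst (.inl i) (.inr i) hi
    simp at this
  have hs : ∀ i, s i ∈ Set.range s ∪ Set.range t := fun i => .inl ⟨i, rfl⟩
  have ht : ∀ i, t i ∈ Set.range s ∪ Set.range t := fun i => .inr ⟨i, rfl⟩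
  choose a ha hsa using fun i => exists_port hW (hs i) (ht i) (hne i) (hc i trivial).2
  choose b hb htb using fun i => exists_port hW (ht i) (hs i) (hne i).symm (hc i trivial).2.symm
  by_cases hab : ∃ i, a i = b i
  · obtain ⟨i, hi⟩ := hab
    refine .inr ⟨i, a i, ha i, hi ▸ hb i, S, fun j hj => ⟨?_, (hc j trivial).2⟩,
      fun j _ l _ => hS j trivial l trivial⟩
    exact Anti.subset_far (hS i trivial j trivial (Ne.symm hj)) (hsa i).mem_right
  · push Not at hab
    refine .inl ⟨a, b, ha, hb, hab, fun i => S i ∩ W, fun i _ => ⟨Set.inter_subset_right, ?_⟩,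
      fun i _ j _ hij => Anti.mono (hS i trivial j trivial hij) Set.inter_subset_left
        Set.inter_subset_left⟩
    exact hW.project ((hsa i).symm.trans ((hc i trivial).2.trans (htb i))) (ha i).1 (hb i).1

/-- A connected set that contains a vertex outside of the pocket of `w` and stays away from a port
of `w` stays away from the pocket. -/
theorem pocket_anti {T S : Set V} {w v a : V} (hW : Reduced G T W) (ha : a ∈ ports G W w)
    (hS : S ⊆ far G a) (hv : v ∉ pocket G W w) (hc : ∀ x ∈ S, Conn G S v x) :
    Anti G (pocket G W w) S := by
  have hport : ∀ z ∈ pocket G W w, ∀ x ∈ S, x ∈ W → ¬ G.Adj z x := by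
    intro z hz x hx hxW hzx
    obtain ⟨haW, rfl | ⟨z', hz', hz'a⟩⟩ := ha
    · exact (Conn.mono hz subset_rfl).1 haW
    · exact (hS hx).2 (hW.clique w a x z' z haW hxW hz' hz hz'a hzx (hS hx).1.symm)
  have hout : ∀ x ∈ S, x ∉ pocket G W w := by
    intro x hx
    refine (hc x hx).ind (p := fun x => x ∉ pocket G W w) hv fun y z hvy hyz hz ih hzP => ?_
    by_cases hyW : y ∈ W
    · exact hport z hzP y hvy.mem_right hyW hyz.symm
    · exact ih (comp_nbr hzP hyz.symm hyW)
  intro z hz x hx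
  refine ⟨fun e => hout x hx (e ▸ hz), fun hzx => ?_⟩
  by_cases hxW : x ∈ W
  · exact hport z hz x hx hxW hzx
  · exact hout x hx (comp_nbr hz hzx hxW)

theorem pocket_pocket_anti {T : Set V} {w v : V} (hW : Reduced G T W) (hw : w ∈ T) (hv : v ∈ T)
    (hwv : w ≠ v) : Anti G (pocket G W w) (pocket G W v) := by
  have hd : ∀ x, x ∈ pocket G W w → x ∉ pocket G W v := fun x hx hx' =>
    hwv (hW.term w hw v hv (Conn.trans hx (Conn.symm hx')))
  intro x hx y hy
  exact ⟨fun e => hd x hx (e ▸ hy), fun hxy => hd y (comp_nbr hx hxy (Conn.mem_right hy)) hy⟩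

include hW hst in
-- Each set is extended by the pockets of its two terminals. Pockets of different terminals have no
-- contact, and a set of another pair has no contact with a pocket because it stays away from one of
-- its ports (`pocket_anti`).
theorem solvable_of_ports {a b : ι → V} (ha : ∀ i, a i ∈ ports G W (s i))
    (hb : ∀ i, b i ∈ ports G W (t i)) (h : SolvableOn G Set.univ W a b) :
    SolvableOn G Set.univ Set.univ s t := by
  obtain ⟨S, hc, hS⟩ := h.exists_connected
  have hs : ∀ i, s i ∈ Set.range s ∪ Set.range t := fun i => .inl ⟨i, rfl⟩
  have ht : ∀ i, t i ∈ Set.range s ∪ Set.range t := fun i => .inr ⟨i, rfl⟩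
  have hSW : ∀ i, S i ⊆ W := fun i => (hc i trivial).1
  have haS : ∀ i, Conn G (S i) (a i) (b i) := fun i => (hc i trivial).2.2 _ (hc i trivial).2.1
  have hfar : ∀ i j, i ≠ j → ∀ x ∈ S i, S j ⊆ far G x := fun i j hij x hx =>
    (hS i trivial j trivial hij).subset_far hx
  have hpa : ∀ i j, i ≠ j → Anti G (pocket G W (s i)) (S j) := fun i j hij =>
    pocket_anti hW (ha i) (hfar i j hij _ (haS i).1) (fun h' => Conn.mem_right h'
      (hSW j (haS j).1)) (hc j trivial).2.2
  have hpb : ∀ i j, i ≠ j → Anti G (pocket G W (t i)) (S j) := fun i j hij =>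
    pocket_anti hW (hb i) (hfar i j hij _ (haS i).mem_right) (fun h' => Conn.mem_right h'
      (hSW j (haS j).1)) (hc j trivial).2.2
  refine ⟨fun i => S i ∪ (pocket G W (s i) ∪ pocket G W (t i)), fun i _ => ⟨Set.subset_univ _, ?_⟩,
    fun i _ j _ hij => ?_⟩
  · refine ((conn_of_port (ha i)).mono ?_).trans (((haS i).mono Set.subset_union_left).trans
      ((conn_of_port (hb i)).mono ?_).symm)
    · exact Set.insert_subset (.inl (haS i).1) fun x hx => .inr (.inl hx)
    · exact Set.insert_subset (.inl (haS i).mem_right) fun x hx => .inr (.inr hx)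
  · have e : ∀ x y, x ≠ y → Sum.elim s t x ≠ Sum.elim s t y := fun x y hxy h' => hxy (hst h')
    refine Anti.union_left (Anti.union_right (hS i trivial j trivial hij) (Anti.union_right
      (hpa j i hij.symm).symm (hpb j i hij.symm).symm)) (Anti.union_left (Anti.union_right
      (hpa i j hij) (Anti.union_right ?_ ?_)) (Anti.union_right (hpb i j hij)
      (Anti.union_right ?_ ?_)))
    · exact pocket_pocket_anti hW (hs i) (hs j) (e (.inl i) (.inl j) (by simpa using hij))
    · exact pocket_pocket_anti hW (hs i) (ht j) (e (.inl i) (.inr j) (by simp))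
    · exact pocket_pocket_anti hW (ht i) (hs j) (e (.inr i) (.inl j) (by simp))
    · exact pocket_pocket_anti hW (ht i) (ht j) (e (.inr i) (.inr j) (by simpa using hij))

include hW hst in
-- Pair `i` is connected by `x` and the pockets of its two terminals. The other pairs stay away from
-- `x`, hence by `pocket_anti` from both pockets.
theorem solvable_of_common_port {i : ι} {x : V} (hs : x ∈ ports G W (s i))
    (ht : x ∈ ports G W (t i)) (h : SolvableOn G {i}ᶜ (far G x) s t) :
    SolvableOn G Set.univ Set.univ s t := by
  classical
  obtain ⟨S, hc, hS⟩ := h.exists_connected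
  have hms : ∀ i, s i ∈ Set.range s ∪ Set.range t := fun i => .inl ⟨i, rfl⟩
  have hmt : ∀ i, t i ∈ Set.range s ∪ Set.range t := fun i => .inr ⟨i, rfl⟩
  have e : ∀ x y, x ≠ y → Sum.elim s t x ≠ Sum.elim s t y := fun x y hxy h' => hxy (hst h')
  have hp : ∀ w ∈ Set.range s ∪ Set.range t, x ∈ ports G W w → ∀ j, j ≠ i → w ≠ s j →
      Anti G (pocket G W w) (S j) := fun w hw hx j hj hne =>
    pocket_anti hW hx (hc j hj).1 (fun h' => hne (hW.term _ hw _ (hms j) h')) (hc j hj).2.2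
  have key : ∀ j, j ≠ i → Anti G ({x} ∪ (pocket G W (s i) ∪ pocket G W (t i))) (S j) := by
    intro j hj
    refine Anti.union_left (anti_far.mono subset_rfl (hc j hj).1) (Anti.union_left
      (hp _ (hms i) hs j hj ?_) (hp _ (hmt i) ht j hj ?_))
    · exact e (.inl i) (.inl j) (by simpa using hj.symm)
    · exact e (.inr i) (.inl j) (by simp)
  refine ⟨fun j => if j = i then {x} ∪ (pocket G W (s i) ∪ pocket G W (t i)) else S j,
    fun j _ => ⟨Set.subset_univ _, ?_⟩, fun j _ l _ hjl => ?_⟩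
  · by_cases hj : j = i
    · subst hj
      simp only [if_true]
      refine ((conn_of_port hs).mono ?_).trans ((conn_of_port ht).mono ?_).symm
      · exact Set.insert_subset (.inl rfl) fun x hx => .inr (.inl hx)
      · exact Set.insert_subset (.inl rfl) fun x hx => .inr (.inr hx)
    · simp only [hj, if_false]
      exact (hc j hj).2.2 _ (hc j hj).2.1
  · by_cases hj : j = i <;> by_cases hl : l = i <;> simp only [hj, hl, if_true, if_false]
    · exact absurd (hj.trans hl.symm) hjl
    · exact key l hl
    · exact (key j hj).symm
    · exact hS j hj l hl hjl

end

namespace RAM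

variable {𝒢 : GraphClass} {k : ℕ}

/-! ## Commands -/

/-- Commands that change the store; at level `ℓ`, an assignment and a loop bind variables from
`ℓ` on. -/
inductive Com (k : ℕ) where
  | setU (r : ℕ) (φ : Fml k)
  | setT (r : ℕ) (φ : Fml k)
  | seq (c c' : Com k)
  | loop (c : Com k)

/-- The effect of a command. -/
def Com.run : Com k → ℕ → (I : Input 𝒢 k) → (ℕ → Fin I.n) → Store I.n → Store I.n
  | .setU r φ, ℓ, I, ρ, S => S.setU r fun v => φ.sat (ℓ + 1) I S (Function.update ρ ℓ v)
  | .setT r φ, ℓ, I, ρ, S => S.setT r fun i j l => φ.sat (ℓ + 3) I S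
      (Function.update (Function.update (Function.update ρ ℓ i) (ℓ + 1) j) (ℓ + 2) l)
  | .seq c c', ℓ, I, ρ, S => c'.run ℓ I ρ (c.run ℓ I ρ S)
  | .loop c, ℓ, I, ρ, S =>
      (List.finRange I.n).foldl (fun S v => c.run (ℓ + 1) I (Function.update ρ ℓ v) S) S

/-- All free variables are below `ℓ`. -/
def Com.Below : Com k → ℕ → Prop
  | .setU _ φ, ℓ => φ.Below (ℓ + 1)
  | .setT _ φ, ℓ => φ.Below (ℓ + 3)
  | .seq c c', ℓ => c.Below ℓ ∧ c'.Below ℓ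
  | .loop c, ℓ => c.Below (ℓ + 1)

/-- The degree of a polynomial that bounds the running time. -/
def Com.deg : Com k → ℕ
  | .setU _ φ => φ.depth + 1
  | .setT _ φ => φ.depth + 3
  | .seq c c' => max c.deg c'.deg
  | .loop c => c.deg + 1

theorem Com.cmd (c : Com k) : ∀ {ℓ : ℕ} {d : ℝ}, c.Below ℓ → (c.deg : ℝ) ≤ d →
    Cmd (𝒢 := 𝒢) ℓ (fun I ρ S => c.run ℓ I ρ S) d := by
  induction c with
  | setU r φ =>
    intro ℓ d h hd
    simp only [deg, Nat.cast_add, Nat.cast_one] at hd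
    exact EvalF.assignU (pu := true) (φ.evalF h (by linarith)) r
  | setT r φ =>
    intro ℓ d h hd
    simp only [deg, Nat.cast_add, Nat.cast_ofNat] at hd
    exact EvalF.assignT (pu := true) (φ.evalF h (by linarith)) r
  | seq c c' ih ih' =>
    intro ℓ d h hd
    simp only [deg, Nat.cast_max, max_le_iff] at hd
    exact (ih h.1 hd.1).seq (ih' h.2 hd.2)
  | loop c ih =>
    intro ℓ d h hd
    simp only [deg, Nat.cast_add, Nat.cast_one] at hd
    exact Cmd.for (ih h (by linarith))

theorem foldl_finRange_induction {α : Type*} {n : ℕ} {f : α → Fin n → α} {a : α}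
    {J : ℕ → α → Prop} (h0 : J 0 a) (hs : ∀ (v : Fin n) a, J v a → J (v + 1) (f a v)) :
    J n ((List.finRange n).foldl f a) := by
  have : ∀ m ≤ n, J m (((List.finRange n).take m).foldl f a) := by
    intro m
    induction m with
    | zero => intro _; simpa using h0
    | succ m ih =>
      intro hm
      rw [List.take_add_one]
      simpa [show m < n from hm] using hs ⟨m, hm⟩ _ (ih (by omega))
  have h := this n le_rfl
  rwa [List.take_of_length_le (by simp)] at h

theorem Com.run_loop {ℓ : ℕ} {I : Input 𝒢 k} {ρ : ℕ → Fin I.n} {S : Store I.n} {c : Com k}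
    (J : ℕ → Store I.n → Prop) (h0 : J 0 S) (hs : ∀ (v : Fin I.n) S, J v S →
      J (v + 1) (c.run (ℓ + 1) I (Function.update ρ ℓ v) S)) :
    J I.n ((Com.loop c).run ℓ I ρ S) :=
  foldl_finRange_induction h0 hs

/-! ## Programs for the problem -/

/-- The store before anything has been computed. -/
def Store.init (n : ℕ) : Store n := ⟨fun _ _ => False, fun _ _ _ _ => False⟩

/-- Add `n` times the register `a` to register `r`. -/
def mulP (k r a : ℕ) : Prog :=
  .seq (block [.const (rB k) 0, .const r 0, .add (rA k) 0 (rB k)])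
    (.loop (rA k) (block [.add r r a, .sub (rA k) (rA k) (rOne k)]))

theorem Halts.mul {n : ℕ} (G : SimpleGraph (Fin n)) {r a : ℕ} {σ : State} (h0 : σ.reg 0 = n)
    (h1 : σ.reg (rOne k) = 1) (hr : r ≠ 0 ∧ r ≠ rOne k ∧ r ≠ rA k ∧ r ≠ rB k)
    (ha : a ≠ r ∧ a ≠ rA k ∧ a ≠ rB k) :
    Halts G (mulP k r a) σ (4 * n + 5) fun σ' => σ'.mem = σ.mem ∧ σ'.reg r = n * σ.reg a ∧
      ∀ q, q ≠ r → q ≠ rA k → q ≠ rB k → σ'.reg q = σ.reg q := by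
  refine Halts.seq (T₁ := 4) (T₂ := n * (3 + 1) + 1) (Halts.block _ (by norm_num) ?_) (by linarith)
  let Inv : ℕ → State → Prop := fun j σ' => σ'.mem = σ.mem ∧ σ'.reg (rA k) = j ∧
    σ'.reg r + j * σ.reg a = n * σ.reg a ∧
    ∀ q, q ≠ r → q ≠ rA k → q ≠ rB k → σ'.reg q = σ.reg q
  refine (Halts.countdown (G := G) (T := 3) Inv (fun j σ' h => h.2.1) ?_ n _ ?_).mono le_rfl ?_
  · rintro j σ' ⟨hm, hA, hs, hq⟩
    refine Halts.block _ (by norm_num) ⟨hm, ?_, ?_, fun q h1 h2 h3 => ?_⟩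
    · simp [State.setReg_reg, hA, hr.2.2.1.symm, hr.2.1.symm, hq (rOne k), h1]
    · simp [State.setReg_reg, hr.2.2.1, hq a ha.1 ha.2.1 ha.2.2]
      rw [Nat.succ_mul] at hs
      omega
    · simp [State.setReg_reg, h1, h2, hq q h1 h2 h3]
  · refine ⟨rfl, ?_, ?_, fun q h1 h2 h3 => ?_⟩
    · simp [State.setReg_reg, h0, hr.1.symm, show (0 : ℕ) ≠ rB k by simp [rSys], hr.2.2.2.symm]
    · simp [State.setReg_reg, hr.2.2.1]
    · simp [State.setReg_reg, h1, h2, h3]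
  · rintro σ' ⟨hm, -, hs, hq⟩
    exact ⟨hm, by simpa using hs, hq⟩

/-- A complete program computes the constants `n ^ 2` and `n ^ 3` by repeated addition, prepares the
store by a command, and evaluates one predicate. The assumption `1 ≤ d` pays for the additions; `1 ≤
k` supplies a vertex and thereby a valuation to start from. -/
theorem solvable_of_cmd {d : ℝ} (hk : 1 ≤ k) (hd : 1 ≤ d) {c : Com k} (hc : c.Below 0)
    (hcd : (c.deg : ℝ) ≤ d)
    (h : EvalF (𝒢 := 𝒢) false 0 (fun I S ρ => S = c.run 0 I ρ (Store.init I.n))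
      (fun I _ _ => I.W.HasSolution) d) :
    IDPSolvableInTime 𝒢 k fun n => (n : ℝ) ^ d := by
  obtain ⟨h0, p₁, C₁, hC₁, h₁⟩ := c.cmd (𝒢 := 𝒢) hc hcd
  obtain ⟨-, p₂, C₂, hC₂, h₂⟩ := h
  refine ⟨.seq (.op (.const (rOne k) 1)) (.seq (mulP k (rSq k) 0) (.seq (mulP k (rCu k) (rSq k))
    (.seq p₁ (.seq p₂ (.ite (rRes k) (.op (.const 0 1)) (.op (.const 0 0))))))), C₁ + C₂ + 21,
    fun n G hG W => ?_⟩
  let I : Input 𝒢 k := ⟨n, G, hG, W⟩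
  let ρ : ℕ → Fin I.n := fun _ => W.s ⟨0, hk⟩
  have hn : 1 ≤ n := I.one_le ρ
  have hn1 : (1 : ℝ) ≤ n := by exact_mod_cast hn
  have hX : (n : ℝ) ≤ (n : ℝ) ^ d := by
    simpa using Real.rpow_le_rpow_of_exponent_le hn1 hd
  change Halts G _ _ _ fun σ => σ.reg 0 = 1 ↔ W.HasSolution
  refine Halts.seq (T₁ := 1) (T₂ := (4 * n + 5) + ((4 * n + 5) + (C₁ * (n : ℝ) ^ d +
    (C₂ * (n : ℝ) ^ d + 2)))) (Halts.op le_rfl ?_) (by nlinarith)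
  set σ₀ := (Op.const (rOne k) 1).exec G (initialState W) with hσ₀
  have hin : ∀ q ≤ 2 * k, σ₀.reg q = (initialState W).reg q := fun q hq =>
    State.setReg_ne _ _ (by simp only [rSys]; omega)
  have h00 : σ₀.reg 0 = n := (hin 0 (by omega)).trans (initialState_reg_zero W)
  have hone : σ₀.reg (rOne k) = 1 := State.setReg_self ..
  refine Halts.seq ((Halts.mul G h00 hone (by simp [rSys]) (by simp [rSys])).mono le_rfl ?_) le_rfl
  rintro σ₁ ⟨hm₁, hr₁, hq₁⟩
  refine Halts.seq ((Halts.mul G ((hq₁ 0 (by simp [rSys]) (by simp [rSys]) (by simp [rSys])).trans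
    h00) ((hq₁ _ (by simp) (by simp) (by simp)).trans hone) (by simp [rSys]) (by simp)).mono
    le_rfl ?_) le_rfl
  rintro σ₂ ⟨hm₂, hr₂, hq₂⟩
  have hq : ∀ q ≤ 2 * k, σ₂.reg q = (initialState W).reg q := by
    intro q hq
    rw [hq₂ q (by simp only [rSys]; omega) (by simp only [rSys]; omega)
      (by simp only [rSys]; omega), hq₁ q (by simp only [rSys]; omega)
      (by simp only [rSys]; omega) (by simp only [rSys]; omega), hin q hq]
  have hmem : ∀ x, σ₂.mem x = 0 := fun x => by rw [hm₂, hm₁]; rfl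
  have hsq : σ₂.reg (rSq k) = n * n := by
    rw [hq₂ _ (by simp) (by simp) (by simp), hr₁, h00]
  have hrep : Rep 0 I (Store.init I.n) ρ σ₂ := by
    refine ⟨(hq 0 (by omega)).trans (initialState_reg_zero W),
      fun i => (hq _ (by omega)).trans (initialState_reg_src W i),
      fun i => (hq _ (by omega)).trans (initialState_reg_tgt W i), ?_, hsq, ?_, by simp,
      fun R i => by simp [hmem, Store.init], fun R i j l => by simp [hmem, Store.init],
      fun a => by simp [hmem]⟩
    · rw [hq₂ _ (by simp) (by simp) (by simp), hq₁ _ (by simp) (by simp) (by simp), hone]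
    · have : σ₁.reg (rSq k) = n * n := by rw [hr₁, h00]
      rw [hr₂, this]
      exact (mul_assoc _ _ _).symm
  refine Halts.seq ((h₁ I _ ρ σ₂ hrep).mono le_rfl ?_) le_rfl
  rintro σ₃ ⟨-, hrep₃⟩
  refine Halts.seq ((h₂ I _ ρ σ₃ hrep₃ rfl).mono le_rfl ?_) le_rfl
  rintro σ₄ ⟨-, hres⟩
  refine Halts.ite (T := 1) (fun hne => Halts.op le_rfl ?_) (fun hz => Halts.op le_rfl ?_)
    (by norm_num)
  · simpa using hres.1 hne
  · simpa using fun h => hres.2 h hz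

end RAM

namespace RAM

variable {𝒢 : GraphClass} {k : ℕ}

/-! ## Some commands -/

section
variable {ℓ : ℕ} {I : Input 𝒢 k} {ρ : ℕ → Fin I.n} {S : Store I.n}

/-- The vertex `a` is a terminal. -/
def Fml.terminal (a : Term k) : Fml k :=
  (List.finRange k).foldr (fun j φ => .or (.or (.eq a (.src j)) (.eq a (.tgt j))) φ) (.neg .tr)

theorem Fml.sat_terminal {a : Term k} : (Fml.terminal a).sat ℓ I S ρ ↔
    a.val I ρ ∈ Set.range I.W.s ∪ Set.range I.W.t := by
  have : ∀ L : List (Fin k), (L.foldr (fun j φ => Fml.or (.or (.eq a (.src j)) (.eq a (.tgt j))) φ)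
      (.neg .tr)).sat ℓ I S ρ ↔ ∃ j ∈ L, a.val I ρ = I.W.s j ∨ a.val I ρ = I.W.t j := by
    intro L
    induction L with
    | nil => simp [sat]
    | cons j L ih => simp [sat, ih, Term.val]
  rw [terminal, this]
  simp only [List.mem_finRange, true_and, Set.mem_union, Set.mem_range, exists_or, eq_comm]

theorem Fml.below_terminal {a : Term k} (h : a.Below ℓ) : (Fml.terminal a).Below ℓ := by
  have : ∀ L : List (Fin k), (L.foldr (fun j φ => Fml.or (.or (.eq a (.src j)) (.eq a (.tgt j))) φ)
      (.neg .tr)).Below ℓ := by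
    intro L
    induction L with
    | nil => trivial
    | cons j L ih => exact ⟨⟨⟨h, trivial⟩, h, trivial⟩, ih⟩
  exact this _

theorem Fml.depth_terminal {a : Term k} : (Fml.terminal a).depth = 0 := by
  have : ∀ L : List (Fin k), (L.foldr (fun j φ => Fml.or (.or (.eq a (.src j)) (.eq a (.tgt j))) φ)
      (.neg .tr)).depth = 0 := by
    intro L
    induction L with
    | nil => rfl
    | cons j L ih => simp [depth, ih]
  exact this _

theorem Store.setU_setU {n : ℕ} (S : Store n) (r : ℕ) (X Y : Fin n → Prop) :
    (S.setU r X).setU r Y = S.setU r Y := by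
  simp [Store.setU]

theorem Store.setT_setT {n : ℕ} (S : Store n) (r : ℕ) (X Y : Fin n → Fin n → Fin n → Prop) :
    (S.setT r X).setT r Y = S.setT r Y := by
  simp [Store.setT]

theorem Store.setU_eq_self {n : ℕ} (S : Store n) (r : ℕ) : S.setU r (S.u r) = S := by
  simp [Store.setU]

/-- Select in relation `r` the first vertex of relation `q`. -/
def Com.first (ℓ r q : ℕ) : Com k :=
  .setU r (.and (.u q (.var ℓ)) (.neg (.ex (.and (.lt (.var (ℓ + 1)) (.var ℓ))
    (.u q (.var (ℓ + 1)))))))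

theorem Com.run_first (r q : ℕ) : ∃ X : Fin I.n → Prop,
    (Com.first ℓ r q).run ℓ I ρ S = S.setU r X ∧ (∀ v, X v → S.u q v) ∧
      (∀ v w, X v → X w → v = w) ∧ ((∃ v, S.u q v) → ∃ v, X v) := by
  classical
  refine ⟨fun v => S.u q v ∧ ∀ w < v, ¬ S.u q w, ?_, fun v h => h.1, fun v w hv hw => ?_, ?_⟩
  · simp [first, run, Fml.sat, Term.val]
  · rcases lt_trichotomy v w with h | h | h
    · exact absurd hv.1 (hw.2 v h)
    · exact h
    · exact absurd hw.1 (hv.2 w h)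
  · rintro ⟨v, hv⟩
    obtain ⟨m, hm, hmin⟩ := Finset.exists_minimal
      (s := Finset.univ.filter fun v => S.u q v) ⟨v, by simpa using hv⟩
    simp only [Finset.mem_filter, Finset.mem_univ, true_and] at hm hmin
    exact ⟨m, hm, fun w hw hwq => absurd (hmin hwq hw.le) (not_le.2 hw)⟩

/-- Repeat `n` times: add to relation `r` the vertices that satisfy `φ`. -/
def Com.grow (ℓ r : ℕ) (φ : Fml k) : Com k :=
  .loop (.setU r (.or (.u r (.var (ℓ + 1))) φ))

/-- Each pass either adds a vertex or finds the relation closed, and a closed relation does not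
change any more; so `n` passes reach closure. No monotonicity of `F` is required. Properties that
should survive the growth are passed as `J`. -/
theorem Com.run_grow {r : ℕ} {φ : Fml k} (F : (Fin I.n → Prop) → Fin I.n → Prop)
    (hF : ∀ X ρ, φ.sat (ℓ + 2) I (S.setU r X) ρ ↔ F X (ρ (ℓ + 1)))
    (J : (Fin I.n → Prop) → Prop) (h0 : J (S.u r)) (hJ : ∀ X, J X → J fun v => X v ∨ F X v) :
    ∃ X, (Com.grow ℓ r φ).run ℓ I ρ S = S.setU r X ∧ J X ∧ ∀ v, F X v → X v := by
  let card : (Fin I.n → Prop) → ℕ := fun X => {v | X v}.ncard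
  obtain ⟨X, hX, hJX, hor⟩ := Com.run_loop (ℓ := ℓ) (I := I) (ρ := ρ) (S := S)
    (c := .setU r (.or (.u r (.var (ℓ + 1))) φ)) (fun i S' => ∃ X, S' = S.setU r X ∧ J X ∧
      ((∀ v, F X v → X v) ∨ i ≤ card X)) ⟨S.u r, (S.setU_eq_self r).symm, h0, .inr (Nat.zero_le _)⟩
    (by
      rintro v _ ⟨X, rfl, hX, hor⟩
      refine ⟨fun v => X v ∨ F X v, ?_, hJ X hX, ?_⟩
      · simp [run, Fml.sat, Term.val, hF, Store.setU_setU]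
      by_cases hcl : ∀ v, F X v → X v
      · have : (fun v => X v ∨ F X v) = X := funext fun v => propext ⟨fun h => h.elim id (hcl v), .inl⟩
        rw [this]; exact .inl hcl
      · have hc := hor.resolve_left hcl
        push Not at hcl
        obtain ⟨w, hw, hwX⟩ := hcl
        refine .inr (lt_of_le_of_lt hc ?_)
        refine Set.ncard_lt_ncard ⟨fun v hv => .inl hv, fun h => hwX (h (.inr hw))⟩
          (Set.toFinite _))
  refine ⟨X, hX, hJX, hor.elim id fun hn v _ => ?_⟩
  have : {v | X v} = Set.univ := by
    refine Set.eq_of_subset_of_ncard_le (Set.subset_univ _) ?_ (Set.toFinite _)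
    simpa [Set.ncard_univ] using hn
  exact this.symm.subset (Set.mem_univ v)

/-- Close relation `r` under adjacency within relation `q`. -/
def Com.close (ℓ r q : ℕ) : Com k :=
  .grow ℓ r (.and (.u q (.var (ℓ + 1))) (.ex (.and (.u r (.var (ℓ + 2)))
    (.adj (.var (ℓ + 2)) (.var (ℓ + 1))))))

theorem Com.run_close {r q : ℕ} (hrq : q ≠ r) (hS : ∀ v, S.u r v → S.u q v) :
    (Com.close ℓ r q).run ℓ I ρ S =
      S.setU r fun v => ∃ s, S.u r s ∧ Conn I.G {x | S.u q x} s v := by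
  obtain ⟨X, hX, ⟨h1, h2⟩, h3⟩ := Com.run_grow (ℓ := ℓ) (I := I) (ρ := ρ) (S := S) (r := r)
    (φ := .and (.u q (.var (ℓ + 1))) (.ex (.and (.u r (.var (ℓ + 2)))
      (.adj (.var (ℓ + 2)) (.var (ℓ + 1))))))
    (fun X v => S.u q v ∧ ∃ b, X b ∧ I.G.Adj b v)
    (by intro X ρ; simp [Fml.sat, Term.val, hrq])
    (fun X => (∀ v, S.u r v → X v) ∧ ∀ v, X v → ∃ s, S.u r s ∧ Conn I.G {x | S.u q x} s v)
    ⟨fun _ h => h, fun v hv => ⟨v, hv, .refl (hS v hv)⟩⟩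
    (by
      rintro X ⟨h1, h2⟩
      refine ⟨fun v hv => .inl (h1 v hv), ?_⟩
      rintro v (hv | ⟨hv, b, hb, hbv⟩)
      · exact h2 v hv
      · obtain ⟨s, hs, hsb⟩ := h2 b hb
        exact ⟨s, hs, hsb.tail hbv hv⟩)
  rw [close, hX]
  congr 1
  funext v
  refine propext ⟨h2 v, ?_⟩
  rintro ⟨s, hs, hsv⟩
  exact hsv.ind (p := X) (h1 s hs) fun a b _ hab hb ha => h3 b ⟨hb, a, ha, hab⟩

/-- Compute in the ternary relation `r` the relation of being connected within the sets described
by `ψ`. -/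
def Com.warshall (ℓ r : ℕ) (ψ : ℕ → ℕ → Fml k) : Com k :=
  .seq (.setT r (.and (.and (ψ ℓ (ℓ + 1)) (ψ ℓ (ℓ + 2)))
    (.or (.eq (.var (ℓ + 1)) (.var (ℓ + 2))) (.adj (.var (ℓ + 1)) (.var (ℓ + 2))))))
    (.loop (.setT r (.or (.t r (ℓ + 1) (ℓ + 2) (ℓ + 3))
      (.and (.t r (ℓ + 1) (ℓ + 2) ℓ) (.t r (ℓ + 1) ℓ (ℓ + 3))))))

/-- After the pivots below `i`, the relation can be composed at every vertex below `i`. Finally it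
can be composed at all vertices; as it contains the edges, it then contains every connection.
Soundness holds because `Conn` is transitive. -/
theorem Com.run_warshall {r : ℕ} {ψ : ℕ → ℕ → Fml k} (R : Fin I.n → Set (Fin I.n))
    (hψ : ∀ ℓ i j ρ, (ψ i j).sat ℓ I S ρ ↔ ρ j ∈ R (ρ i)) :
    (Com.warshall ℓ r ψ).run ℓ I ρ S = S.setT r fun x a b => Conn I.G (R x) a b := by
  set S₁ := S.setT r fun x a b => (a ∈ R x ∧ b ∈ R x) ∧ (a = b ∨ I.G.Adj a b) with hS₁
  have h1 : (Com.warshall ℓ r ψ).run ℓ I ρ S = (Com.loop (.setT r (.or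
      (.t r (ℓ + 1) (ℓ + 2) (ℓ + 3)) (.and (.t r (ℓ + 1) (ℓ + 2) ℓ)
        (.t r (ℓ + 1) ℓ (ℓ + 3)))))).run ℓ I ρ S₁ := by
    rw [warshall, run]
    congr 1
    simp [run, Fml.sat, Term.val, hψ, hS₁]
  rw [h1]
  obtain ⟨X, hX, hbase, hsound, htr⟩ := Com.run_loop (ℓ := ℓ) (I := I) (ρ := ρ) (S := S₁)
    (c := .setT r (.or (.t r (ℓ + 1) (ℓ + 2) (ℓ + 3)) (.and (.t r (ℓ + 1) (ℓ + 2) ℓ)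
      (.t r (ℓ + 1) ℓ (ℓ + 3))))) (fun i S' => ∃ X, S' = S.setT r X ∧
      (∀ x a b, S₁.t r x a b → X x a b) ∧ (∀ x a b, X x a b → Conn I.G (R x) a b) ∧
      ∀ x a b (w : Fin I.n), (w : ℕ) < i → X x a w → X x w b → X x a b)
    (by
      refine ⟨_, rfl, fun x a b h => by simpa [hS₁] using h, ?_, fun _ _ _ _ h => by omega⟩
      rintro x a b ⟨⟨ha, hb⟩, rfl | hab⟩
      · exact .refl ha
      · exact .of_adj ha hab hb)
    (by
      rintro z _ ⟨X, rfl, hbase, hsound, htr⟩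
      refine ⟨fun x a b => X x a b ∨ (X x a z ∧ X x z b), ?_, fun x a b h => .inl (hbase x a b h),
        ?_, ?_⟩
      · simp [run, Fml.sat, Store.setT_setT, add_assoc]
      · rintro x a b (h | ⟨h, h'⟩)
        · exact hsound x a b h
        · exact (hsound _ _ _ h).trans (hsound _ _ _ h')
      · intro x a b w hw
        rcases Nat.lt_succ_iff_lt_or_eq.1 hw with hw | hw
        · rintro (h | ⟨h, h'⟩) (g | ⟨g, g'⟩)
          · exact .inl (htr x a b w hw h g)
          · exact .inr ⟨htr x a z w hw h g, g'⟩
          · exact .inr ⟨h, htr x z b w hw h' g⟩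
          · exact .inr ⟨h, g'⟩
        · obtain rfl : w = z := Fin.ext hw
          rintro (h | ⟨h, h'⟩) (g | ⟨g, g'⟩)
          exacts [.inr ⟨h, g⟩, .inr ⟨h, g'⟩, .inr ⟨h, g⟩, .inr ⟨h, g'⟩])
  rw [hX]
  congr 1
  funext x a b
  refine propext ⟨hsound x a b, fun hc => ?_⟩
  refine hc.ind (p := fun b => X x a b) (hbase _ _ _ ?_) fun c d hac hcd hd ih =>
    htr x a d c c.2 ih (hbase _ _ _ ?_)
  · simpa [hS₁] using hc.1
  · simpa [hS₁] using ⟨⟨hac.mem_right, hd⟩, Or.inr hcd⟩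

end

end RAM

/-! ### Hubs: the sets from which separators are read off -/

/-- A set of vertices of `W` from whose complement in `W` a clique separator can be read off. -/
def Hub {V : Type*} (G : SimpleGraph V) (W H : Set V) : Prop :=
  (Unseparated G W H ∧ (∀ d ∈ W, Attached G W H d → d ∈ H) ∧
    ∃ x ∈ H, ∃ y ∈ H, x ≠ y ∧ ¬ G.Adj x y) ∨
  (∃ u ∈ W, (∃ v ∈ W, v ∈ far G u) ∧ H = W \ far G u ∧ ∀ x y, ¬ Seed G W u x y) ∨
  (H = W ∧ ∀ u ∈ W, ∀ v ∈ W, v ≠ u → G.Adj u v)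

/-- The three forms are a closed unseparated set, the closed neighbourhood of a vertex when there is
no seed, and all of a complete `W`. In the last form nothing lies outside of the hub. -/
theorem Hub.cut {V : Type*} {G : SimpleGraph V} {W H : Set V} (h : Hub G W H) {v : V}
    (hv : v ∈ W \ H) :
    Cut G W v (comp G (W \ H) v) (boundary G W (comp G (W \ H) v)) := by
  rcases h with ⟨h1, h2, h3⟩ | ⟨u, hu, -, rfl, h⟩ | ⟨rfl, -⟩
  · exact Cut.of_closed h1.subset hv h2 h3
  · refine Cut.of_nbhd hu ⟨hv.1, ?_⟩ h
    by_contra hf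
    exact hv.2 ⟨hv.1, hf⟩
  · exact absurd hv.1 hv.2

/-- If the hub is all of `W`, the second form cannot occur, since it comes with a vertex that is far
from `u`. The other two forms are unseparated. -/
theorem Hub.unseparated {V : Type*} {G : SimpleGraph V} {W H : Set V} (h : Hub G W H)
    (hv : ∀ v ∈ W, v ∈ H) : Unseparated G W W := by
  rcases h with ⟨h1, h2, h3⟩ | ⟨u, hu, ⟨v, hv', hf⟩, rfl, h⟩ | ⟨rfl, h⟩
  · obtain rfl := h1.subset.antisymm hv
    exact h1
  · exact absurd hf (hv v hv').2
  · exact .of_complete h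

namespace RAM

variable {𝒢 : GraphClass} {k : ℕ}

/-! ## Searching for a clique separator

Unary relations: `0` the set `W`, `1` whether the instance is split, `2`, `3`, `4` the parts `A`,
`K`, `B` of the splitting, `5` the terminals, `6` to `11` candidates and choice of a seed, `12` the
hub, `13`, `14` candidates and choice of a vertex that is not adjacent to all others, `15` the
complement of the hub in `W`, `16` a component `A` of it, `17` its boundary `K`, `18` the complement
of `K`, `19` the component of this complement that contains `A`, `20` the remaining vertices, `21`
and `22` whether `19` and `20` contain two terminals.

Ternary relations: `0` and `1` auxiliary, `2` links, `3` reachability outside of `W`, `4` ports. -/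

/-- Compute the links. -/
def Com.links (ℓ : ℕ) : Com k :=
  .seq (.warshall ℓ 0 fun i j => .and (.u 0 (.var j)) (.and (.neg (.eq (.var j) (.var i)))
    (.neg (.adj (.var i) (.var j)))))
  (.seq (.setT 1 (.ex (.and (.adj (.var (ℓ + 1)) (.var (ℓ + 3))) (.t 0 ℓ (ℓ + 3) (ℓ + 2)))))
  (.setT 2 (.ex (.and (.t 1 ℓ (ℓ + 1) (ℓ + 3)) (.adj (.var (ℓ + 3)) (.var (ℓ + 2)))))))

/-- The three variables form a seed. -/
def Fml.seed (i j l : ℕ) : Fml k :=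
  .and (.u 0 (.var i)) (.and (.and (.u 0 (.var j)) (.adj (.var i) (.var j)))
    (.and (.and (.u 0 (.var l)) (.adj (.var i) (.var l))) (.and (.neg (.eq (.var j) (.var l)))
      (.and (.neg (.adj (.var j) (.var l))) (.t 2 i j l)))))

/-- Choose a seed. -/
def Com.pick (ℓ : ℕ) : Com k :=
  .seq (.setU 6 (.ex (.ex (.seed ℓ (ℓ + 1) (ℓ + 2))))) (.seq (.first ℓ 7 6)
  (.seq (.setU 8 (.ex (.and (.u 7 (.var (ℓ + 1))) (.ex (.seed (ℓ + 1) ℓ (ℓ + 2))))))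
  (.seq (.first ℓ 9 8) (.seq (.setU 10 (.ex (.and (.u 7 (.var (ℓ + 1)))
    (.ex (.and (.u 9 (.var (ℓ + 2))) (.seed (ℓ + 1) (ℓ + 2) ℓ))))))
  (.seq (.first ℓ 11 10) (.setU 12 (.or (.u 9 (.var ℓ)) (.u 11 (.var ℓ)))))))))

/-- Grow the hub. -/
def Com.attach (ℓ : ℕ) : Com k :=
  .grow ℓ 12 (.and (.u 0 (.var (ℓ + 1))) (.ex (.ex (.and (.and (.u 12 (.var (ℓ + 2)))
    (.u 12 (.var (ℓ + 3)))) (.and (.neg (.eq (.var (ℓ + 2)) (.var (ℓ + 3))))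
    (.and (.neg (.adj (.var (ℓ + 2)) (.var (ℓ + 3)))) (.and (.adj (.var (ℓ + 1)) (.var (ℓ + 2)))
    (.or (.adj (.var (ℓ + 1)) (.var (ℓ + 3))) (.t 2 (ℓ + 2) (ℓ + 1) (ℓ + 3))))))))))

/-- Determine the hub if there is no seed. -/
def Com.seedless (ℓ : ℕ) : Com k :=
  .seq (.setU 13 (.and (.u 0 (.var ℓ)) (.ex (.and (.u 0 (.var (ℓ + 1)))
    (.and (.neg (.eq (.var (ℓ + 1)) (.var ℓ))) (.neg (.adj (.var ℓ) (.var (ℓ + 1)))))))))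
  (.seq (.first ℓ 14 13) (.setU 12 (.or (.and (.ex (.u 11 (.var (ℓ + 1)))) (.u 12 (.var ℓ)))
    (.and (.neg (.ex (.u 11 (.var (ℓ + 1))))) (.and (.u 0 (.var ℓ))
      (.neg (.ex (.and (.u 14 (.var (ℓ + 1))) (.and (.neg (.eq (.var ℓ) (.var (ℓ + 1))))
        (.neg (.adj (.var (ℓ + 1)) (.var ℓ))))))))))))

/-- Determine the separator and its two sides. -/
def Com.sides (ℓ : ℕ) : Com k :=
  .seq (.setU 15 (.and (.u 0 (.var ℓ)) (.neg (.u 12 (.var ℓ)))))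
  (.seq (.first ℓ 16 15) (.seq (.setU 19 (.u 16 (.var ℓ))) (.seq (.close ℓ 16 15)
  (.seq (.setU 17 (.and (.u 0 (.var ℓ)) (.and (.neg (.u 16 (.var ℓ)))
    (.ex (.and (.u 16 (.var (ℓ + 1))) (.adj (.var (ℓ + 1)) (.var ℓ)))))))
  (.seq (.setU 18 (.neg (.u 17 (.var ℓ)))) (.seq (.close ℓ 19 18)
  (.setU 20 (.and (.neg (.u 17 (.var ℓ))) (.neg (.u 19 (.var ℓ)))))))))))

section
variable {ℓ : ℕ} {I : Input 𝒢 k} {ρ : ℕ → Fin I.n} {S : Store I.n}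

theorem Com.run_links : ((Com.links ℓ).run ℓ I ρ S).u = S.u ∧
    ∀ u x y, ((Com.links ℓ).run ℓ I ρ S).t 2 u x y ↔ Link I.G ({v | S.u 0 v} ∩ far I.G u) x y := by
  have h := Com.run_warshall (ℓ := ℓ) (I := I) (ρ := ρ) (S := S) (r := 0)
    (ψ := fun i j => .and (.u 0 (.var j)) (.and (.neg (.eq (.var j) (.var i)))
    (.neg (.adj (.var i) (.var j))))) (fun u => {v | S.u 0 v} ∩ far I.G u) (by
      intro ℓ i j ρ
      simp [Fml.sat, Term.val, far])
  simp only [links, run, h]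
  refine ⟨by simp, fun u x y => ?_⟩
  simp only [Fml.sat, Term.val, Link, Store.setT_self]
  simp
  constructor
  · rintro ⟨b, ⟨a, h1, h2⟩, h3⟩; exact ⟨a, h1, b, h2, h3⟩
  · rintro ⟨a, h1, b, h2, h3⟩; exact ⟨b, ⟨a, h1, h2⟩, h3⟩


theorem Fml.sat_seed {i j l : ℕ}
    (hS : ∀ u x y, S.t 2 u x y ↔ Link I.G ({v | S.u 0 v} ∩ far I.G u) x y) :
    (Fml.seed i j l).sat ℓ I S ρ ↔ Seed I.G {v | S.u 0 v} (ρ i) (ρ j) (ρ l) := by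
  simp only [seed, sat, Term.val, hS]
  exact ⟨fun ⟨a, b, c, d, e, f⟩ => ⟨a, b, c, d, e, f⟩, fun ⟨a, b, c, d, e, f⟩ => ⟨a, b, c, d, e, f⟩⟩

/-- The three vertices of a seed are selected one after the other, each as the first one that can be
completed. Relation `11` holds the last of them and thereby records whether there is a seed at all.
-/
theorem Com.run_pick (hS : ∀ u x y, S.t 2 u x y ↔ Link I.G ({v | S.u 0 v} ∩ far I.G u) x y) :
    (∀ j < 6, ((Com.pick ℓ).run ℓ I ρ S).u j = S.u j) ∧ ((Com.pick ℓ).run ℓ I ρ S).t = S.t ∧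
      ((∃ u x y, Seed I.G {v | S.u 0 v} u x y ∧ ((Com.pick ℓ).run ℓ I ρ S).u 11 y ∧
        ∀ v, ((Com.pick ℓ).run ℓ I ρ S).u 12 v ↔ v = x ∨ v = y) ∨
      ((∀ u x y, ¬ Seed I.G {v | S.u 0 v} u x y) ∧
        (∀ y, ¬ ((Com.pick ℓ).run ℓ I ρ S).u 11 y) ∧
        ∀ v, ¬ ((Com.pick ℓ).run ℓ I ρ S).u 12 v)) := by
  have hseed : ∀ (S' : Store I.n) ℓ ρ i j l, S'.u 0 = S.u 0 → S'.t = S.t →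
      ((Fml.seed i j l).sat ℓ I S' ρ ↔ Seed I.G {v | S.u 0 v} (ρ i) (ρ j) (ρ l)) := by
    intro S' ℓ ρ i j l h0 ht
    rw [Fml.sat_seed (by rw [h0, ht]; exact hS), h0]
  simp only [pick, run]
  set S₁ := S.setU 6 _ with h₁
  obtain ⟨X, hX, hX1, hX2, hX3⟩ := Com.run_first (ℓ := ℓ) (I := I) (ρ := ρ) (S := S₁) 7 6
  rw [hX]
  set S₂ := (S₁.setU 7 X).setU 8 _ with h₂
  obtain ⟨Y, hY, hY1, hY2, hY3⟩ := Com.run_first (ℓ := ℓ) (I := I) (ρ := ρ) (S := S₂) 9 8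
  rw [hY]
  set S₃ := (S₂.setU 9 Y).setU 10 _ with h₃
  obtain ⟨Z, hZ, hZ1, hZ2, hZ3⟩ := Com.run_first (ℓ := ℓ) (I := I) (ρ := ρ) (S := S₃) 11 10
  rw [hZ]
  have e₁ : ∀ u, S₁.u 6 u ↔ ∃ x y, Seed I.G {v | S.u 0 v} u x y := by
    simp [h₁, Fml.sat, hseed, add_assoc]
  have u₁ : S₁.u 0 = S.u 0 ∧ S₁.t = S.t := by simp [h₁]
  have u₂ : S₂.u 0 = S.u 0 ∧ S₂.t = S.t ∧ S₂.u 7 = X := by simp [h₂, u₁]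
  have e₂ : ∀ x, S₂.u 8 x ↔ ∃ u, X u ∧ ∃ y, Seed I.G {v | S.u 0 v} u x y := by
    simp [h₂, Fml.sat, Term.val, hseed, u₁, add_assoc]
  have e₃ : ∀ y, S₃.u 10 y ↔ ∃ u, X u ∧ ∃ x, Y x ∧ Seed I.G {v | S.u 0 v} u x y := by
    simp [h₃, Fml.sat, Term.val, hseed, u₂, add_assoc]
  have e₄ : S₃.u 9 = Y := by simp [h₃]
  refine ⟨fun j hj => ?_, by simp [h₃, h₂, h₁], ?_⟩
  · have : ∀ i, 6 ≤ i → j ≠ i := fun i hi h => by omega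
    simp [h₃, h₂, h₁, this]
  by_cases hex : ∃ u x y, Seed I.G {v | S.u 0 v} u x y
  · left
    obtain ⟨u, hu⟩ := hX3 (hex.imp fun u hu => (e₁ u).2 hu)
    obtain ⟨x₀, y₀, h0⟩ := (e₁ u).1 (hX1 u hu)
    obtain ⟨x, hx⟩ := hY3 ⟨x₀, (e₂ x₀).2 ⟨u, hu, y₀, h0⟩⟩
    obtain ⟨u', hu', y₁, h1⟩ := (e₂ x).1 (hY1 x hx)
    obtain ⟨y, hy⟩ := hZ3 ⟨y₁, (e₃ y₁).2 ⟨u', hu', x, hx, h1⟩⟩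
    obtain ⟨u'', -, x', hx', h2⟩ := (e₃ y).1 (hZ1 y hy)
    obtain rfl := hY2 x x' hx hx'
    refine ⟨u'', x, y, h2, by simp [hy], fun v => ?_⟩
    simp only [Store.setU_self, Fml.sat, Term.val, Function.update_self, ne_eq, 
      Nat.reduceEqDiff, not_false_eq_true, Store.setU_ne, e₄]
    exact or_congr ⟨fun h => hY2 v x h hx, fun h => h ▸ hx⟩ ⟨fun h => hZ2 v y h hy, fun h => h ▸ hy⟩
  · right
    push Not at hex
    have hY0 : ∀ x, ¬ Y x := fun x hx => by
      obtain ⟨u, -, y, h⟩ := (e₂ x).1 (hY1 x hx)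
      exact hex _ _ _ h
    have hZ0 : ∀ y, ¬ Z y := fun y hy => by
      obtain ⟨u, -, x, -, h⟩ := (e₃ y).1 (hZ1 y hy)
      exact hex _ _ _ h
    refine ⟨hex, by simpa using hZ0, fun v => ?_⟩
    simp [Fml.sat, Term.val, e₄, hY0, hZ0]

/-- By `Unseparated.insert_attached` every pass of the growth keeps the hub unseparated. Without a
seed the growth starts from the empty set; its outcome is then ignored by `Com.seedless`. -/
theorem Com.run_attach (hS : ∀ u x y, S.t 2 u x y ↔ Link I.G ({v | S.u 0 v} ∩ far I.G u) x y)
    (h12 : Unseparated I.G {v | S.u 0 v} {v | S.u 12 v}) :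
    ∃ X, (Com.attach ℓ).run ℓ I ρ S = S.setU 12 X ∧ (∀ v, S.u 12 v → X v) ∧
      Unseparated I.G {v | S.u 0 v} {v | X v} ∧
      ∀ d, S.u 0 d → Attached I.G {v | S.u 0 v} {v | X v} d → X d := by
  obtain ⟨X, hX, ⟨h1, h2⟩, h3⟩ := Com.run_grow (ℓ := ℓ) (I := I) (ρ := ρ) (S := S) (r := 12)
    (φ := (.and (.u 0 (.var (ℓ + 1))) (.ex (.ex (.and (.and (.u 12 (.var (ℓ + 2)))
    (.u 12 (.var (ℓ + 3)))) (.and (.neg (.eq (.var (ℓ + 2)) (.var (ℓ + 3))))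
    (.and (.neg (.adj (.var (ℓ + 2)) (.var (ℓ + 3)))) (.and (.adj (.var (ℓ + 1)) (.var (ℓ + 2)))
    (.or (.adj (.var (ℓ + 1)) (.var (ℓ + 3))) (.t 2 (ℓ + 2) (ℓ + 1) (ℓ + 3)))))))))))
    (fun X d => S.u 0 d ∧ Attached I.G {v | S.u 0 v} {v | X v} d)
    (by
      intro X ρ
      simp only [Fml.sat, Term.val, hS, Attached, add_assoc, Store.setU_self, Store.setU_t]
      simp [and_assoc])
    (fun X => (∀ v, S.u 12 v → X v) ∧ Unseparated I.G {v | S.u 0 v} {v | X v}) ⟨fun _ h => h, h12⟩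
    (by
      rintro X ⟨h1, h2⟩
      exact ⟨fun v hv => .inl (h1 v hv), h2.insert_attached
        (D := {d | S.u 0 d ∧ Attached I.G {v | S.u 0 v} {v | X v} d}) fun d hd => hd⟩)
  exact ⟨X, hX, h1, h2, fun d h0 hd => h3 d ⟨h0, hd⟩⟩

/-- With a seed the grown hub is kept. Without one, the first vertex of `W` with a non-neighbour in
`W` provides the second form of a hub; if there is no such vertex, `W` is complete and becomes the
hub itself. -/
theorem Com.run_seedless (h : (∃ v, S.u 11 v) → Hub I.G {v | S.u 0 v} {v | S.u 12 v})
    (h' : (∀ v, ¬ S.u 11 v) → ∀ u x y, ¬ Seed I.G {v | S.u 0 v} u x y) :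
    (∀ j < 6, ((Com.seedless ℓ).run ℓ I ρ S).u j = S.u j) ∧
      Hub I.G {v | S.u 0 v} {v | ((Com.seedless ℓ).run ℓ I ρ S).u 12 v} := by
  simp only [seedless, run]
  set S₁ := S.setU 13 _ with h₁
  obtain ⟨X, hX, hX1, hX2, hX3⟩ := Com.run_first (ℓ := ℓ) (I := I) (ρ := ρ) (S := S₁) 14 13
  rw [hX]
  have e₁ : ∀ u, S₁.u 13 u ↔ S.u 0 u ∧ ∃ v, S.u 0 v ∧ v ∈ far I.G u := by
    simp [h₁, Fml.sat, Term.val, far]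
  refine ⟨fun j hj => ?_, ?_⟩
  · have : ∀ i, 6 ≤ i → j ≠ i := fun i hi h => by omega
    simp [h₁, this]
  have e₂ : ∀ j, j ≠ 13 → S₁.u j = S.u j := fun j hj => by simp [h₁, hj]
  have e₃ : {v | ((S₁.setU 14 X).setU 12 fun v => ((Fml.or (.and (.ex (.u 11 (.var (ℓ + 1))))
      (.u 12 (.var ℓ))) (.and (.neg (.ex (.u 11 (.var (ℓ + 1))))) (.and (.u 0 (.var ℓ))
      (.neg (.ex (.and (.u 14 (.var (ℓ + 1))) (.and (.neg (.eq (.var ℓ) (.var (ℓ + 1))))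
        (.neg (.adj (.var (ℓ + 1)) (.var ℓ))))))))))).sat (ℓ + 1) I (S₁.setU 14 X)
          (Function.update ρ ℓ v)).u 12 v} =
      {v | ((∃ y, S.u 11 y) ∧ S.u 12 v) ∨ (¬ ∃ y, S.u 11 y) ∧ S.u 0 v ∧
        ¬ ∃ u, X u ∧ v ∈ far I.G u} := by
    ext v
    simp [Fml.sat, Term.val, e₂, far]
  rw [e₃]
  by_cases h11 : ∃ y, S.u 11 y
  · simpa [h11] using h h11
  · simp only [h11, false_and, not_false_eq_true, true_and, false_or]
    push Not at h11
    have hno := h' h11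
    by_cases hu : ∃ u, X u
    · obtain ⟨u, hu⟩ := hu
      obtain ⟨hu0, v, hv0, hv⟩ := (e₁ u).1 (hX1 u hu)
      refine .inr (.inl ⟨u, hu0, ⟨v, hv0, hv⟩, ?_, hno u⟩)
      ext w
      refine and_congr_right fun _ => not_congr ⟨?_, fun hw => ⟨u, hu, hw⟩⟩
      rintro ⟨u', hu', hw⟩
      rwa [hX2 u u' hu hu']
    · refine .inr (.inr ⟨?_, fun u hu0 v hv0 hne => ?_⟩)
      · ext w
        simp only [Set.mem_ofPred_eq, and_iff_left_iff_imp]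
        rintro - ⟨u, hu', -⟩
        exact hu ⟨u, hu'⟩
      · by_contra hna
        exact hu (hX3 ⟨u, (e₁ u).2 ⟨hu0, v, hv0, hne, hna⟩⟩)

/-- The component of the first vertex outside of the hub is computed twice: within the rest of `W`,
which gives `A` and its boundary `K`, and then in all of `G \ K`, because terminals are counted in
the whole graph. If the hub is all of `W`, both come out empty. -/
theorem Com.run_sides (h : Hub I.G {v | S.u 0 v} {v | S.u 12 v}) :
    (∀ j < 6, ((Com.sides ℓ).run ℓ I ρ S).u j = S.u j) ∧
      ((Unseparated I.G {v | S.u 0 v} {v | S.u 0 v} ∧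
        ∀ v, ¬ ((Com.sides ℓ).run ℓ I ρ S).u 16 v ∧ ¬ ((Com.sides ℓ).run ℓ I ρ S).u 19 v) ∨
      ∃ v, Cut I.G {v | S.u 0 v} v {v | ((Com.sides ℓ).run ℓ I ρ S).u 16 v}
          {v | ((Com.sides ℓ).run ℓ I ρ S).u 17 v} ∧
        {v | ((Com.sides ℓ).run ℓ I ρ S).u 19 v} =
          comp I.G {v | ((Com.sides ℓ).run ℓ I ρ S).u 17 v}ᶜ v ∧
        {v | ((Com.sides ℓ).run ℓ I ρ S).u 20 v} = {x | ¬ ((Com.sides ℓ).run ℓ I ρ S).u 17 x ∧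
          ¬ ((Com.sides ℓ).run ℓ I ρ S).u 19 x}) := by
  simp only [sides, run]
  set S₁ := S.setU 15 _ with h₁
  obtain ⟨X, hX, hX1, hX2, hX3⟩ := Com.run_first (ℓ := ℓ) (I := I) (ρ := ρ) (S := S₁) 16 15
  rw [hX]
  set S₂ := (S₁.setU 16 X).setU 19 _ with h₂
  have e15 : ∀ v, S₁.u 15 v ↔ S.u 0 v ∧ ¬ S.u 12 v := by simp [h₁, Fml.sat, Term.val]
  have e15' : S₂.u 15 = S₁.u 15 := by simp [h₂]
  have e16 : S₂.u 16 = X := by simp [h₂]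
  have e19 : S₂.u 19 = X := by
    funext v; simp [h₂, Fml.sat, Term.val]
  rw [Com.run_close (S := S₂) (by omega) (fun v hv => by
    rw [e15']; rw [e16] at hv; exact hX1 v hv)]
  rw [e16, e15']
  set A : Fin I.n → Prop := fun v => ∃ s, X s ∧ Conn I.G {x | S₁.u 15 x} s v with hA
  set S₃ := ((S₂.setU 16 A).setU 17 _).setU 18 _ with h₃
  have e17 : ∀ v, S₃.u 17 v ↔ S.u 0 v ∧ ¬ A v ∧ ∃ a, A a ∧ I.G.Adj a v := by
    simp [h₃, h₂, h₁, Fml.sat, Term.val]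
  have e18 : ∀ v, S₃.u 18 v ↔ ¬ S₃.u 17 v := by
    simp [h₃, Fml.sat, Term.val]
  have e19' : S₃.u 19 = X := by simp [h₃, e19]
  have hXA : ∀ v, X v → A v := fun v hv => ⟨v, hv, .refl (hX1 v hv)⟩
  rw [Com.run_close (S := S₃) (by omega) (fun v hv => by
    rw [e18, e17]; rw [e19'] at hv; exact fun h => h.2.1 (hXA v hv)), e19']
  have e16' : S₃.u 16 = A := by simp [h₃]
  have e0 : ∀ j < 6, S₃.u j = S.u j := fun j hj => by
    have : ∀ i, 6 ≤ i → j ≠ i := fun i hi h => by omega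
    simp [h₃, h₂, h₁, this]
  refine ⟨fun j hj => ?_, ?_⟩
  · have : ∀ i, 6 ≤ i → j ≠ i := fun i hi h => by omega
    simp [e0 j hj, this]
  simp only [Fml.sat, Term.val, Function.update_self, Store.setU_self, ne_eq,
    Nat.reduceEqDiff, not_false_eq_true, Store.setU_ne, e16']
  have e15s : {x | S₁.u 15 x} = {v | S.u 0 v} \ {v | S.u 12 v} := Set.ext e15
  have e18s : {x | S₃.u 18 x} = {v | S₃.u 17 v}ᶜ := Set.ext e18
  by_cases hv : ∃ v, X v
  · right
    obtain ⟨v, hv⟩ := hv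
    have hone : ∀ (U : Set (Fin I.n)), {w | ∃ s, X s ∧ Conn I.G U s w} = comp I.G U v := by
      intro U
      ext w
      refine ⟨?_, fun h => ⟨v, hv, h⟩⟩
      rintro ⟨s, hs, h⟩
      rwa [hX2 s v hs hv] at h
    have hAs : {w | A w} = comp I.G ({v | S.u 0 v} \ {v | S.u 12 v}) v := by
      rw [← e15s]; exact hone _
    have hKs : {w | S₃.u 17 w} = boundary I.G {v | S.u 0 v} {w | A w} := by
      ext w; exact e17 w
    refine ⟨v, ?_, ?_, trivial⟩
    · rw [hKs, hAs]
      exact h.cut ((e15 v).1 (hX1 v hv))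
    · rw [← e18s]; exact hone _
  · left
    refine ⟨h.unseparated fun v h0 => ?_, fun v => ⟨?_, ?_⟩⟩
    · by_contra hv12
      exact hv (hX3 ⟨v, (e15 v).2 ⟨h0, hv12⟩⟩)
    · rintro ⟨s, hs, -⟩; exact hv ⟨s, hs⟩
    · rintro ⟨s, hs, -⟩; exact hv ⟨s, hs⟩

end

end RAM

/-! ### Cuts as separations of the whole graph, and counting terminals -/

/-- Without using `K` one cannot leave `A`, whereas `rest` provides a vertex outside. In the main
loop this excludes that a cut is found after `W` has become unseparated. -/
theorem Cut.not_unseparated {V : Type*} {G : SimpleGraph V} {W A K : Set V} {v : V}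
    (h : Cut G W v A K) : ¬ Unseparated G W W := by
  intro hu
  obtain ⟨b, hbW, hbA, hbK⟩ := h.rest
  have hc := hu.conn K h.clique v (h.subA h.memA) b hbW (Set.disjoint_left.1 h.disj h.memA) hbK
  exact hbA (hc.mem_of_closed h.memA fun a ha c hc hac =>
    (h.nbr a ha c hc.1 hac).resolve_right hc.2).mem_right.2

theorem Cut.separation {V : Type*} {G : SimpleGraph V} {W A K : Set V} {v : V}
    (h : Cut G W v A K) :
    Separation G (comp G Kᶜ v) K {x | x ∉ K ∧ x ∉ comp G Kᶜ v} where
  cover x := by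
    by_cases h1 : x ∈ K
    · exact .inr (.inl h1)
    · by_cases h2 : x ∈ comp G Kᶜ v
      · exact .inl h2
      · exact .inr (.inr ⟨h1, h2⟩)
  disjAK := Set.disjoint_left.2 fun _ hx hxK => Conn.mem_right hx hxK
  disjAB := Set.disjoint_left.2 fun _ hx hx' => hx'.2 hx
  disjBK := Set.disjoint_left.2 fun _ hx hxK => hx.1 hxK
  clique := h.clique
  nonadj _ ha _ hb hab := hb.2 (comp_nbr ha hab hb.1)

/-- The set contains two of the vertices in `T`. -/
def HasTwo {V : Type*} (T R : Set V) : Prop := ∃ v w, v ≠ w ∧ (v ∈ T ∧ v ∈ R) ∧ w ∈ T ∧ w ∈ R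

theorem eq_of_not_hasTwo {V : Type*} {T R : Set V} (h : ¬ HasTwo T R) {v w : V} (hv : v ∈ T)
    (hw : w ∈ T) (hv' : v ∈ R) (hw' : w ∈ R) : v = w := by
  by_contra hne
  exact h ⟨v, w, hne, ⟨hv, hv'⟩, hw, hw'⟩

theorem HasTwo.exists_index {V ι : Type*} {s t : ι → V} {R : Set V}
    (h : HasTwo (Set.range s ∪ Set.range t) R) :
    ∃ a b : ι ⊕ ι, a ≠ b ∧ Sum.elim s t a ∈ R ∧ Sum.elim s t b ∈ R := by
  obtain ⟨v, w, hne, ⟨hv, hv'⟩, hw, hw'⟩ := h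
  have key : ∀ v ∈ Set.range s ∪ Set.range t, ∃ a : ι ⊕ ι, Sum.elim s t a = v := by
    rintro v (⟨i, rfl⟩ | ⟨i, rfl⟩)
    exacts [⟨.inl i, rfl⟩, ⟨.inr i, rfl⟩]
  obtain ⟨a, rfl⟩ := key v hv
  obtain ⟨b, rfl⟩ := key w hw
  exact ⟨a, b, fun h => hne (by rw [h]), hv', hw'⟩

namespace RAM

variable {𝒢 : GraphClass} {k : ℕ}

/-! ### The loop that searches and reduces -/

/-- Search for a clique separator of the subgraph induced by `W`. -/
def Com.search (ℓ : ℕ) : Com k :=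
  .seq (.links ℓ) (.seq (.pick ℓ) (.seq (.attach ℓ) (.seq (.seedless ℓ) (.sides ℓ))))

/-- Relation `R` contains two terminals. -/
def Fml.two (ℓ R : ℕ) : Fml k :=
  .ex (.ex (.and (.neg (.eq (.var (ℓ + 1)) (.var (ℓ + 2))))
    (.and (.and (.u 5 (.var (ℓ + 1))) (.u R (.var (ℓ + 1))))
      (.and (.u 5 (.var (ℓ + 2))) (.u R (.var (ℓ + 2)))))))

/-- Use the separator: remove one of its sides from `W`, or keep it if both sides contain two
terminals. -/
def Com.reduce (ℓ : ℕ) : Com k :=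
  .seq (.setU 21 (.two ℓ 19)) (.seq (.setU 22 (.two ℓ 20))
  (.seq (.setU 2 (.or (.and (.u 1 (.var ℓ)) (.u 2 (.var ℓ)))
    (.and (.neg (.u 1 (.var ℓ))) (.u 19 (.var ℓ)))))
  (.seq (.setU 3 (.or (.and (.u 1 (.var ℓ)) (.u 3 (.var ℓ)))
    (.and (.neg (.u 1 (.var ℓ))) (.u 17 (.var ℓ)))))
  (.seq (.setU 4 (.or (.and (.u 1 (.var ℓ)) (.u 4 (.var ℓ)))
    (.and (.neg (.u 1 (.var ℓ))) (.u 20 (.var ℓ)))))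
  (.seq (.setU 0 (.and (.u 0 (.var ℓ)) (.or (.u 1 (.var ℓ))
    (.or (.and (.neg (.u 21 (.var ℓ))) (.neg (.u 16 (.var ℓ))))
    (.or (.and (.u 21 (.var ℓ)) (.and (.neg (.u 22 (.var ℓ))) (.or (.u 16 (.var ℓ))
      (.u 17 (.var ℓ))))) (.and (.u 21 (.var ℓ)) (.u 22 (.var ℓ))))))))
  (.setU 1 (.or (.u 1 (.var ℓ)) (.and (.u 21 (.var ℓ)) (.u 22 (.var ℓ))))))))))

/-- The computation that precedes the calls of the given programs. -/
def Com.prepare : Com k :=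
  .seq (.setU 0 .tr) (.seq (.setU 5 (.terminal (.var 0)))
  (.seq (.loop (.seq (.search 1) (.reduce 1)))
  (.seq (.warshall 0 3 fun _ j => .neg (.u 0 (.var j)))
  (.setT 4 (.and (.u 0 (.var 1)) (.or (.eq (.var 1) (.var 0))
    (.ex (.and (.t 3 0 0 3) (.adj (.var 3) (.var 1))))))))))

section
variable {ℓ : ℕ} {I : Input 𝒢 k} {ρ : ℕ → Fin I.n} {S : Store I.n}

theorem Com.run_search :
    (∀ j < 6, ((Com.search ℓ).run ℓ I ρ S).u j = S.u j) ∧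
      ((Unseparated I.G {v | S.u 0 v} {v | S.u 0 v} ∧
        ∀ v, ¬ ((Com.search ℓ).run ℓ I ρ S).u 16 v ∧ ¬ ((Com.search ℓ).run ℓ I ρ S).u 19 v) ∨
      ∃ v, Cut I.G {v | S.u 0 v} v {v | ((Com.search ℓ).run ℓ I ρ S).u 16 v}
          {v | ((Com.search ℓ).run ℓ I ρ S).u 17 v} ∧
        {v | ((Com.search ℓ).run ℓ I ρ S).u 19 v} =
          comp I.G {v | ((Com.search ℓ).run ℓ I ρ S).u 17 v}ᶜ v ∧
        {v | ((Com.search ℓ).run ℓ I ρ S).u 20 v} = {x | ¬ ((Com.search ℓ).run ℓ I ρ S).u 17 x ∧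
          ¬ ((Com.search ℓ).run ℓ I ρ S).u 19 x}) := by
  obtain ⟨hu, ht⟩ := Com.run_links (ℓ := ℓ) (I := I) (ρ := ρ) (S := S)
  simp only [search, run]
  set S₁ := (Com.links ℓ).run ℓ I ρ S
  rw [← hu] at ht
  obtain ⟨hu₂, ht₂, hor⟩ := Com.run_pick (ℓ := ℓ) (ρ := ρ) ht
  set S₂ := (Com.pick ℓ).run ℓ I ρ S₁
  rw [← hu₂ 0 (by omega)] at ht hor
  rw [← ht₂] at ht
  have h12 : Unseparated I.G {v | S₂.u 0 v} {v | S₂.u 12 v} := by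
    rcases hor with ⟨u, x, y, hs, -, h⟩ | ⟨-, -, h⟩
    · have : {v | S₂.u 12 v} = {x, y} := Set.ext fun v => h v
      rw [this]; exact hs.unseparated
    · exact ⟨fun v hv => absurd hv (h v), fun K _ x hx => absurd hx (h x)⟩
  obtain ⟨X, hX, hX1, hX2, hX3⟩ := Com.run_attach (ℓ := ℓ) (ρ := ρ) ht h12
  rw [hX]
  obtain ⟨hu₄, hhub⟩ := Com.run_seedless (ℓ := ℓ) (I := I) (ρ := ρ) (S := S₂.setU 12 X) (by
      simp only [ne_eq, OfNat.zero_ne_ofNat, Nat.reduceEqDiff, not_false_eq_true, Store.setU_ne,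
        Store.setU_self]
      rintro ⟨y, hy⟩
      rcases hor with ⟨u, x, y, hs, -, h⟩ | ⟨-, hno, -⟩
      · exact .inl ⟨hX2, hX3, x, hX1 x ((h x).2 (.inl rfl)), y, hX1 y ((h y).2 (.inr rfl)),
          hs.ne, hs.nonadj⟩
      · exact absurd hy (hno y)) (by
      simp only [ne_eq, OfNat.zero_ne_ofNat, Nat.reduceEqDiff, not_false_eq_true, Store.setU_ne]
      intro hno
      rcases hor with ⟨u, x, y, -, hy, -⟩ | ⟨h, -⟩
      · exact absurd hy (hno y)
      · exact h)
  set S₄ := (Com.seedless ℓ).run ℓ I ρ (S₂.setU 12 X)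
  rw [← hu₄ 0 (by omega)] at hhub
  obtain ⟨hu₅, h⟩ := Com.run_sides (ℓ := ℓ) (ρ := ρ) hhub
  have e : ∀ j < 6, S₄.u j = S.u j := fun j hj => by
    rw [hu₄ j hj, Store.setU_ne _ _ _ _ (by omega), hu₂ j hj, hu]
  refine ⟨fun j hj => (hu₅ j hj).trans (e j hj), ?_⟩
  rw [← e 0 (by omega)]
  exact h

theorem Fml.sat_two {R : ℕ} : (Fml.two ℓ R).sat (ℓ + 1) I S ρ ↔
    HasTwo {v | S.u 5 v} {v | S.u R v} := by
  simp [two, sat, Term.val, HasTwo, add_assoc]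

/-- The terminals of an instance. -/
def Input.terminals (I : Input 𝒢 k) : Set (Fin I.n) := Set.range I.W.s ∪ Set.range I.W.t

/-- A separation with two terminals on both sides has been found. -/
structure Split (I : Input 𝒢 k) (S : Store I.n) : Prop where
  flag : ∀ v, S.u 1 v
  sep : Separation I.G {v | S.u 2 v} {v | S.u 3 v} {v | S.u 4 v}
  left : HasTwo I.terminals {v | S.u 2 v}
  right : HasTwo I.terminals {v | S.u 4 v}

/-- The progress measure is the size of `W`. Deleting `A` loses the vertex `v₀`, and keeping only `A
∪ K` loses the vertex given by `rest`; so each round either deletes a vertex, or has found `W`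
unseparated, or sets the flag. Once the flag is set, the separation is frozen. -/
theorem Com.run_reduce_step {i : ℕ} (h5 : {v | S.u 5 v} = I.terminals)
    (h : Split I S ∨ (∀ v, ¬ S.u 1 v) ∧ Reduced I.G I.terminals {v | S.u 0 v} ∧
      (Unseparated I.G {v | S.u 0 v} {v | S.u 0 v} ∨ {v | S.u 0 v}.ncard + i ≤ I.n)) :
    let S' := (Com.seq (.search ℓ) (.reduce ℓ)).run ℓ I ρ S
    {v | S'.u 5 v} = I.terminals ∧ (Split I S' ∨ (∀ v, ¬ S'.u 1 v) ∧
      Reduced I.G I.terminals {v | S'.u 0 v} ∧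
      (Unseparated I.G {v | S'.u 0 v} {v | S'.u 0 v} ∨ {v | S'.u 0 v}.ncard + (i + 1) ≤ I.n)) := by
  intro S'
  obtain ⟨hu, hor⟩ := Com.run_search (ℓ := ℓ) (I := I) (ρ := ρ) (S := S)
  set S₁ := (Com.search ℓ).run ℓ I ρ S with hS₁
  have hS' : S' = (Com.reduce ℓ).run ℓ I ρ S₁ := rfl
  have e5 : S'.u 5 = S.u 5 := by simp [hS', reduce, run, hu]
  have e1 : ∀ v, S'.u 1 v ↔ S.u 1 v ∨ HasTwo I.terminals {v | S₁.u 19 v} ∧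
      HasTwo I.terminals {v | S₁.u 20 v} := by
    simp [hS', reduce, run, Fml.sat_two, Fml.sat, Term.val, hu, h5]
  have e2 : ∀ v, S'.u 2 v ↔ S.u 1 v ∧ S.u 2 v ∨ ¬ S.u 1 v ∧ S₁.u 19 v := by
    simp [hS', reduce, run, Fml.sat, Term.val, hu]
  have e3 : ∀ v, S'.u 3 v ↔ S.u 1 v ∧ S.u 3 v ∨ ¬ S.u 1 v ∧ S₁.u 17 v := by
    simp [hS', reduce, run, Fml.sat, Term.val, hu]
  have e4 : ∀ v, S'.u 4 v ↔ S.u 1 v ∧ S.u 4 v ∨ ¬ S.u 1 v ∧ S₁.u 20 v := by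
    simp [hS', reduce, run, Fml.sat, Term.val, hu]
  have e0 : ∀ v, S'.u 0 v ↔ S.u 0 v ∧ (S.u 1 v ∨ ¬ HasTwo I.terminals {v | S₁.u 19 v} ∧
      ¬ S₁.u 16 v ∨ HasTwo I.terminals {v | S₁.u 19 v} ∧
      ¬ HasTwo I.terminals {v | S₁.u 20 v} ∧ (S₁.u 16 v ∨ S₁.u 17 v) ∨
      HasTwo I.terminals {v | S₁.u 19 v} ∧ HasTwo I.terminals {v | S₁.u 20 v}) := by
    simp [hS', reduce, run, Fml.sat_two, Fml.sat, Term.val, hu, h5]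
  refine ⟨by rw [e5, h5], ?_⟩
  rcases h with h | ⟨hflag, hred, hsize⟩
  · left
    have a2 : S'.u 2 = S.u 2 := funext fun v => by simp [e2, h.flag]
    have a3 : S'.u 3 = S.u 3 := funext fun v => by simp [e3, h.flag]
    have a4 : S'.u 4 = S.u 4 := funext fun v => by simp [e4, h.flag]
    exact ⟨fun v => (e1 v).2 (.inl (h.flag v)), by rw [a2, a3, a4]; exact h.sep,
      by rw [a2]; exact h.left, by rw [a4]; exact h.right⟩
  simp only [hflag, false_or, false_and, not_false_eq_true, true_and] at e0 e1 e2 e3 e4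
  rcases hor with ⟨hun, hno⟩ | ⟨v₀, hcut, h19, h20⟩
  · right
    have hno19 : ¬ HasTwo I.terminals {v | S₁.u 19 v} := by
      rintro ⟨v, -, -, ⟨-, hv⟩, -⟩
      exact (hno v).2 hv
    have a0 : S'.u 0 = S.u 0 := funext fun v => by simp [e0, hno19, (hno v).1]
    refine ⟨by simp [e1, hno19], by rwa [a0], by rw [a0]; exact .inl hun⟩
  have hsz := hsize.resolve_left hcut.not_unseparated
  rw [h19, h20] at e0 e1
  have hB : {x | ¬ S₁.u 17 x ∧ ¬ S₁.u 19 x} =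
      -- Relation `20` is rewritten as the right side of `Cut.separation`.
      {x | x ∉ {v | S₁.u 17 v} ∧ x ∉ comp I.G {v | S₁.u 17 v}ᶜ v₀} := by rw [← h19]; rfl
  rw [hB] at h20 e0 e1
  by_cases hA : HasTwo I.terminals (comp I.G {v | S₁.u 17 v}ᶜ v₀)
  · by_cases hB : HasTwo I.terminals {x | x ∉ {v | S₁.u 17 v} ∧ x ∉ comp I.G {v | S₁.u 17 v}ᶜ v₀}
    · left
      have a2 : S'.u 2 = S₁.u 19 := funext fun v => propext (e2 v)
      have a3 : S'.u 3 = S₁.u 17 := funext fun v => propext (e3 v)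
      have a4 : S'.u 4 = S₁.u 20 := funext fun v => propext (e4 v)
      refine ⟨fun v => (e1 v).2 ⟨hA, hB⟩, ?_, ?_, ?_⟩
      · rw [a2, a3, a4, h19, h20]; exact hcut.separation
      · rwa [a2, h19]
      · rwa [a4, h20]
    · right
      have a0 : {v | S'.u 0 v} = {v | S₁.u 16 v} ∪ {v | S₁.u 17 v} := by
        ext v
        refine (e0 v).trans ⟨?_, fun h => ⟨h.elim (hcut.subA ·) (hcut.subK ·),
          .inr (.inl ⟨hA, hB, h⟩)⟩⟩
        rintro ⟨-, h | h | h⟩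
        exacts [absurd hA h.1, h.2.2, absurd h.2 hB]
      refine ⟨fun v h => hB ((e1 v).1 h).2, ?_, .inr ?_⟩
      · rw [a0]
        exact hcut.reduced_union hred fun s hs t ht h1 h2 h3 h4 =>
          eq_of_not_hasTwo hB hs ht ⟨h2, h1⟩ ⟨h4, h3⟩
      · refine le_trans ?_ hsz
        rw [a0]
        have : ({v | S₁.u 16 v} ∪ {v | S₁.u 17 v}).ncard < {v | S.u 0 v}.ncard := by
          obtain ⟨b, hb, hbA, hbK⟩ := hcut.rest
          exact Set.ncard_lt_ncard ⟨Set.union_subset hcut.subA hcut.subK,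
            fun h => (h hb).elim hbA hbK⟩ (Set.toFinite _)
        omega
  · right
    have a0 : {v | S'.u 0 v} = {v | S.u 0 v} \ {v | S₁.u 16 v} := by
      ext v
      simp [e0, hA]
    refine ⟨fun v => by simp [e1, hA], ?_, .inr ?_⟩
    · rw [a0]
      exact hcut.reduced_diff hred fun s hs t ht h1 h2 => eq_of_not_hasTwo hA hs ht h1 h2
    · refine le_trans ?_ hsz
      rw [a0]
      have : ({v | S.u 0 v} \ {v | S₁.u 16 v}).ncard < {v | S.u 0 v}.ncard :=
        Set.ncard_lt_ncard ⟨Set.sdiff_subset, fun h => (h (hcut.subA hcut.memA)).2 hcut.memA⟩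
          (Set.toFinite _)
      omega

/-- No further reduction of the vertex set is possible. -/
structure Final (I : Input 𝒢 k) (S : Store I.n) : Prop where
  flag : ∀ v, ¬ S.u 1 v
  reduced : Reduced I.G I.terminals {v | S.u 0 v}
  unseparated : Unseparated I.G {v | S.u 0 v} {v | S.u 0 v}
  ports : ∀ w a x, S.t 4 w a x ↔ a ∈ ports I.G {v | S.u 0 v} w

/-- If `W` had lost a vertex in every one of the `n` rounds, it would be empty, and the empty set is
unseparated as well. So after `n` rounds either the flag is set or no clique separates `W`. -/
theorem Com.run_prepare : let S := Com.prepare.run 0 I ρ (Store.init I.n)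
    Split I S ∨ Final I S := by
  intro S
  set S₁ := (Com.setU 5 (.terminal (.var 0))).run 0 I ρ
    ((Com.setU 0 .tr).run 0 I ρ (Store.init I.n)) with hS₁
  obtain ⟨h5, h⟩ := Com.run_loop (ℓ := 0) (I := I) (ρ := ρ) (S := S₁)
    (c := .seq (.search 1) (.reduce 1)) (fun i S => {v | S.u 5 v} = I.terminals ∧
      (Split I S ∨ (∀ v, ¬ S.u 1 v) ∧ Reduced I.G I.terminals {v | S.u 0 v} ∧
      (Unseparated I.G {v | S.u 0 v} {v | S.u 0 v} ∨ {v | S.u 0 v}.ncard + i ≤ I.n)))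
    (by
      have a0 : {v | S₁.u 0 v} = Set.univ := by
        ext v; simp [hS₁, run, Fml.sat]
      refine ⟨?_, .inr ⟨fun v => ?_, ?_, .inr ?_⟩⟩
      · ext v; simp [hS₁, run, Fml.sat_terminal, Term.val, Input.terminals]
      · simp [hS₁, run, Store.init]
      · rw [a0]; exact Reduced.univ _
      · simp [a0, Set.ncard_univ])
    (fun v S h => Com.run_reduce_step (ℓ := 1) h.1 h.2)
  set S₂ := (Com.loop (.seq (.search 1) (.reduce 1))).run 0 I ρ S₁ with hS₂
  have hwar := Com.run_warshall (ℓ := 0) (I := I) (ρ := ρ) (S := S₂) (r := 3)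
    (ψ := fun _ j => .neg (.u 0 (.var j))) (fun _ => {v | S₂.u 0 v}ᶜ) (by
      intro ℓ i j ρ
      simp [Fml.sat, Term.val])
  have hS : S = (Com.setT 4 (.and (.u 0 (.var 1)) (.or (.eq (.var 1) (.var 0))
    (.ex (.and (.t 3 0 0 3) (.adj (.var 3) (.var 1))))))).run 0 I ρ
      ((Com.warshall 0 3 fun _ j => .neg (.u 0 (.var j))).run 0 I ρ S₂) := rfl
  rw [hwar] at hS
  have hu : S.u = S₂.u := by simp [hS, run]
  have ht : ∀ w a x, S.t 4 w a x ↔ a ∈ ports I.G {v | S₂.u 0 v} w := by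
    simp [hS, run, Fml.sat, Term.val, ports]
  rcases h with h | ⟨h1, h2, h3⟩
  · left
    exact ⟨by rw [hu]; exact h.flag, by rw [hu]; exact h.sep, by rw [hu]; exact h.left,
      by rw [hu]; exact h.right⟩
  · right
    refine ⟨by rwa [hu], by rwa [hu], ?_, by rwa [hu]⟩
    rw [hu]
    refine h3.elim id fun h0 => ?_
    have : {v | S₂.u 0 v} = ∅ := by
      rw [← Set.ncard_eq_zero (Set.toFinite _)]; omega
    rw [this]
    exact ⟨subset_rfl, fun K _ x hx => absurd hx (Set.notMem_empty x)⟩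

end

theorem Com.below_prepare : (Com.prepare (k := k)).Below 0 := by
  simp [prepare, search, reduce, links, pick, attach, seedless, sides, warshall, first, close, grow,
    Below, Fml.Below, Term.Below, Fml.two, Fml.seed]
  exact Fml.below_terminal (by simp [Term.Below])

/-- The computation of the links, the reachability by `Com.warshall` and the growth of the hub cost
`n ^ 4`, and this is done in each of `n` rounds. -/
theorem Com.deg_prepare : (Com.prepare (k := k)).deg = 5 := by
  simp [prepare, search, reduce, links, pick, attach, seedless, sides, warshall, first, close, grow,
    deg, Fml.depth, Fml.two, Fml.seed, Fml.depth_terminal]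

end RAM

namespace RAM

variable {𝒢 : GraphClass} {k : ℕ}

/-! ## Finite combinations of predicates -/

section
variable {pu : Bool} {ℓ : ℕ} {P φ : Pred 𝒢 k} {d : ℝ}

theorem EvalF.const (hd : 0 ≤ d) (p : Prop) : EvalF pu ℓ P (fun _ _ _ => p) d := by
  by_cases hp : p
  · exact (EvalF.true hd).congr fun _ _ _ _ => by simp [hp]
  · exact (EvalF.false hd).congr fun _ _ _ _ => by simp [hp]

theorem EvalF.all {ι : Type*} [Finite ι] {φ : ι → Pred 𝒢 k} (hd : 0 ≤ d)
    (h : ∀ i, EvalF pu ℓ P (φ i) d) : EvalF pu ℓ P (fun I S ρ => ∀ i, φ i I S ρ) d := by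
  classical
  have := Fintype.ofFinite ι
  have key : ∀ F : Finset ι, EvalF pu ℓ P (fun I S ρ => ∀ i ∈ F, φ i I S ρ) d := by
    intro F
    induction F using Finset.induction_on with
    | empty => exact (EvalF.true hd).congr fun _ _ _ _ => by simp
    | insert i F _ ih =>
      exact ((h i).and (ih.pre fun _ _ _ h => h.1)).congr fun _ _ _ _ => by simp
  exact (key Finset.univ).congr fun _ _ _ _ => by simp

theorem EvalF.any {ι : Type*} [Finite ι] {φ : ι → Pred 𝒢 k} (hd : 0 ≤ d)
    (h : ∀ i, EvalF pu ℓ P (φ i) d) : EvalF pu ℓ P (fun I S ρ => ∃ i, φ i I S ρ) d :=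
  (EvalF.not (EvalF.all hd fun i => (h i).not)).congr fun _ _ _ _ => by push Not; rfl

/-- Distinguish the finitely many values of a function. -/
theorem EvalF.cases {ι : Type*} [Finite ι] (f : ∀ I : Input 𝒢 k, Store I.n → (ℕ → Fin I.n) → ι)
    (hd : 0 ≤ d) (hf : ∀ j, EvalF pu ℓ P (fun I S ρ => f I S ρ = j) d)
    (h : ∀ j, EvalF pu ℓ (fun I S ρ => P I S ρ ∧ f I S ρ = j) φ d) : EvalF pu ℓ P φ d :=
  (EvalF.any hd fun j => (hf j).and (h j)).congr fun _ _ _ _ => by simp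

theorem EvalF.iff_const {p : Prop} (h : EvalF pu ℓ P φ d) :
    EvalF pu ℓ P (fun I S ρ => φ I S ρ ↔ p) d := by
  by_cases hp : p
  · exact h.congr fun _ _ _ _ => by simp [hp]
  · exact h.not.congr fun _ _ _ _ => by simp [hp]

/-- A predicate that does not depend on the variables from `m` on, preceded by `m` quantifiers. -/
theorem EvalF.exs {m : ℕ} (hφ : ∀ I S (ρ ρ' : ℕ → Fin I.n), (∀ i < m, ρ i = ρ' i) →
    φ I S ρ → φ I S ρ') (hP : ∀ I S ρ ρ', P I S ρ → P I S ρ')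
    (h : EvalF pu m P φ (d - m)) : EvalF pu 0 P (fun I S _ => ∃ ρ, φ I S ρ) d := by
  have key : ∀ j ≤ m, EvalF pu (m - j) P
      (fun I S ρ => ∃ ρ', (∀ i < m - j, ρ' i = ρ i) ∧ φ I S ρ') (d - (m - j : ℕ)) := by
    intro j
    induction j with
    | zero =>
      intro _
      refine h.congr fun I S ρ _ => ⟨fun h => ⟨ρ, fun _ _ => rfl, h⟩, ?_⟩
      rintro ⟨ρ', hρ, h⟩
      exact hφ I S _ _ hρ h
    | succ j ih =>
      intro hj
      have hm : m - j = m - (j + 1) + 1 := by omega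
      have h := ih (by omega)
      rw [hm] at h
      refine (EvalF.ex (P' := P) (P := P) (h.mono ?_) fun I S ρ v h => hP _ _ _ _ h).congr
        fun I S ρ _ => ⟨?_, ?_⟩
      · push_cast; linarith
      · rintro ⟨v, ρ', hρ, h⟩
        refine ⟨ρ', fun i hi => ?_, h⟩
        rw [hρ i (by omega), Function.update_of_ne (by omega)]
      · rintro ⟨ρ', hρ, h⟩
        refine ⟨ρ' (m - (j + 1)), ρ', fun i hi => ?_, h⟩
        by_cases hi' : i = m - (j + 1)
        · subst hi'; simp
        · rw [Function.update_of_ne hi', hρ i (by omega)]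
  have := key m le_rfl
  rw [Nat.sub_self] at this
  exact (this.mono (by simp)).congr fun _ _ _ _ => by simp

end

/-! ## Calls of the given programs -/

section
variable {ℓ : ℕ} {P : Pred 𝒢 k} {c d : ℝ} {ψ : Fml k}

/-- The vertices that satisfy a formula at level `ℓ + 1`. -/
def Fml.set (ψ : Fml k) (ℓ : ℕ) (I : Input 𝒢 k) (S : Store I.n) (ρ : ℕ → Fin I.n) :
    Set (Fin I.n) := {v | ψ.sat (ℓ + 1) I S (Function.update ρ ℓ v)}

/-- The formula speaks about the variable `ℓ`, so a term is inserted by quantifying over the vertex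
equal to it instead of by substitution. -/
theorem EvalF.mem_set (hψ : ψ.Below (ℓ + 1)) (hψd : (ψ.depth : ℝ) + 1 ≤ d) {a : Term k}
    (ha : a.Below ℓ) : EvalF Bool.false ℓ P (fun I S ρ => a.val I ρ ∈ ψ.set ℓ I S ρ) d := by
  refine (Fml.evalF (.ex (.and (.eq (.var ℓ) a) ψ)) (ℓ := ℓ)
    ⟨⟨Nat.lt_succ_self ℓ, ha.mono (Nat.le_succ ℓ)⟩, hψ⟩ (by simpa [Fml.depth] using hψd)).congr
    fun I S ρ _ => ?_
  have e : ∀ v, (Term.var ℓ : Term k).val I (Function.update ρ ℓ v) = v := fun v =>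
    Function.update_self ..
  simp [Fml.sat, e, Term.val_update ha, Fml.set]

/-- The given program may be called only on legal instances, so legality is tested first. Terminals
outside of the set, and contacts between terminals of different pairs, make a solution impossible,
so the answer NO is right when the test fails. A pair with equal terminals would be illegal and yet
perhaps solvable; it is therefore excluded by the hypothesis `hne`. -/
theorem EvalF.solvable {𝒦 : GraphClass} {j : ℕ}
    (hsolve : IDPSolvableInTime 𝒦 j (fun n => (n : ℝ) ^ c)) (hc : 0 ≤ c) (hcd : c ≤ d)
    (hψ : ψ.Below (ℓ + 1)) (hψd : (ψ.depth : ℝ) + 1 ≤ d) {a b : Fin j → Term k}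
    (ha : ∀ i, (a i).Below ℓ) (hb : ∀ i, (b i).Below ℓ)
    (hne : ∀ I S ρ, P I S ρ → ∀ i, (a i).val I ρ ≠ (b i).val I ρ)
    (hmem : ∀ I S ρ, P I S ρ → ∀ (m : ℕ) (e : Fin m ↪ Fin I.n), Set.range e = ψ.set ℓ I S ρ →
      I.G.comap e ∈ 𝒦 m) :
    EvalF Bool.false ℓ P (fun I S ρ => SolvableOn I.G Set.univ (ψ.set ℓ I S ρ)
      (fun i => (a i).val I ρ) (fun i => (b i).val I ρ)) d := by
  have hd : 0 ≤ d := hc.trans hcd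
  have hor : EvalF Bool.false ℓ P (fun I S ρ => ∀ i, (a i).val I ρ ∈ ψ.set ℓ I S ρ ∧
      (b i).val I ρ ∈ ψ.set ℓ I S ρ ∧ ∀ i', i = i' ∨
      ¬ ((a i).val I ρ = (a i').val I ρ ∨ (a i).val I ρ = (b i').val I ρ ∨
        (b i).val I ρ = (b i').val I ρ ∨ I.G.Adj ((a i).val I ρ) ((a i').val I ρ) ∨
        I.G.Adj ((a i).val I ρ) ((b i').val I ρ) ∨ I.G.Adj ((b i).val I ρ) ((b i').val I ρ))) d :=
    EvalF.all hd fun i => (EvalF.mem_set hψ hψd (ha i)).and ((EvalF.mem_set hψ hψd (hb i)).and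
      (EvalF.all hd fun i' => (EvalF.const hd _).or (((EvalF.eq hd (ha i) (ha i')).or
      ((EvalF.eq hd (ha i) (hb i')).or ((EvalF.eq hd (hb i) (hb i')).or
      ((EvalF.adj hd (ha i) (ha i')).or ((EvalF.adj hd (ha i) (hb i')).or
      (EvalF.adj hd (hb i) (hb i'))))))).not)))
  refine (hor.and (EvalF.solve hsolve hc hcd (P' := fun _ _ _ => True)
    (ψ := fun I S ρ => ψ.sat (ℓ + 1) I S ρ) (ψ.evalF hψ (by linarith)) ha hb
    (fun _ _ _ _ _ => trivial) ?_)).congr ?_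
  · rintro I S ρ ⟨hp, h⟩
    refine ⟨fun i => (h i).1, fun i => (h i).2.1, ?_, fun i i' hii => ?_, hmem I S ρ hp⟩
    · have h' : ∀ i i', i ≠ i' → _ := fun i i' hii => ((h i).2.2 i').resolve_left hii
      push Not at h'
      rintro (i | i) (i' | i') hxy <;> simp only [Sum.elim_inl, Sum.elim_inr] at hxy
      · by_contra hii
        exact (h' i i' fun e => hii (by rw [e])).1 hxy
      · by_cases hii : i = i'
        · exact absurd (hii ▸ hxy) (hne I S ρ hp i)
        · exact absurd hxy (h' i i' hii).2.1
      · by_cases hii : i = i'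
        · exact absurd (hii ▸ hxy).symm (hne I S ρ hp i')
        · exact absurd hxy.symm (h' i' i (Ne.symm hii)).2.1
      · by_contra hii
        exact (h' i i' fun e => hii (by rw [e])).2.2.1 hxy
    · have h' := ((h i).2.2 i').resolve_left hii
      push Not at h'
      exact h'.2.2.2
  · rintro I S ρ hp
    refine ⟨fun h => h.2, fun h => ⟨fun i => ?_, h⟩⟩
    obtain ⟨X, h1, h2⟩ := h
    have hs : ∀ i, (a i).val I ρ ∈ X i := fun i => (h1 i trivial).2.1
    have ht : ∀ i, (b i).val I ρ ∈ X i := fun i => (h1 i trivial).2.mem_right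
    refine ⟨(h1 i trivial).1 (hs i), (h1 i trivial).1 (ht i), fun i' => ?_⟩
    by_cases hii : i = i'
    · exact .inl hii
    · have h3 := h2 i trivial i' trivial hii
      have e1 := h3 _ (hs i) _ (hs i')
      have e2 := h3 _ (hs i) _ (ht i')
      have e3 := h3 _ (ht i) _ (ht i')
      tauto

theorem exists_fin_embedding {m : ℕ} (J : Set (Fin m)) (hJ : J ≠ Set.univ) :
    ∃ j < m, ∃ f : Fin j ↪ Fin m, Set.range f = J := by
  refine ⟨Nat.card J, ?_, (Finite.equivFin J).symm.toEmbedding.trans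
    (Function.Embedding.subtype _), ?_⟩
  · simpa using Set.ncard_lt_ncard (Set.ssubset_univ_iff.2 hJ) (Set.toFinite _)
  · ext x
    refine ⟨?_, fun hx => ⟨Finite.equivFin J ⟨x, hx⟩,
      congrArg Subtype.val ((Finite.equivFin J).symm_apply_apply ⟨x, hx⟩)⟩⟩
    rintro ⟨i, rfl⟩
    exact ((Finite.equivFin J).symm i).2

theorem _root_.GraphClass.Hereditary.comap_mem {𝒢 : GraphClass} (h : 𝒢.Hereditary) {m n : ℕ}
    {G : SimpleGraph (Fin n)} (hG : G ∈ 𝒢 n) (e : Fin m ↪ Fin n) : G.comap e ∈ 𝒢 m :=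
  h m n _ G ⟨SimpleGraph.Embedding.comap e G⟩ hG

/-- Solve an instance with fewer pairs. -/
theorem EvalF.subproblem (hher : 𝒢.Hereditary) (hc : 0 ≤ c)
    (ih : ∀ m, 1 ≤ m → m < k → IDPSolvableInTime 𝒢 m (fun n => (n : ℝ) ^ (2 * (m : ℝ) + c)))
    (hd : 2 * ((k : ℝ) - 1) + c ≤ d) (hψ : ψ.Below (ℓ + 1)) (hψd : (ψ.depth : ℝ) + 1 ≤ d)
    (J : Set (Fin k)) {a b : Fin k → Term k} (ha : ∀ i, (a i).Below ℓ) (hb : ∀ i, (b i).Below ℓ)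
    (hne : ∀ I S ρ, P I S ρ → ∀ i ∈ J, (a i).val I ρ ≠ (b i).val I ρ) :
    EvalF Bool.false ℓ P (fun I S ρ => J ≠ Set.univ ∧ SolvableOn I.G J (ψ.set ℓ I S ρ)
      (fun i => (a i).val I ρ) (fun i => (b i).val I ρ)) d := by
  have h0 : 0 ≤ d := by
    have : (0 : ℝ) ≤ ψ.depth := by positivity
    linarith
  by_cases hJ : J = Set.univ
  -- The condition `J ≠ Set.univ` is part of the predicate, so no program for all `k` pairs is
  -- needed here.
  · exact (EvalF.false h0).congr fun _ _ _ _ => by simp [hJ]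
  obtain ⟨j, hj, f, rfl⟩ := exists_fin_embedding J hJ
  -- An instance without pairs is solvable; the induction hypothesis only begins with one pair.
  rcases Nat.eq_zero_or_pos j with rfl | hj0
  · refine (EvalF.true h0).congr fun _ _ _ _ => ⟨fun _ => ⟨hJ, fun _ => ∅, ?_, ?_⟩, fun _ => trivial⟩
    · rintro _ ⟨i, -⟩; exact i.elim0
    · rintro _ ⟨i, -⟩; exact i.elim0
  have hjk : (j : ℝ) ≤ (k : ℝ) - 1 := by
    rw [le_sub_iff_add_le]; exact_mod_cast hj
  refine (EvalF.solvable (ih j hj0 hj) (by positivity) (by linarith) hψ hψd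
    (a := fun i => a (f i)) (b := fun i => b (f i)) (fun i => ha _) (fun i => hb _)
    (fun I S ρ hp i => hne I S ρ hp _ ⟨i, rfl⟩) fun I S ρ _ m e _ => hher.comap_mem I.mem e).congr
    fun I S ρ _ => ?_
  rw [and_iff_right hJ]
  exact SolvableOn.reindex (G := I.G) f (s := fun i => (a i).val I ρ) (t := fun i => (b i).val I ρ)

end

theorem Input.ne (I : Input 𝒢 k) (i j : Fin k) : I.W.s i ≠ I.W.t j := fun h => by
  have := @I.W.distinct (.inl i) (.inr j) h
  simp at this

end RAM

namespace RAM

variable {𝒢 : GraphClass} {k : ℕ}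

theorem EvalF.ite {pu : Bool} {ℓ : ℕ} {P φ ψ : Pred 𝒢 k} {d : ℝ} (hψ : EvalF pu ℓ P ψ d)
    (h : EvalF pu ℓ (fun I S ρ => P I S ρ ∧ ψ I S ρ) φ d)
    (h' : EvalF pu ℓ (fun I S ρ => P I S ρ ∧ ¬ ψ I S ρ) φ d) : EvalF pu ℓ P φ d :=
  ((hψ.and h).or (hψ.not.and h')).congr fun _ _ _ _ => by tauto

/-! ## Dividing an instance along a separation -/

section
variable {c d : ℝ} {RA RK RB : ℕ} {P : Pred 𝒢 k}

theorem EvalF.touching_eq {ℓ : ℕ} (hd : 0 ≤ d) (J : Set (Fin k)) :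
    EvalF Bool.false ℓ P (fun I S _ => touching {v | S.u RB v} I.W.s I.W.t = J) d :=
  (EvalF.all hd fun i => ((EvalF.un hd RB (a := .src i) trivial).or
    (EvalF.un hd RB (a := .tgt i) trivial)).iff_const (p := i ∈ J)).congr
    fun _ _ _ _ => Set.ext_iff.symm

variable (hher : 𝒢.Hereditary) (hc : 0 ≤ c)
  (ih : ∀ m, 1 ≤ m → m < k → IDPSolvableInTime 𝒢 m (fun n => (n : ℝ) ^ (2 * (m : ℝ) + c)))
  (hk : 2 ≤ k) (hd : 2 * (k : ℝ) + c ≤ d)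

include hher hc ih hk hd

/-- Which pairs touch `B` depends on the instance, but the programs to be called depend on the
number of pairs. Hence one branch for each of the finitely many sets `J`. The two quantifiers for
`x` and `y` cost `n ^ 2`, and each call concerns at most `k - 1` pairs. -/
theorem EvalF.splitUncrossed : EvalF Bool.false 0 P (fun I S _ =>
    ((touching {v | S.u RB v} I.W.s I.W.t)ᶜ ≠ Set.univ ∧
      touching {v | S.u RB v} I.W.s I.W.t ≠ Set.univ) ∧
    SplitUncrossed I.G {v | S.u RA v} {v | S.u RK v} {v | S.u RB v} I.W.s I.W.t) d := by
  have hk' : (2 : ℝ) ≤ k := by exact_mod_cast hk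
  have h0 : 0 ≤ d := by linarith
  refine EvalF.cases (fun I S _ => touching {v | S.u RB v} I.W.s I.W.t) h0
    (fun J => EvalF.touching_eq h0 J) fun J => ?_
  let ψ₁ : Fml k := .or (.u RA (.var 2)) (.and (.or (.eq (.var 2) (.var 0))
    (.eq (.var 2) (.var 1))) (.u RK (.var 2)))
  let φ : ℕ → Fml k := fun i => .or (.neg (.u RK (.var i))) (.and
    (.neg (.eq (.var 2) (.var i))) (.neg (.adj (.var i) (.var 2))))
  let ψ₂ : Fml k := .and (.u RB (.var 2)) (.and (φ 0) (φ 1))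
  have h : EvalF (𝒢 := 𝒢) Bool.false 2 (fun _ _ _ => True) (fun I S ρ =>
      (Jᶜ ≠ Set.univ ∧ SolvableOn I.G Jᶜ (ψ₁.set 2 I S ρ) I.W.s I.W.t) ∧
      J ≠ Set.univ ∧ SolvableOn I.G J (ψ₂.set 2 I S ρ) I.W.s I.W.t) (d - 1 - 1) := by
    refine EvalF.and ?_ ?_
    · exact EvalF.subproblem (ψ := ψ₁) hher hc ih (by linarith) (by simp [ψ₁, Fml.Below, Term.Below])
        (by simp [ψ₁, Fml.depth]; linarith) Jᶜ (a := .src) (b := .tgt) (fun _ => trivial)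
        (fun _ => trivial) fun I _ _ _ i _ => I.ne i i
    · exact EvalF.subproblem (ψ := ψ₂) hher hc ih (by linarith)
        (by simp [ψ₂, φ, Fml.Below, Term.Below]) (by simp [ψ₂, φ, Fml.depth]; linarith) J
        (a := .src) (b := .tgt) (fun _ => trivial) (fun _ => trivial) fun I _ _ _ i _ => I.ne i i
  refine ((EvalF.ex h (P := fun _ _ _ => True) fun _ _ _ _ _ => trivial).ex
    (P := fun _ _ _ => True) fun _ _ _ _ _ => trivial).weaken le_rfl (fun _ _ _ _ => trivial) ?_
  rintro I S ρ ⟨-, hJ⟩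
  rw [hJ]
  have e₁ : ∀ x y, ψ₁.set 2 I S (Function.update (Function.update ρ 0 x) (0 + 1) y) =
      {v | S.u RA v} ∪ ({x, y} ∩ {v | S.u RK v}) := fun x y => by
    ext v; simp [ψ₁, Fml.set, Fml.sat, Term.val]
  have e₂ : ∀ x y, ψ₂.set 2 I S (Function.update (Function.update ρ 0 x) (0 + 1) y) =
      {v ∈ {v | S.u RB v} | ∀ z ∈ ({x, y} : Set _) ∩ {v | S.u RK v}, v ∈ far I.G z} :=
    fun x y => by
      ext v
      have : v ∈ ψ₂.set 2 I S (Function.update (Function.update ρ 0 x) (0 + 1) y) ↔ S.u RB v ∧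
          (¬ S.u RK x ∨ ¬ v = x ∧ ¬ I.G.Adj x v) ∧ (¬ S.u RK y ∨ ¬ v = y ∧ ¬ I.G.Adj y v) := by
        simp [ψ₂, φ, Fml.set, Fml.sat, Term.val]
      refine this.trans (and_congr_right fun _ => ⟨?_, fun h => ⟨?_, ?_⟩⟩)
      · rintro ⟨h1, h2⟩ z ⟨rfl | rfl, hz⟩
        exacts [h1.resolve_left (not_not.2 hz), h2.resolve_left (not_not.2 hz)]
      · exact or_iff_not_imp_left.2 fun hx => h x ⟨.inl rfl, not_not.1 hx⟩
      · exact or_iff_not_imp_left.2 fun hy => h y ⟨.inr rfl, not_not.1 hy⟩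
  simp only [e₁, e₂, SplitUncrossed, hJ]
  constructor
  · rintro ⟨x, y, ⟨h1, h2⟩, h3, h4⟩
    exact ⟨⟨h1, h3⟩, x, y, h2, h4⟩
  · rintro ⟨⟨h1, h3⟩, x, y, h2, h4⟩
    exact ⟨x, y, ⟨h1, h2⟩, h3, h4⟩

/-- Costs are as in `EvalF.splitUncrossed`. In the instances for the two halves a terminal of `o` is
replaced by `x` or `y`; the separation guarantees that the new terminal in `K` differs from the old
one in `A` or `B`, as the calls require. -/
theorem EvalF.splitCrossed (o : Fin k)
    (hP : ∀ I S ρ, P I S ρ → Separation I.G {v | S.u RA v} {v | S.u RK v} {v | S.u RB v}) :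
    EvalF Bool.false 0 P (fun I S _ =>
    (insert o (touching {v | S.u RB v} I.W.s I.W.t)ᶜ ≠ Set.univ ∧
      touching {v | S.u RB v} I.W.s I.W.t ≠ Set.univ) ∧
    SplitCrossed I.G {v | S.u RA v} {v | S.u RK v} {v | S.u RB v} I.W.s I.W.t o) d := by
  have hk' : (2 : ℝ) ≤ k := by exact_mod_cast hk
  have h0 : 0 ≤ d := by linarith
  refine EvalF.cases (fun I S _ => touching {v | S.u RB v} I.W.s I.W.t) h0
    (fun J => EvalF.touching_eq h0 J) fun J => ?_
  let ψ : ℕ → ℕ → ℕ → Fml k := fun R i j => .or (.and (.u R (.var 2))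
    (.or (.eq (.var 0) (.var 1)) (.neg (.adj (.var 2) (.var j))))) (.eq (.var 2) (.var i))
  have hb : ∀ R, ∀ i < 2, ∀ j < 2, (ψ R i j).Below (2 + 1) := fun R i hi j hj => by
    simp [ψ, Fml.Below, Term.Below]; omega
  have hdep : ∀ R i j, ((ψ R i j).depth : ℝ) + 1 ≤ d - 1 - 1 := fun R i j => by
    simp [ψ, Fml.depth]; linarith
  let a : Fin k → Term k := fun i => if i = o then .var 1 else .src i
  let b : Fin k → Term k := fun i => if i = o then .var 0 else .tgt i
  let Q : Pred 𝒢 k := fun I S _ => (Disjoint {v | S.u RA v} {v | S.u RK v} ∧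
    Disjoint {v | S.u RB v} {v | S.u RK v}) ∧ S.u RA (I.W.s o) ∧ S.u RB (I.W.t o)
  have h : EvalF (𝒢 := 𝒢) Bool.false 2 Q (fun I S ρ =>
      S.u RK (ρ 0) ∧ S.u RK (ρ 1) ∧
      (insert o Jᶜ ≠ Set.univ ∧ SolvableOn I.G (insert o Jᶜ) ((ψ RA 0 1).set 2 I S ρ) I.W.s
        (fun i => (b i).val I ρ)) ∧
      J ≠ Set.univ ∧ SolvableOn I.G J ((ψ RB 1 0).set 2 I S ρ) (fun i => (a i).val I ρ) I.W.t)
      (d - 1 - 1) := by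
    refine (EvalF.un (by linarith) RK (a := .var 0) (by simp [Term.Below])).and
      ((EvalF.un (by linarith) RK (a := .var 1) (by simp [Term.Below])).and (EvalF.and ?_ ?_))
    · refine EvalF.subproblem (ψ := ψ RA 0 1) hher hc ih (by linarith)
        (hb _ _ (by omega) _ (by omega)) (hdep _ _ _) (insert o Jᶜ) (a := .src) (b := b)
        (fun _ => trivial) (fun i => ?_) ?_
      · by_cases hi : i = o <;> simp [b, hi, Term.Below]
      · rintro I S ρ ⟨⟨⟨⟨hA, hB⟩, hs, ht⟩, hx⟩, hy⟩ i -
        by_cases hi : i = o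
        · simp only [b, hi, if_true, Term.val]
          exact fun e => Set.disjoint_left.1 hA hs (e ▸ hx)
        · simp only [b, hi, if_false, Term.val]
          exact I.ne i i
    · refine EvalF.subproblem (ψ := ψ RB 1 0) hher hc ih (by linarith)
        (hb _ _ (by omega) _ (by omega)) (hdep _ _ _) J (a := a) (b := .tgt)
        (fun i => ?_) (fun _ => trivial) ?_
      · by_cases hi : i = o <;> simp [a, hi, Term.Below]
      · rintro I S ρ ⟨⟨⟨⟨⟨hA, hB⟩, hs, ht⟩, hx⟩, hy⟩, -⟩ i -
        by_cases hi : i = o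
        · simp only [a, hi, if_true, Term.val]
          exact fun e => Set.disjoint_left.1 hB ht (e ▸ hy)
        · simp only [a, hi, if_false, Term.val]
          exact I.ne i i
  have h' := (EvalF.ex h (P := Q) fun _ _ _ _ h => h).ex (P := Q) fun _ _ _ _ h => h
  refine ((EvalF.un h0 RA (a := .src o) trivial).and ((EvalF.un h0 RB (a := .tgt o) trivial).and
    (h'.pre ?_))).congr ?_
  · rintro I S ρ ⟨⟨⟨hp, -⟩, hs⟩, ht⟩
    exact ⟨⟨(hP _ _ _ hp).disjAK, (hP _ _ _ hp).disjBK⟩, hs, ht⟩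
  rintro I S ρ ⟨-, hJ⟩
  rw [hJ]
  have e₁ : ∀ x y, (ψ RA 0 1).set 2 I S (Function.update (Function.update ρ 0 x) (0 + 1) y) =
      {v | v ∈ {v | S.u RA v} ∧ (x = y ∨ ¬ I.G.Adj v y) ∨ v = x} := fun x y => by
    ext v; simp [ψ, Fml.set, Fml.sat, Term.val]
  have e₂ : ∀ x y, (ψ RB 1 0).set 2 I S (Function.update (Function.update ρ 0 x) (0 + 1) y) =
      {v | v ∈ {v | S.u RB v} ∧ (x = y ∨ ¬ I.G.Adj v x) ∨ v = y} := fun x y => by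
    ext v; simp [ψ, Fml.set, Fml.sat, Term.val]
  classical
  have e₃ : ∀ x y, (fun i => (b i).val I (Function.update (Function.update ρ 0 x) (0 + 1) y)) =
      Function.update I.W.t o x := fun x y => by
    funext i
    by_cases hi : i = o
    · subst hi; simp [b, Term.val]
    · simp [b, hi, Term.val]
  have e₄ : ∀ x y, (fun i => (a i).val I (Function.update (Function.update ρ 0 x) (0 + 1) y)) =
      Function.update I.W.s o y := fun x y => by
    funext i
    by_cases hi : i = o
    · subst hi; simp [a, Term.val]
    · simp [a, hi, Term.val]
  have e₅ : ∀ x y, Function.update (Function.update ρ 0 x) (0 + 1) y 0 = x ∧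
      Function.update (Function.update ρ 0 x) (0 + 1) y 1 = y := fun x y => by simp
  simp only [e₁, e₂, e₃, e₄, e₅, SplitCrossed, hJ]
  constructor
  · rintro ⟨hs, ht, x, y, hx, hy, ⟨h1, h2⟩, h3, h4⟩
    refine ⟨⟨h1, h3⟩, hs, ht, x, hx, y, hy, ?_, ?_⟩
    · convert h2
    · convert h4
  · rintro ⟨⟨h1, h3⟩, hs, ht, x, hx, y, hy, h2, h4⟩
    refine ⟨hs, ht, x, y, hx, hy, ⟨h1, ?_⟩, h3, ?_⟩
    · convert h2
    · convert h4

/-- The conditions that the index sets are proper, which the calls need, are no loss: with two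
terminals on either side they follow from solvability. -/
theorem EvalF.split : EvalF (𝒢 := 𝒢) (k := k) Bool.false 0 (fun I S _ => Split I S)
    (fun I _ _ => I.W.HasSolution) d := by
  have h0 : 0 ≤ d := by
    have : (0 : ℝ) ≤ k := by positivity
    linarith
  refine ((EvalF.splitUncrossed (RA := 2) (RK := 3) (RB := 4) hher hc ih hk hd).or
    ((EvalF.splitUncrossed (RA := 4) (RK := 3) (RB := 2) hher hc ih hk hd).or
    ((EvalF.any h0 fun o => EvalF.splitCrossed (RA := 2) (RK := 3) (RB := 4) hher hc ih hk hd o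
      fun _ _ _ h => h.sep).or
    (EvalF.any h0 fun o => EvalF.splitCrossed (RA := 4) (RK := 3) (RB := 2) hher hc ih hk hd o
      fun _ _ _ h => h.sep.symm)))).congr fun I S ρ h => ?_
  rw [I.W.hasSolution_iff]
  constructor
  · rintro (h' | h' | ⟨o, h'⟩ | ⟨o, h'⟩)
    exacts [h.sep.of_uncrossed h'.2, h.sep.symm.of_uncrossed h'.2, h.sep.of_crossed h'.2,
      h.sep.symm.of_crossed h'.2]
  · intro hsol
    have hA := h.left.exists_index
    have hB := h.right.exists_index
    have hA1 : ∃ a : Fin k ⊕ Fin k, Sum.elim I.W.s I.W.t a ∈ {v | S.u 2 v} :=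
      let ⟨a, _, _, ha, _⟩ := hA; ⟨a, ha⟩
    have hB1 : ∃ a : Fin k ⊕ Fin k, Sum.elim I.W.s I.W.t a ∈ {v | S.u 4 v} :=
      let ⟨a, _, _, ha, _⟩ := hB; ⟨a, ha⟩
    have hK : ∃ a, a ∉ {v | S.u 3 v} :=
      let ⟨_, ha⟩ := hA1; ⟨_, Set.disjoint_left.1 h.sep.disjAK ha⟩
    have t1 := h.sep.touching_ne_univ hsol hA
    have t2 := h.sep.symm.touching_ne_univ hsol hB
    rcases h.sep.split hsol hK with h' | h' | ⟨o, h'⟩ | ⟨o, h'⟩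
    · exact .inl ⟨⟨compl_touching_ne_univ hB1, t1⟩, h'⟩
    · exact .inr (.inl ⟨⟨compl_touching_ne_univ hA1, t2⟩, h'⟩)
    · exact .inr (.inr (.inl ⟨o, ⟨h.sep.insert_compl_touching_ne_univ h'.1 hB, t1⟩, h'⟩))
    · exact .inr (.inr (.inr ⟨o, ⟨h.sep.symm.insert_compl_touching_ne_univ h'.1 hA, t2⟩, h'⟩))

end

end RAM

namespace RAM

variable {𝒢 : GraphClass} {k : ℕ}

/-! ## Instances without clique separator -/

section
variable {ℬ : GraphClass} {c d : ℝ}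

/-- Atoms for ternary relations accept only variables, so the terminal is first bound to one. The
third argument of relation `4` is a dummy. -/
theorem EvalF.port {pu : Bool} {ℓ i : ℕ} (hi : i < ℓ) (hd : 1 ≤ d) {a : Term k}
    (ha : a.Below ℓ) : EvalF (𝒢 := 𝒢) pu ℓ (fun I S _ => Final I S)
      (fun I S ρ => ρ i ∈ ports I.G {v | S.u 0 v} (a.val I ρ)) d := by
  refine (Fml.evalF (.ex (.and (.eq (.var ℓ) a) (.t 4 ℓ i i))) (ℓ := ℓ)
    ⟨⟨Nat.lt_succ_self ℓ, ha.mono (Nat.le_succ ℓ)⟩, Nat.lt_succ_self ℓ, by omega, by omega⟩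
    (by simpa [Fml.depth] using hd)).congr fun I S ρ h => ?_
  have e : ∀ v, (Term.var ℓ : Term k).val I (Function.update ρ ℓ v) = v := fun v =>
    Function.update_self ..
  simp [Fml.sat, e, Term.val_update ha, h.ports, hi.ne]

theorem _root_.GraphClass.DecomposableUsingCliqueCutsets.mem_basic
    (hdec : 𝒢.DecomposableUsingCliqueCutsets ℬ) {I : Input 𝒢 k} {W : Set (Fin I.n)}
    (hW : Unseparated I.G W W) {m : ℕ} (e : Fin m ↪ Fin I.n) (he : Set.range e = W) :
    I.G.comap e ∈ ℬ m := by
  subst he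
  exact (hdec.basic_or_cutset m _ (hdec.hereditary.comap_mem I.mem e)).resolve_right
    hW.not_hasCliqueCutset

/-- Solve the instance with terminals in the reduced vertex set. -/
theorem EvalF.solvable_reduced (hbasic : IDPSolvableInTime ℬ k (fun n => (n : ℝ) ^ c))
    (hdec : 𝒢.DecomposableUsingCliqueCutsets ℬ) (hc : 1 ≤ c)
    (hd : 2 * (k : ℝ) + c ≤ d) (hk : 1 ≤ k) :
    EvalF (𝒢 := 𝒢) (k := k) Bool.false 0 (fun I S _ => Final I S) (fun I S _ =>
      ∃ a b : Fin k → Fin I.n, (∀ i, a i ∈ ports I.G {v | S.u 0 v} (I.W.s i)) ∧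
        (∀ i, b i ∈ ports I.G {v | S.u 0 v} (I.W.t i)) ∧ (∀ i, a i ≠ b i) ∧
        SolvableOn I.G Set.univ {v | S.u 0 v} a b) d := by
  -- After the `2 * k` quantifiers for the ports, an exponent of at least `c` is left for the basic
  -- program; since `c ≥ 1`, it also covers the lookup of ports.
  have hd1 : 1 ≤ d - (2 * k : ℕ) := by push_cast; linarith
  have h : EvalF (𝒢 := 𝒢) (k := k) Bool.false (2 * k) (fun I S _ => Final I S) (fun I S ρ =>
      (∀ i : Fin k, ρ i ∈ ports I.G {v | S.u 0 v} (I.W.s i) ∧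
        ρ (k + i) ∈ ports I.G {v | S.u 0 v} (I.W.t i) ∧ ¬ ρ i = ρ (k + i)) ∧
      SolvableOn I.G Set.univ {v | S.u 0 v} (fun i : Fin k => ρ i) fun i : Fin k => ρ (k + i))
      (d - (2 * k : ℕ)) := by
    refine EvalF.and (EvalF.all (by linarith) fun i =>
      (EvalF.port (by omega) hd1 (a := .src i) trivial).and
      (((EvalF.port (by omega) hd1 (a := .tgt i) trivial).pre fun _ _ _ h => h.1).and
      (EvalF.eq (by linarith) (a := .var i) (b := .var (k + i))
        (by simp only [Term.Below]; omega) (by simp only [Term.Below]; omega)).not)) ?_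
    refine (EvalF.solvable (ψ := .u 0 (.var (2 * k))) hbasic (by linarith)
      (by push_cast; linarith) (by simp [Fml.Below, Term.Below]) (by simpa [Fml.depth] using hd1)
      (a := fun i => .var i) (b := fun i => .var (k + i))
      (fun i => by simp only [Term.Below]; omega) (fun i => by simp only [Term.Below]; omega)
      (fun I S ρ h i => (h.2 i).2.2) ?_).congr ?_
    · intro I S ρ h m e he
      refine hdec.mem_basic h.1.unseparated e (he.trans ?_)
      ext v; simp [Fml.set, Fml.sat, Term.val]
    · intro I S ρ _
      have : (Fml.u 0 (.var (2 * k))).set (2 * k) I S ρ = {v | S.u 0 v} := by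
        ext v; simp [Fml.set, Fml.sat, Term.val]
      rw [this]
      rfl
  refine (EvalF.exs ?_ (fun _ _ _ _ h => h) h).congr fun I S ρ _ => ⟨?_, ?_⟩
  · intro I S ρ ρ' hρ h
    have e : ∀ i : Fin k, ρ' i = ρ i ∧ ρ' (k + i) = ρ (k + i) := fun i =>
      ⟨(hρ _ (by omega)).symm, (hρ _ (by omega)).symm⟩
    simpa only [e] using h
  · rintro ⟨ρ, h, h'⟩
    exact ⟨_, _, fun i => (h i).1, fun i => (h i).2.1, fun i => (h i).2.2, h'⟩
  · rintro ⟨a, b, ha, hb, hab, h⟩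
    let ρ' : ℕ → Fin I.n := fun x =>
      if hx : x < k then a ⟨x, hx⟩ else if hx : x - k < k then b ⟨x - k, hx⟩ else a ⟨0, hk⟩
    have e : ∀ i : Fin k, ρ' i = a i ∧ ρ' (k + i) = b i := fun i => by simp [ρ']
    refine ⟨ρ', ?_⟩
    simp only [e]
    exact ⟨fun i => ⟨ha i, hb i, hab i⟩, h⟩

/-- The disjunction of `solvable_ports`: distinct ports throughout, or a pair `i` with a common port
`x`. The second case is cheaper, with one quantifier and `k - 1` remaining pairs. -/
theorem EvalF.final (hbasic : IDPSolvableInTime ℬ k (fun n => (n : ℝ) ^ c))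
    (hdec : 𝒢.DecomposableUsingCliqueCutsets ℬ) (hc : 1 ≤ c)
    (ih : ∀ m, 1 ≤ m → m < k → IDPSolvableInTime 𝒢 m (fun n => (n : ℝ) ^ (2 * (m : ℝ) + c)))
    (hk : 2 ≤ k) (hd : 2 * (k : ℝ) + c ≤ d) :
    EvalF (𝒢 := 𝒢) (k := k) Bool.false 0 (fun I S _ => Final I S)
      (fun I _ _ => I.W.HasSolution) d := by
  have hk' : (2 : ℝ) ≤ k := by exact_mod_cast hk
  have h0 : 0 ≤ d := by linarith
  let ψ : Fml k := .and (.neg (.eq (.var 1) (.var 0))) (.neg (.adj (.var 0) (.var 1)))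
  have h : ∀ i : Fin k, EvalF (𝒢 := 𝒢) (k := k) Bool.false 1 (fun I S _ => Final I S)
      (fun I S ρ => ρ 0 ∈ ports I.G {v | S.u 0 v} (I.W.s i) ∧
        ρ 0 ∈ ports I.G {v | S.u 0 v} (I.W.t i) ∧
        ({i}ᶜ : Set (Fin k)) ≠ Set.univ ∧
        SolvableOn I.G {i}ᶜ (ψ.set 1 I S ρ) I.W.s I.W.t) (d - 1) := fun i =>
    (EvalF.port (by omega) (by linarith) (a := .src i) trivial).and
      (((EvalF.port (by omega) (by linarith) (a := .tgt i) trivial).pre fun _ _ _ h => h.1).and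
      (EvalF.subproblem (ψ := ψ) hdec.hereditary (by linarith) ih (by linarith)
        (by simp [ψ, Fml.Below, Term.Below]) (by simp [ψ, Fml.depth]; linarith) {i}ᶜ
        (a := .src) (b := .tgt) (fun _ => trivial) (fun _ => trivial)
        fun I _ _ _ i _ => I.ne i i))
  refine ((EvalF.solvable_reduced hbasic hdec hc hd (by omega)).or (EvalF.any h0 fun i => EvalF.ex (h i)
    (P := fun I S _ => Final I S) fun _ _ _ _ h => h)).congr fun I S ρ hf => ?_
  have e : ∀ x, ψ.set 1 I S (Function.update ρ 0 x) = far I.G x := fun x => by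
    ext v; simp [ψ, Fml.set, Fml.sat, Term.val, far]
  have hne : ∀ i : Fin k, ({i}ᶜ : Set (Fin k)) ≠ Set.univ := fun i h =>
    (h.symm.subset (Set.mem_univ i) : i ∈ ({i}ᶜ : Set (Fin k))) rfl
  simp only [e, Function.update_self, hne, ne_eq, not_false_eq_true, true_and]
  rw [I.W.hasSolution_iff]
  constructor
  · rintro (⟨a, b, ha, hb, -, h⟩ | ⟨i, x, hs, ht, h⟩)
    · exact solvable_of_ports hf.reduced I.W.distinct ha hb h
    · exact solvable_of_common_port hf.reduced I.W.distinct hs ht h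
  · exact solvable_ports hf.reduced I.W.distinct

/-- The induction step on the number of pairs. -/
theorem solvable_step (hbasic : IDPSolvableInTime ℬ k (fun n => (n : ℝ) ^ c))
    (hdec : 𝒢.DecomposableUsingCliqueCutsets ℬ) (hc : 1 ≤ c)
    (ih : ∀ m, 1 ≤ m → m < k → IDPSolvableInTime 𝒢 m (fun n => (n : ℝ) ^ (2 * (m : ℝ) + c)))
    (hk : 2 ≤ k) : IDPSolvableInTime 𝒢 k (fun n => (n : ℝ) ^ (2 * (k : ℝ) + c)) := by
  have hk' : (2 : ℝ) ≤ k := by exact_mod_cast hk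
  refine solvable_of_cmd (by omega) (by linarith) Com.below_prepare
    -- The exponent `5` of the preparation is at most `2 * k + c` because `k ≥ 2` and `c ≥ 1`.
    (by rw [Com.deg_prepare]; push_cast; linarith) ?_
  refine EvalF.ite (Fml.evalF (.ex (.u 1 (.var 0))) (by simp [Fml.Below, Term.Below])
    (by simp [Fml.depth]; linarith))
    ((EvalF.split hdec.hereditary (by linarith) ih hk le_rfl).pre ?_)
    ((EvalF.final hbasic hdec hc ih hk le_rfl).pre ?_)
  · rintro I S ρ ⟨hS, v, hv⟩
    rw [hS] at hv ⊢
    exact Com.run_prepare.resolve_right fun h => h.flag _ hv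
  · rintro I S ρ ⟨hS, hv⟩
    rw [hS] at hv ⊢
    exact Com.run_prepare.resolve_left fun h => hv ⟨ρ 0, h.flag _⟩

/-- For a single pair it suffices to compute a component. -/
theorem solvable_one (hd : 3 ≤ d) : IDPSolvableInTime 𝒢 1 (fun n => (n : ℝ) ^ d) := by
  refine solvable_of_cmd (c := .seq (.setU 1 .tr) (.seq (.setU 0 (.eq (.var 0) (.src 0)))
    (.close 0 0 1))) le_rfl (by linarith)
    (by simp [Com.close, Com.grow, Com.Below, Fml.Below, Term.Below])
    (by simp [Com.close, Com.grow, Com.deg, Fml.depth]; linarith) ?_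
  refine (EvalF.un (by linarith) 0 (a := .tgt 0) trivial).congr ?_
  rintro I S ρ rfl
  simp only [Com.run]
  rw [Com.run_close (by omega) (by simp [Fml.sat]), I.W.hasSolution_iff]
  simp only [Store.setU_self, ne_eq, one_ne_zero, not_false_eq_true, Store.setU_ne, Fml.sat,
    Term.val, Function.update_self]
  constructor
  · rintro ⟨_, rfl, h⟩
    refine ⟨fun _ => Set.univ, fun j _ => ⟨subset_rfl, ?_⟩, fun i _ j _ hij =>
      absurd (Subsingleton.elim i j) hij⟩
    rw [Subsingleton.elim j 0]
    exact h.mono (Set.subset_univ _)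
  · rintro ⟨X, h, -⟩
    exact ⟨_, rfl, (h 0 trivial).2.mono fun _ _ => by simp⟩

end

end RAM

/-! ### The induction on the number of pairs -/

theorem mainTheorem4 (𝒢 ℬ : GraphClass) (hdec : 𝒢.DecomposableUsingCliqueCutsets ℬ)
    (c : ℝ) (hc : 1 ≤ c)
    (hbasic : ∀ k : ℕ, 1 ≤ k → IDPSolvableInTime ℬ k (fun n => (n : ℝ) ^ c)) :
    ∀ k : ℕ, 1 ≤ k → IDPSolvableInTime 𝒢 k (fun n => (n : ℝ) ^ (2 * (k : ℝ) + c)) := by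
  intro k
  induction k using Nat.strong_induction_on with
  | _ k ih =>
    intro hk
    rcases hk.eq_or_lt with rfl | hk'
    · exact RAM.solvable_one (by push_cast; linarith)
    · exact RAM.solvable_step (hbasic k hk) hdec hc (fun m h1 h2 => ih m h2 h1) hk'
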